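/- Let $G_n$ be the path graph with vertex set $\{0,1/n,2/n,\dots,1\}$ and edges $\{(j-1)/n,j/n\}$, $1\le j\le n$. For $\mathcal{B}_n\in\mathbb{R}$ and $\theta_0,\theta_1\in(-\pi,\pi]$, consider the XY model on $G_n$ with Dirichlet boundary condition $(\theta_0,\theta_1)$ and inverse temperature $\mathcal{B}_n$: the probability measure $$Z_{G_n}^{-1}(\theta_0,\theta_1)\,\exp\Big(\mathcal{B}_n\sum_{j=1}^{n}\cos\big(\theta^n_{j/n}-\theta^n_{(j-1)/n}\big)\Big)\prod_{j=1}^{n-1}d\theta^n_{j/n}\;\delta(\theta^n_0=\theta_0)\,\delta(\theta^n_1=\theta_1)$$ on families of angles in $(-\pi,\pi]$, where $Z_{G_n}(\theta_0,\theta_1)$ is the normalizing constant. Write $S^n_j=e^{i\theta^n_{j/n}}$ for $0\le j\le n$. Suppose that $\mathcal{B}_n/n\to b\in(0,\infty)$ as $n\to\infty$. (1) For all $\theta_0,\theta_1\in(-\pi,\pi]$, the process $(S^n_{\lfloor nt\rfloor})_{0\le t\le 1}$ converges in distribution, in the space of càdlàg paths $[0,1]\to\mathbb{S}^1$ with the Skorokhod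 ($J_1$) metric, to $S(t)=e^{iB(t)/\sqrt b}$, where $B$ is a standard one-dimensional Brownian motion started from a point $B(0)$ with $e^{iB(0)/\sqrt b}=e^{i\theta_0}$ and conditioned on $e^{iB(1)/\sqrt b}=e^{i\theta_1}$. The conditional law of $S$ is understood as the weak limit, as $\varepsilon\downarrow0$, of the laws of $(e^{iB(t)/\sqrt b})_{0\le t\le1}$ given the events $\{|e^{iB(1)/\sqrt b}-e^{i\theta_1}|<\varepsilon\}$, and part of the claim is that this limit exists. (2) For all $\theta_0,\theta_1,\theta_0',\theta_1'\in(-\pi,\pi]$, as $n\to\infty$, $$\frac{Z_{G_n}(\theta_0,\theta_1)}{Z_{G_n}(\theta_0',\theta_1')}\longrightarrow\frac{\sum_{m\in\mathbb{Z}}\exp\left(-\frac{b}{2}(\theta_1-\theta_0+2\pi m)^2\right)}{\sum_{m\in\mathbb{Z}}\exp\left(-\frac{b}{2}(\theta_1'-\theta_0'+2\pi m)^2\right)}.$$ -/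

import Mathlib

open MeasureTheory ProbabilityTheory Filter Topology

noncomputable section

namespace XYChain

/-! ### The Skorokhod space of càdlàg paths -/

/-- A path on `[0,1]` is càdlàg if it is right-continuous and has left limits. -/
def IsCadlag {E : Type*} [TopologicalSpace E] (f : unitInterval → E) : Prop :=
  ∀ t, ContinuousWithinAt f (Set.Ici t) t ∧ ∃ l, Tendsto f (𝓝[<] t) (𝓝 l)

/-- The space `D([0,1], E)` of càdlàg paths. -/
def SkorokhodSpace (E : Type*) [TopologicalSpace E] : Type _ :=
  {f : unitInterval → E // IsCadlag f}

instance {E : Type*} [TopologicalSpace E] :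
    CoeFun (SkorokhodSpace E) (fun _ => unitInterval → E) := ⟨Subtype.val⟩

/-- The Skorokhod (J1) distance
`inf_λ max (sup_t |λ t - t|) (sup_t d(x t, y (λ t)))`, the infimum being over all increasing
bijections `λ` of `[0,1]`. -/
instance {E : Type*} [PseudoEMetricSpace E] : PseudoEMetricSpace (SkorokhodSpace E) where
  edist x y := ⨅ l : unitInterval ≃o unitInterval,
    max (⨆ t, edist (l t) t) (⨆ t, edist (x t) (y (l t)))
  edist_self x := by
    refine le_antisymm (iInf_le_of_le (OrderIso.refl _) ?_) zero_le
    simp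
  edist_comm x y := by
    have key : ∀ x y : SkorokhodSpace E,
        (⨅ l : unitInterval ≃o unitInterval,
          max (⨆ t, edist (l t) t) (⨆ t, edist (x t) (y (l t)))) ≤
        ⨅ l : unitInterval ≃o unitInterval,
          max (⨆ t, edist (l t) t) (⨆ t, edist (y t) (x (l t))) := by
      intro x y
      refine le_iInf fun l => iInf_le_of_le l.symm (max_le_max ?_ ?_)
      · refine iSup_le fun t => le_iSup_of_le (l.symm t) ?_
        rw [OrderIso.apply_symm_apply, edist_comm]
      · refine iSup_le fun t => le_iSup_of_le (l.symm t) ?_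
        rw [OrderIso.apply_symm_apply, edist_comm]
    exact le_antisymm (key x y) (key y x)
  edist_triangle x y z := by
    simp only [ENNReal.iInf_add, ENNReal.add_iInf]
    refine le_iInf fun m => le_iInf fun l => iInf_le_of_le (l.trans m) (max_le ?_ ?_)
    · refine iSup_le fun t => ?_
      calc edist ((l.trans m) t) t ≤ edist (m (l t)) (l t) + edist (l t) t := edist_triangle _ _ _
        _ = edist (l t) t + edist (m (l t)) (l t) := add_comm _ _
        _ ≤ max (⨆ t, edist (l t) t) (⨆ t, edist (x t) (y (l t))) +
            max (⨆ t, edist (m t) t) (⨆ t, edist (y t) (z (m t))) :=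
          add_le_add ((le_iSup (fun t => edist (l t) t) t).trans (le_max_left _ _))
            ((le_iSup (fun t => edist (m t) t) (l t)).trans (le_max_left _ _))
    · refine iSup_le fun t => ?_
      calc edist (x t) (z ((l.trans m) t))
          ≤ edist (x t) (y (l t)) + edist (y (l t)) (z (m (l t))) := edist_triangle _ _ _
        _ ≤ _ := add_le_add
            ((le_iSup (fun t => edist (x t) (y (l t))) t).trans (le_max_right _ _))
            ((le_iSup (fun t => edist (y t) (z (m t))) (l t)).trans (le_max_right _ _))

instance {E : Type*} [PseudoEMetricSpace E] : MeasurableSpace (SkorokhodSpace E) := borel _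

instance {E : Type*} [PseudoEMetricSpace E] : BorelSpace (SkorokhodSpace E) := ⟨rfl⟩

/-! ### The XY chain with Dirichlet boundary condition

The vertex `j / n` of the chain with `n` edges is indexed by `j : Fin (n + 1)`. -/

/-- The Hamiltonian of the chain, as a function of the angles of the spins. -/
def hamiltonian (n : ℕ) (θ : Fin (n + 1) → ℝ) : ℝ :=
  -∑ j : Fin n, Real.cos (θ j.castSucc - θ j.succ)

/-- The reference measure at a vertex: a point mass at the two ends, Lebesgue measure on
`(-π, π]` at the interior vertices. -/
def siteMeasure (n : ℕ) (θ₀ θ₁ : ℝ) (j : Fin (n + 1)) : Measure ℝ :=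
  if j = 0 then Measure.dirac θ₀
  else if j = Fin.last n then Measure.dirac θ₁
  else volume.restrict (Set.Ioc (-Real.pi) Real.pi)

instance (n : ℕ) (θ₀ θ₁ : ℝ) (j : Fin (n + 1)) : IsFiniteMeasure (siteMeasure n θ₀ θ₁ j) := by
  unfold siteMeasure
  split_ifs <;> infer_instance

/-- The product reference measure `∏ dθ_i δ(θ_0 = θ₀) δ(θ_n = θ₁)`. -/
def referenceMeasure (n : ℕ) (θ₀ θ₁ : ℝ) : Measure (Fin (n + 1) → ℝ) :=
  Measure.pi (siteMeasure n θ₀ θ₁)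

/-- The partition function at inverse temperature `β`. -/
def partitionFunction (n : ℕ) (β θ₀ θ₁ : ℝ) : ℝ :=
  ∫ θ, Real.exp (-β * hamiltonian n θ) ∂referenceMeasure n θ₀ θ₁

/-- The Gibbs measure of the chain at inverse temperature `β`. -/
def gibbsMeasure (n : ℕ) (β θ₀ θ₁ : ℝ) : Measure (Fin (n + 1) → ℝ) :=
  (referenceMeasure n θ₀ θ₁).withDensity fun θ =>
    ENNReal.ofReal (Real.exp (-β * hamiltonian n θ) / partitionFunction n β θ₀ θ₁)

instance (n : ℕ) (θ₀ θ₁ : ℝ) : IsFiniteMeasure (referenceMeasure n θ₀ θ₁) := by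
  unfold referenceMeasure
  infer_instance

lemma siteMeasure_ne_zero (n : ℕ) (θ₀ θ₁ : ℝ) (j : Fin (n + 1)) :
    siteMeasure n θ₀ θ₁ j ≠ 0 := by
  unfold siteMeasure
  split_ifs
  · exact NeZero.ne _
  · exact NeZero.ne _
  · rw [Ne, Measure.restrict_eq_zero, Real.volume_Ioc, ENNReal.ofReal_eq_zero, not_le]
    linarith [Real.pi_pos]

instance (n : ℕ) (θ₀ θ₁ : ℝ) : NeZero (referenceMeasure n θ₀ θ₁) := by
  refine ⟨fun h => ?_⟩
  have h1 : referenceMeasure n θ₀ θ₁ Set.univ = 0 := by rw [h]; rfl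
  rw [referenceMeasure, Measure.pi_univ, Finset.prod_eq_zero_iff] at h1
  obtain ⟨j, -, hj⟩ := h1
  exact siteMeasure_ne_zero n θ₀ θ₁ j (Measure.measure_univ_eq_zero.1 hj)

lemma integrable_exp_hamiltonian (n : ℕ) (β θ₀ θ₁ : ℝ) :
    Integrable (fun θ => Real.exp (-β * hamiltonian n θ)) (referenceMeasure n θ₀ θ₁) := by
  refine Integrable.of_bound (C := Real.exp (|β| * n)) ?_ (ae_of_all _ fun θ => ?_)
  · refine Continuous.aestronglyMeasurable ?_
    unfold hamiltonian
    fun_prop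
  · rw [Real.norm_eq_abs, Real.abs_exp, Real.exp_le_exp]
    refine (le_abs_self _).trans ?_
    rw [abs_mul, abs_neg]
    refine mul_le_mul_of_nonneg_left ?_ (abs_nonneg _)
    rw [hamiltonian, abs_neg]
    refine (Finset.abs_sum_le_sum_abs _ _).trans ?_
    refine (Finset.sum_le_sum fun j _ => Real.abs_cos_le_one _).trans ?_
    simp

instance (n : ℕ) (β θ₀ θ₁ : ℝ) : IsProbabilityMeasure (gibbsMeasure n β θ₀ θ₁) :=
  isProbabilityMeasure_tilted (integrable_exp_hamiltonian n β θ₀ θ₁)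

lemma floor_lt (n : ℕ) (t : unitInterval) : ⌊(n : ℝ) * t⌋₊ < n + 1 := by
  rw [Nat.lt_succ_iff]
  exact Nat.floor_le_of_le (mul_le_of_le_one_right (Nat.cast_nonneg n) t.2.2)

lemma isCadlag_step {E : Type*} [TopologicalSpace E] (n : ℕ) (g : Fin (n + 1) → E) :
    IsCadlag fun t : unitInterval => g ⟨⌊(n : ℝ) * t⌋₊, floor_lt n t⟩ := by
  intro t
  have hc : Continuous fun s : unitInterval => (n : ℝ) * (s : ℝ) := by fun_prop
  have hn : (0 : ℝ) ≤ n := Nat.cast_nonneg n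
  refine ⟨?_, ?_⟩
  · refine Tendsto.congr' ?_ tendsto_const_nhds
    have h1 : ∀ᶠ s : unitInterval in 𝓝[≥] t, (n : ℝ) * s < ⌊(n : ℝ) * t⌋₊ + 1 :=
      (hc.continuousAt.eventually_lt continuousAt_const
        (Nat.lt_floor_add_one _)).filter_mono nhdsWithin_le_nhds
    filter_upwards [h1, self_mem_nhdsWithin] with s hs hst
    congr 2
    refine ((Nat.floor_eq_iff (mul_nonneg hn s.2.1)).2 ⟨?_, hs⟩).symm
    exact (Nat.floor_le (mul_nonneg hn t.2.1)).trans (mul_le_mul_of_nonneg_left hst hn)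
  · refine ⟨g ⟨⌈(n : ℝ) * t⌉₊ - 1, ?_⟩, Tendsto.congr' ?_ tendsto_const_nhds⟩
    · have : ⌈(n : ℝ) * t⌉₊ ≤ n := Nat.ceil_le.2 (mul_le_of_le_one_right hn t.2.2)
      omega
    · have h1 : ∀ᶠ s : unitInterval in 𝓝[<] t, (⌈(n : ℝ) * t⌉₊ : ℝ) - 1 < n * s := by
        refine (continuousAt_const.eventually_lt hc.continuousAt ?_).filter_mono
          nhdsWithin_le_nhds
        linarith [Nat.ceil_lt_add_one (mul_nonneg hn t.2.1)]
      filter_upwards [h1, self_mem_nhdsWithin] with s hs hst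
      have hst' : (s : ℝ) < t := hst
      congr 2
      refine ((Nat.floor_eq_iff (mul_nonneg hn s.2.1)).2 ?_).symm
      rcases Nat.eq_zero_or_pos n with rfl | hpos
      · simp
      · have h2 : (n : ℝ) * s < n * t := mul_lt_mul_of_pos_left hst' (Nat.cast_pos.2 hpos)
        have h3 : 0 < ⌈(n : ℝ) * t⌉₊ :=
          Nat.ceil_pos.2 ((mul_nonneg hn s.2.1).trans_lt h2)
        rw [Nat.cast_sub h3, Nat.cast_one]
        refine ⟨hs.le, ?_⟩
        linarith [Nat.le_ceil ((n : ℝ) * t)]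

/-- The rescaled path `t ↦ S_{[nt]}` of the chain, where the spin at a vertex with angle `θ_j`
is `exp (i θ_j)`. -/
def spinPath (n : ℕ) (θ : Fin (n + 1) → ℝ) : SkorokhodSpace Circle :=
  ⟨fun t => Circle.exp (θ ⟨⌊(n : ℝ) * t⌋₊, floor_lt n t⟩),
    isCadlag_step n fun j => Circle.exp (θ j)⟩

/-! ### Conditioning on the value of a random variable -/

/-- `ν` is the law of `X` conditioned on `Y = y` (an event that may have probability zero): the
weak limit, as `ε ↓ 0`, of the conditional laws of `X` given the events `dist Y y < ε`, which
are required to have positive probability. -/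
def IsConditionalLaw {Ω E F : Type*} [MeasurableSpace Ω] [TopologicalSpace E] [MeasurableSpace E]
    [PseudoMetricSpace F] (P : Measure Ω) (X : Ω → E) (Y : Ω → F) (y : F)
    (ν : ProbabilityMeasure E) : Prop :=
  AEMeasurable X P ∧
  (∀ ε > (0 : ℝ), P {ω | dist (Y ω) y < ε} ≠ 0) ∧
  ∀ f : BoundedContinuousFunction E ℝ,
    Tendsto (fun ε : ℝ => ∫ ω, f (X ω) ∂(P[|{ω | dist (Y ω) y < ε}])) (𝓝[>] 0)
      (𝓝 (∫ x, f x ∂(ν : Measure E)))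

end XYChain

end

/-! Modulo `2π` the chain is a random walk bridge. Each edge carries the weight `exp (β cos x)`, so
the angles are those of a walk with independent steps of law `stepLaw β`, started at `θ₀` and
conditioned to end at `θ₁`. The partition function is `stepMass β ^ n` times the `n`-step density
`chainKernel β n` at `exp (i(θ₀ - θ₁))` (`ofReal_partitionFunction`). Averaging over rotations is
diagonal in the characters `z ^ k`, so the whole model is governed by the coefficients `c_k =
stepCoeff β k`.

Local limit. Integration by parts (`mul_stepCoeff`) and a fourth moment bound give `β (1 - c_k) → k²
/ 2`, hence `c_k ^ l → exp (-k² s / 2)` when `l / β → s`. The bound `stepCoeff_sq_le`, uniform in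
`k`, supplies a summable majorant, so the kernels converge uniformly on the circle to the heat
kernel (`tendsto_chainKernel`). Poisson summation (`heatKernel_exp`) turns the heat kernel into a
wrapped Gaussian, and the ratio of partition functions follows.

Conditioned Brownian motion. Write `W t = t W 1 + bridge`, the bridge being independent of `W 1`
(`exists_bridge`). Conditioning the endpoint on a shrinking arc leads to a mixture of bridges over
the winding number `m ∈ ℤ` with Gaussian weights (`pinnedLaw`), because the densities involved are
continuous. Expanding in Fourier series in the endpoint (`wrap_pathAvg_listVal`) gives its
finite-dimensional distributions in the same transfer-operator form as those of the chain
(`integral_listVal_gibbsMeasure`), with heat operators in place of steps. Strong convergence of the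
operators then gives convergence of the finite-dimensional distributions.

Path space. Over at most `n / 2` steps the conditioned increments are dominated by those of the free
walk, whence `E dist⁴ ≤ C (e / n)²` (`exists_lintegral_increment_le`). A halving argument
(`lintegral_maxIncrement_le`) makes this a maximal inequality, so for all large `n` the path is
close in mean to its discretisation at `m` times. Bounded Lipschitz test functions then reduce the
convergence to finitely many times, without any compactness argument. The limit paths are
continuous, so the identity time change suffices in every estimate of the Skorokhod distance. -/

noncomputable section

namespace XYChain

/-! ### Averaging operators on the circle -/

/-- A closed subspace of `C(X, ℂ)` that contains all products of the members of a separating family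
and their conjugates is everything. -/
lemma submodule_eq_top_of_separates {X : Type*} [TopologicalSpace X] [CompactSpace X]
    (S : Set C(X, ℂ)) (sep : ∀ x y, x ≠ y → ∃ f ∈ S, f x ≠ f y)
    (M : Submodule ℂ C(X, ℂ)) (hM : IsClosed (M : Set C(X, ℂ)))
    (h : ∀ f ∈ Submonoid.closure (S ∪ star S), f ∈ M) : M = ⊤ := by
  have h1 : (StarAlgebra.adjoin ℂ S).SeparatesPoints := by
    intro x y hxy
    obtain ⟨f, hf, hne⟩ := sep x y hxy
    exact ⟨f, ⟨f, StarAlgebra.subset_adjoin ℂ S hf, rfl⟩, hne⟩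
  have h2 := ContinuousMap.starSubalgebra_topologicalClosure_eq_top_of_separatesPoints _ h1
  have h3 : ((StarAlgebra.adjoin ℂ S : StarSubalgebra ℂ C(X, ℂ)) : Set C(X, ℂ)) ⊆ M := by
    intro f hf
    have hf' : f ∈ (Algebra.adjoin ℂ (S ∪ star S)).toSubmodule := hf
    rw [Algebra.adjoin_eq_span] at hf'
    exact Submodule.span_le.2 (fun g hg => h g hg) hf'
  rw [eq_top_iff]
  intro f _
  have hf : f ∈ (StarAlgebra.adjoin ℂ S).topologicalClosure := by rw [h2]; trivial
  exact closure_minimal h3 hM hf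

/-- The monomial `z ↦ z ^ k` on the circle. -/
def circleMonomial (k : ℤ) : C(Circle, ℂ) where
  toFun z := ((z ^ k : Circle) : ℂ)
  continuous_toFun := continuous_subtype_val.comp (continuous_zpow k)

@[simp] lemma circleMonomial_apply (k : ℤ) (z : Circle) :
    circleMonomial k z = ((z ^ k : Circle) : ℂ) := rfl

lemma norm_circleMonomial (k : ℤ) : ‖circleMonomial k‖ = 1 := by
  refine le_antisymm ((ContinuousMap.norm_le _ zero_le_one).2 fun z => (Circle.norm_coe _).le) ?_
  simpa using (circleMonomial k).norm_coe_le_norm 1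

lemma circleMonomial_exp (k : ℤ) (x : ℝ) :
    circleMonomial k (Circle.exp x) = Complex.exp (k * x * Complex.I) := by
  simp [← Complex.exp_int_mul, mul_assoc]

/-- Since conjugation sends `z` to `z⁻¹`, the products allowed by Stone–Weierstrass are exactly the
characters; convergence of averaging operators need only be tested on them. -/
lemma submodule_eq_top_of_circleMonomial (M : Submodule ℂ C(Circle, ℂ))
    (hM : IsClosed (M : Set C(Circle, ℂ))) (h : ∀ k, circleMonomial k ∈ M) : M = ⊤ := by
  refine submodule_eq_top_of_separates {circleMonomial 1} ?_ M hM ?_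
  · intro x y hxy
    exact ⟨_, rfl, by simpa using fun h => hxy (Circle.ext h)⟩
  · intro f hf
    have : ∃ k, f = circleMonomial k := by
      induction hf using Submonoid.closure_induction with
      | mem f hf =>
        rcases hf with rfl | hf
        · exact ⟨1, rfl⟩
        · refine ⟨-1, ?_⟩
          have hf' : star f = circleMonomial 1 := hf
          rw [← star_star f, hf']
          ext z
          simp [← Circle.coe_inv_eq_conj]
      | one => exact ⟨0, by ext z; simp⟩
      | mul f g _ _ hf hg =>
        obtain ⟨k, rfl⟩ := hf
        obtain ⟨l, rfl⟩ := hg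
        exact ⟨k + l, by ext z; simp [zpow_add]⟩
    obtain ⟨k, rfl⟩ := this
    exact h k

lemma integrable_of_continuous_circle (f : C(Circle, ℂ)) (μ : Measure ℝ) [IsFiniteMeasure μ]
    (z : Circle) : Integrable (fun u => f (z * Circle.exp u)) μ := by
  refine Integrable.of_bound (C := ‖f‖) ?_ (ae_of_all _ fun u => f.norm_coe_le_norm _)
  exact Continuous.aestronglyMeasurable (by fun_prop)

/-- The subspace on which a sequence of operators converges to a given operator. -/
def convergenceSubmodule {E F : Type*} [NormedAddCommGroup E] [NormedSpace ℂ E]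
    [NormedAddCommGroup F] [NormedSpace ℂ F] (T : ℕ → E →L[ℂ] F) (T₀ : E →L[ℂ] F) :
    Submodule ℂ E where
  carrier := {g | Tendsto (fun n => T n g) atTop (𝓝 (T₀ g))}
  zero_mem' := by simp
  add_mem' := fun {a b} ha hb => by
    simpa only [Set.mem_ofPred_eq, map_add] using Tendsto.add ha hb
  smul_mem' := fun c a ha => by
    simpa only [Set.mem_ofPred_eq, map_smul] using Tendsto.const_smul ha c

/-- An `ε / 3` argument: contractions transfer convergence at a nearby point. Strong convergence
thus only has to be checked on a set with dense span. -/
lemma isClosed_convergenceSubmodule {E F : Type*} [NormedAddCommGroup E] [NormedSpace ℂ E]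
    [NormedAddCommGroup F] [NormedSpace ℂ F] {T : ℕ → E →L[ℂ] F} {T₀ : E →L[ℂ] F}
    (hT : ∀ n g, ‖T n g‖ ≤ ‖g‖) (hT₀ : ∀ g, ‖T₀ g‖ ≤ ‖g‖) :
    IsClosed (convergenceSubmodule T T₀ : Set E) := by
  refine isClosed_of_closure_subset fun g hg => ?_
  change Tendsto _ _ _
  rw [Metric.tendsto_atTop]
  intro ε hε
  obtain ⟨a, ha, hga⟩ := Metric.mem_closure_iff.1 hg (ε / 3) (by positivity)
  obtain ⟨N, hN⟩ := Metric.tendsto_atTop.1 (show Tendsto _ _ _ from ha) (ε / 3) (by positivity)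
  refine ⟨N, fun n hn => ?_⟩
  have h1 : dist (T n g) (T n a) ≤ dist g a := by
    rw [dist_eq_norm, dist_eq_norm, ← map_sub]; exact hT _ _
  have h2 : dist (T₀ a) (T₀ g) ≤ dist g a := by
    rw [dist_comm, dist_eq_norm, dist_eq_norm, ← map_sub]; exact hT₀ _
  have h3 := dist_triangle4 (T n g) (T n a) (T₀ a) (T₀ g)
  linarith [hN n hn]

/-- Averaging a function on the circle over random rotations of law `μ`. -/
def rotAvg (μ : Measure ℝ) [IsProbabilityMeasure μ] : C(Circle, ℂ) →L[ℂ] C(Circle, ℂ) :=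
  LinearMap.mkContinuous
    { toFun := fun f =>
        { toFun := fun z => ∫ u, f (z * Circle.exp u) ∂μ
          continuous_toFun := by
            refine continuous_of_dominated (bound := fun _ => ‖f‖) ?_ ?_ ?_ ?_
            · exact fun z => (integrable_of_continuous_circle f μ z).1
            · exact fun z => ae_of_all _ fun u => f.norm_coe_le_norm _
            · exact integrable_const _
            · exact ae_of_all _ fun u => by fun_prop }
      map_add' := fun f g => by
        ext z
        exact integral_add (integrable_of_continuous_circle f μ z)
          (integrable_of_continuous_circle g μ z)
      map_smul' := fun a f => by
        ext z
        exact integral_const_mul a _ } 1 (fun f => by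
      rw [one_mul]
      refine (ContinuousMap.norm_le _ (norm_nonneg _)).2 fun z => ?_
      refine (norm_integral_le_of_norm_le_const (C := ‖f‖)
        (ae_of_all _ fun u => f.norm_coe_le_norm _)).trans ?_
      simp)

section rotAvg
variable (μ ν : Measure ℝ) [IsProbabilityMeasure μ] [IsProbabilityMeasure ν]

lemma rotAvg_apply (f : C(Circle, ℂ)) (z : Circle) :
    rotAvg μ f z = ∫ u, f (z * Circle.exp u) ∂μ := rfl

lemma norm_rotAvg_le (f : C(Circle, ℂ)) : ‖rotAvg μ f‖ ≤ ‖f‖ := by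
  have := ContinuousLinearMap.le_of_opNorm_le (rotAvg μ)
    (LinearMap.mkContinuous_norm_le _ zero_le_one _) f
  rwa [one_mul] at this

/-- A character is multiplicative, so a rotation only scales it. This diagonalises every averaging
operator, and on the circle only integer frequencies matter. -/
lemma rotAvg_circleMonomial (k : ℤ) :
    rotAvg μ (circleMonomial k) = charFun μ k • circleMonomial k := by
  ext z
  rw [rotAvg_apply, charFun_apply_real]
  simp only [ContinuousMap.smul_apply, smul_eq_mul, circleMonomial_apply, mul_zpow]
  rw [← integral_mul_const]
  congr with u
  have := circleMonomial_exp k u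
  simp only [circleMonomial_apply] at this
  rw [Circle.coe_mul, this, mul_comm]
  norm_cast

lemma rotAvg_conv (f : C(Circle, ℂ)) : rotAvg (μ ∗ ν) f = rotAvg μ (rotAvg ν f) := by
  ext z
  rw [rotAvg_apply, integral_conv (integrable_of_continuous_circle f _ z), rotAvg_apply]
  congr with u
  rw [rotAvg_apply]
  congr with v
  rw [Circle.exp_add, mul_assoc]

lemma rotAvg_dirac_zero (f : C(Circle, ℂ)) : rotAvg (Measure.dirac 0) f = f := by
  ext z
  simp [rotAvg_apply]

end rotAvg

/-- The `n`-fold convolution power of a measure on the line. -/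
def convPow (μ : Measure ℝ) : ℕ → Measure ℝ
  | 0 => Measure.dirac 0
  | n + 1 => μ ∗ convPow μ n

instance (μ : Measure ℝ) [IsProbabilityMeasure μ] (n : ℕ) :
    IsProbabilityMeasure (convPow μ n) := by
  induction n with
  | zero => exact inferInstanceAs (IsProbabilityMeasure (Measure.dirac _))
  | succ n ih => exact inferInstanceAs (IsProbabilityMeasure (μ ∗ convPow μ n))

lemma charFun_convPow (μ : Measure ℝ) [IsProbabilityMeasure μ] (n : ℕ) (t : ℝ) :
    charFun (convPow μ n) t = charFun μ t ^ n := by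
  induction n with
  | zero => simp [convPow]
  | succ n ih => rw [convPow, charFun_conv, ih, pow_succ']

lemma rotAvg_convPow_zero (μ : Measure ℝ) [IsProbabilityMeasure μ] (f : C(Circle, ℂ)) :
    rotAvg (convPow μ 0) f = f := rotAvg_dirac_zero f

lemma rotAvg_convPow_succ (μ : Measure ℝ) [IsProbabilityMeasure μ] (n : ℕ) (f : C(Circle, ℂ)) :
    rotAvg (convPow μ (n + 1)) f = rotAvg μ (rotAvg (convPow μ n) f) := rotAvg_conv _ _ f

lemma rotAvg_convPow_add (μ : Measure ℝ) [IsProbabilityMeasure μ] (m n : ℕ) (f : C(Circle, ℂ)) :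
    rotAvg (convPow μ (m + n)) f = rotAvg (convPow μ m) (rotAvg (convPow μ n) f) := by
  induction m with
  | zero => rw [zero_add, rotAvg_convPow_zero]
  | succ m ih => rw [Nat.succ_add, rotAvg_convPow_succ, ih, rotAvg_convPow_succ]

/-- Convergence of the Fourier coefficients of rotation laws gives strong convergence of the
averaging operators. -/
lemma tendsto_rotAvg {μ : ℕ → Measure ℝ} [∀ n, IsProbabilityMeasure (μ n)] {ν : Measure ℝ}
    [IsProbabilityMeasure ν]
    (h : ∀ k : ℤ, Tendsto (fun n => charFun (μ n) k) atTop (𝓝 (charFun ν k)))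
    {f : ℕ → C(Circle, ℂ)} {g : C(Circle, ℂ)} (hf : Tendsto f atTop (𝓝 g)) :
    Tendsto (fun n => rotAvg (μ n) (f n)) atTop (𝓝 (rotAvg ν g)) := by
  have key : ∀ g : C(Circle, ℂ), Tendsto (fun n => rotAvg (μ n) g) atTop (𝓝 (rotAvg ν g)) := by
    have hM : convergenceSubmodule (fun n => rotAvg (μ n)) (rotAvg ν) = ⊤ := by
      refine submodule_eq_top_of_circleMonomial _ ?_ ?_
      · exact isClosed_convergenceSubmodule (fun n => norm_rotAvg_le (μ n)) (norm_rotAvg_le ν)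
      · intro k
        change Tendsto _ _ _
        simp only [rotAvg_circleMonomial]
        exact (h k).smul_const _
    intro g
    have : g ∈ convergenceSubmodule (fun n => rotAvg (μ n)) (rotAvg ν) := by rw [hM]; trivial
    exact this
  -- Contractivity lets the argument move with `n`; this is what makes the statement usable inside
  -- iterated operators.
  have h1 : Tendsto (fun n => rotAvg (μ n) (f n - g)) atTop (𝓝 0) := by
    refine squeeze_zero_norm (fun n => norm_rotAvg_le (μ n) (f n - g)) ?_
    exact tendsto_iff_norm_sub_tendsto_zero.1 hf
  simpa using h1.add (key g)

/-! ### Fourier series on the circle -/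

instance : Fact (0 < 2 * Real.pi) := ⟨Real.two_pi_pos⟩

/-- The Fourier coefficients, without the factor `1 / 2π`, of a function of the angle. -/
def angleCoeff (f : ℝ → ℂ) (k : ℤ) : ℂ :=
  ∫ x in Set.Ioc (-Real.pi) Real.pi, Complex.exp (-(k * x * Complex.I)) * f x

/-- Fourier inversion on `AddCircle`; the factor `2π` on the right compensates the missing
normalisation in `angleCoeff`. -/
lemma hasSum_angleCoeff {f : ℝ → ℂ} (hf : Continuous f) (hp : f.Periodic (2 * Real.pi))
    (hs : Summable (angleCoeff f)) (x : ℝ) :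
    HasSum (fun k : ℤ => angleCoeff f k * Complex.exp (k * x * Complex.I)) (2 * Real.pi * f x) := by
  have hpi := Real.pi_pos
  let g : C(AddCircle (2 * Real.pi), ℂ) :=
    ⟨hp.lift, continuous_coinduced_dom.2 hf⟩
  have hg : ∀ y : ℝ, g (y : AddCircle (2 * Real.pi)) = f y := fun y => hp.lift_coe y
  have hc : ∀ k : ℤ, fourierCoeff g k = (1 / (2 * Real.pi) : ℂ) * angleCoeff f k := by
    intro k
    rw [fourierCoeff_eq_intervalIntegral g k (-Real.pi), angleCoeff,
      intervalIntegral.integral_of_le (by linarith)]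
    rw [show -Real.pi + 2 * Real.pi = Real.pi by ring, Complex.real_smul]
    congr 1
    · push_cast; rfl
    · congr with y
      rw [fourier_coe_apply, hg, smul_eq_mul]
      congr 2
      push_cast
      field_simp
  have hs' : Summable (fourierCoeff g) := by
    rw [show fourierCoeff g = fun k => (1 / (2 * Real.pi) : ℂ) * angleCoeff f k from funext hc]
    exact hs.mul_left _
  have h := (has_pointwise_sum_fourier_series_of_summable hs' (x : AddCircle (2 * Real.pi))).mul_left
    (2 * Real.pi : ℂ)
  rw [hg] at h
  refine h.congr_fun fun k => ?_
  rw [hc, fourier_coe_apply, smul_eq_mul]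
  have : (Real.pi : ℂ) ≠ 0 := by exact_mod_cast hpi.ne'
  rw [← mul_assoc, ← mul_assoc, mul_one_div_cancel (by simp), one_mul]
  congr 2
  push_cast
  field_simp

lemma integral_Ioc_add_of_periodic {f : ℝ → ℂ} (hp : f.Periodic (2 * Real.pi)) (u : ℝ) :
    ∫ x in Set.Ioc (-Real.pi) Real.pi, f (x + u) = ∫ x in Set.Ioc (-Real.pi) Real.pi, f x := by
  have hpi := Real.pi_pos
  rw [← intervalIntegral.integral_of_le (by linarith),
    ← intervalIntegral.integral_of_le (by linarith), intervalIntegral.integral_comp_add_right]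
  have := hp.intervalIntegral_add_eq (-Real.pi + u) (-Real.pi)
  rwa [show -Real.pi + u + 2 * Real.pi = Real.pi + u by ring,
    show -Real.pi + 2 * Real.pi = Real.pi by ring] at this

/-- Fubini, then the translation `x ↦ x + u`, which leaves the integral over a period unchanged and
produces the factor `exp (i k u)`. -/
lemma angleCoeff_rotAvg (μ : Measure ℝ) [IsProbabilityMeasure μ] (f : C(Circle, ℂ)) (k : ℤ) :
    angleCoeff (fun x => rotAvg μ f (Circle.exp x)) k =
      charFun μ k * angleCoeff (fun x => f (Circle.exp x)) k := by
  have hper : ((fun y : ℝ => Complex.exp (-(k * y * Complex.I)) * f (Circle.exp y))).Periodic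
      (2 * Real.pi) := by
    intro y
    have h2 : Complex.exp (-(k * (y + 2 * Real.pi : ℝ) * Complex.I)) =
        Complex.exp (-(k * y * Complex.I)) := by
      rw [Complex.exp_eq_exp_iff_exists_int]
      exact ⟨-k, by push_cast; ring⟩
    simp only [h2, Circle.periodic_exp y]
  have hig : Integrable (Function.uncurry fun (x u : ℝ) =>
      Complex.exp (-(k * x * Complex.I)) * f (Circle.exp x * Circle.exp u))
      ((volume.restrict (Set.Ioc (-Real.pi) Real.pi)).prod μ) := by
    refine Integrable.of_bound (C := ‖f‖) ?_ (ae_of_all _ fun p => ?_)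
    · exact Continuous.aestronglyMeasurable (by fun_prop)
    · have : ‖Complex.exp (-(k * p.1 * Complex.I))‖ = 1 := by
        rw [Complex.norm_exp]; simp
      simp only [Function.uncurry, norm_mul, this, one_mul]
      exact f.norm_coe_le_norm _
  simp only [angleCoeff, rotAvg_apply, charFun_apply_real]
  simp_rw [← integral_const_mul]
  rw [integral_integral_swap hig, integral_const_mul, ← integral_mul_const]
  congr with u
  have := integral_Ioc_add_of_periodic hper u
  rw [← this, ← integral_const_mul]
  congr with x
  rw [Circle.exp_add, ← mul_assoc, ← Complex.exp_add]
  congr 2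
  push_cast
  ring

/-! ### Functionals of finitely many values of a path -/

/-- The product of functions of the values of a path at the successive times whose increments are
given in a list. -/
def listVal {T : Type*} [Add T] : List (T × C(Circle, ℂ)) → (T → Circle) → ℂ
  | [], _ => 1
  | (d, H) :: L, s => H (s d) * listVal L fun t => s (d + t)

/-- The iteration of evolution operators and multiplications along a list. -/
def transfer {T : Type*} (A : T → C(Circle, ℂ) → C(Circle, ℂ)) :
    List (T × C(Circle, ℂ)) → C(Circle, ℂ) → C(Circle, ℂ)
  | [], g => g
  | (d, H) :: L, g => A d (H * transfer A L g)

/-- The total time of a list of increments. -/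
def listTime {T : Type*} [AddMonoid T] (L : List (T × C(Circle, ℂ))) : T := (L.map Prod.fst).sum

/-! ### The law of one step of the chain -/

/-- The total mass of the weight `exp (β cos x)` on a period. -/
def stepMass (β : ℝ) : ℝ := ∫ x in Set.Ioc (-Real.pi) Real.pi, Real.exp (β * Real.cos x)

/-- The probability measure on `(-π, π]` with density proportional to `exp (β cos x)`. -/
def stepLaw (β : ℝ) : Measure ℝ :=
  (volume.restrict (Set.Ioc (-Real.pi) Real.pi)).tilted fun x => β * Real.cos x

lemma integrable_of_continuous_period {E : Type*} [NormedAddCommGroup E] {g : ℝ → E}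
    (hg : Continuous g) :
    Integrable g (volume.restrict (Set.Ioc (-Real.pi) Real.pi)) :=
  (hg.integrableOn_Icc (a := -Real.pi) (b := Real.pi)).mono_set Set.Ioc_subset_Icc_self

instance : NeZero ((volume : Measure ℝ).restrict (Set.Ioc (-Real.pi) Real.pi)) := by
  refine ⟨?_⟩
  rw [Ne, Measure.restrict_eq_zero, Real.volume_Ioc, ENNReal.ofReal_eq_zero, not_le]
  linarith [Real.pi_pos]

instance (β : ℝ) : IsProbabilityMeasure (stepLaw β) :=
  isProbabilityMeasure_tilted (integrable_of_continuous_period (by fun_prop))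

lemma integral_stepLaw {E : Type*} [NormedAddCommGroup E] [NormedSpace ℝ E] (β : ℝ) (g : ℝ → E) :
    ∫ x, g x ∂stepLaw β =
      (stepMass β)⁻¹ • ∫ x in Set.Ioc (-Real.pi) Real.pi, Real.exp (β * Real.cos x) • g x := by
  rw [stepLaw, integral_tilted, ← integral_smul]
  congr with x
  rw [smul_smul, div_eq_inv_mul, stepMass]

lemma stepMass_pos (β : ℝ) : 0 < stepMass β :=
  integral_exp_pos (integrable_of_continuous_period (by fun_prop))

lemma ae_abs_le_pi_stepLaw (β : ℝ) : ∀ᵐ x ∂stepLaw β, |x| ≤ Real.pi := by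
  refine (tilted_absolutelyContinuous _ _).ae_le ?_
  filter_upwards [ae_restrict_mem measurableSet_Ioc] with x hx
  exact abs_le.2 ⟨hx.1.le, hx.2⟩

lemma integrable_stepLaw (β : ℝ) {g : ℝ → ℝ} (hg : Continuous g) : Integrable g (stepLaw β) := by
  obtain ⟨C, hC⟩ := (isCompact_Icc (a := -Real.pi) (b := Real.pi)).exists_bound_of_continuousOn
    hg.continuousOn
  refine Integrable.of_bound (C := C) hg.aestronglyMeasurable ?_
  filter_upwards [ae_abs_le_pi_stepLaw β] with x hx
  exact hC x (abs_le.1 hx)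

/-- Laplace lower bound: on `|x| ≤ 1 / √β`, an interval of length `2 / √β`, one has `β cos x ≥ β - 1
/ 2`. -/
lemma le_stepMass {β : ℝ} (hβ : 1 ≤ β) :
    2 * Real.exp (β - 1 / 2) / √β ≤ stepMass β := by
  have hs : 1 ≤ √β := by rw [Real.one_le_sqrt]; exact hβ
  have h0 : (0 : ℝ) < (√β)⁻¹ := by positivity
  have h1 : (√β)⁻¹ ≤ 1 := inv_le_one_of_one_le₀ hs
  have hpi := Real.two_le_pi
  have hsub : Set.Ioc (-(√β)⁻¹) (√β)⁻¹ ⊆ Set.Ioc (-Real.pi) Real.pi :=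
    Set.Ioc_subset_Ioc (by linarith) (by linarith)
  have hig : Integrable (fun x => Real.exp (β * Real.cos x))
    (volume.restrict (Set.Ioc (-Real.pi) Real.pi)) := integrable_of_continuous_period (by fun_prop)
  calc 2 * Real.exp (β - 1 / 2) / √β
      = ∫ x in Set.Ioc (-(√β)⁻¹) (√β)⁻¹, Real.exp (β - 1 / 2) := by
        rw [setIntegral_const, Real.volume_real_Ioc_of_le (by linarith), smul_eq_mul]
        ring
    _ ≤ ∫ x in Set.Ioc (-(√β)⁻¹) (√β)⁻¹, Real.exp (β * Real.cos x) := by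
        refine setIntegral_mono_on (integrable_const _) (hig.mono_measure
          (Measure.restrict_mono hsub le_rfl)) measurableSet_Ioc fun x hx => ?_
        refine Real.exp_le_exp.2 ?_
        have hx2 : x ^ 2 ≤ ((√β)⁻¹) ^ 2 := sq_le_sq' hx.1.le hx.2
        rw [inv_pow, Real.sq_sqrt (by linarith)] at hx2
        have : β * x ^ 2 ≤ 1 := by
          calc β * x ^ 2 ≤ β * β⁻¹ := by gcongr
            _ = 1 := mul_inv_cancel₀ (by linarith)
        nlinarith [Real.one_sub_sq_div_two_le_cos (x := x)]
    _ ≤ stepMass β := by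
        refine setIntegral_mono_set hig (ae_of_all _ fun x => (Real.exp_pos _).le) ?_
        exact hsub.eventuallyLE

/-- Comes from `cos x ≤ 1 - 2 x² / π²`, valid on the whole period, so Gaussian domination holds
without localising near `0`. -/
lemma exp_mul_cos_le {β x : ℝ} (hβ : 0 ≤ β) (hx : |x| ≤ Real.pi) :
    Real.exp (β * Real.cos x) ≤ Real.exp β * Real.exp (-(2 * β / Real.pi ^ 2) * x ^ 2) := by
  rw [← Real.exp_add, Real.exp_le_exp]
  have := mul_le_mul_of_nonneg_left (Real.cos_le_one_sub_mul_cos_sq hx) hβ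
  refine this.trans_eq ?_
  ring

lemma stepMass_le {β : ℝ} (hβ : 0 < β) :
    stepMass β ≤ Real.exp β * (√(Real.pi ^ 3 / 2) / √β) := by
  have ha : 0 < 2 * β / Real.pi ^ 2 := by positivity
  calc stepMass β ≤ ∫ x in Set.Ioc (-Real.pi) Real.pi,
        Real.exp β * Real.exp (-(2 * β / Real.pi ^ 2) * x ^ 2) := by
        refine setIntegral_mono_on (integrable_of_continuous_period (by fun_prop))
          (integrable_of_continuous_period (by fun_prop)) measurableSet_Ioc fun x hx => ?_
        exact exp_mul_cos_le hβ.le (abs_le.2 ⟨hx.1.le, hx.2⟩)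
    _ ≤ ∫ x, Real.exp β * Real.exp (-(2 * β / Real.pi ^ 2) * x ^ 2) := by
        refine setIntegral_le_integral ((integrable_exp_neg_mul_sq ha).const_mul _)
          (ae_of_all _ fun x => by positivity)
    _ = _ := by
        rw [integral_const_mul, integral_gaussian, ← Real.sqrt_div (by positivity)]
        congr 2
        field_simp

/-- The constant in the bound for the fourth moment of a step. -/
def fourthMomentConst : ℝ := Real.exp (1 / 2) * Real.pi ^ 4 * √(Real.pi ^ 3)

/-- Half of the Gaussian factor absorbs `x⁴`, by `exp y ≥ y² / 2` with `y = a x² / 2`; the other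
half is integrated over the line. Dividing by the lower bound of `le_stepMass` leaves order `β⁻²`.
-/
lemma integral_pow_four_stepLaw_le {β : ℝ} (hβ : 1 ≤ β) :
    ∫ x, x ^ 4 ∂stepLaw β ≤ fourthMomentConst / β ^ 2 := by
  have hβ0 : 0 < β := by linarith
  set a := 2 * β / Real.pi ^ 2 with ha_def
  have ha : 0 < a := by positivity
  have hnum : ∫ x in Set.Ioc (-Real.pi) Real.pi, Real.exp (β * Real.cos x) • x ^ 4 ≤
      Real.exp β * (8 / a ^ 2) * √(Real.pi / (a / 2)) := by
    calc _ ≤ ∫ x in Set.Ioc (-Real.pi) Real.pi,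
          Real.exp β * (8 / a ^ 2) * Real.exp (-(a / 2) * x ^ 2) := by
          refine setIntegral_mono_on (integrable_of_continuous_period (by fun_prop))
            (integrable_of_continuous_period (by fun_prop)) measurableSet_Ioc fun x hx => ?_
          have h1 := exp_mul_cos_le hβ0.le (abs_le.2 ⟨hx.1.le, hx.2⟩)
          rw [← ha_def] at h1
          have h2 : x ^ 4 * Real.exp (-(a / 2) * x ^ 2) ≤ 8 / a ^ 2 := by
            have h3 := Real.quadratic_le_exp_of_nonneg (x := a / 2 * x ^ 2) (by positivity)
            have h4 : a ^ 2 * x ^ 4 ≤ 8 * Real.exp (a / 2 * x ^ 2) := by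
              nlinarith [show 0 ≤ a / 2 * x ^ 2 by positivity]
            rw [neg_mul, Real.exp_neg, ← div_eq_mul_inv, div_le_div_iff₀ (Real.exp_pos _)
              (by positivity)]
            linarith
          have h5 : Real.exp (-a * x ^ 2) =
              Real.exp (-(a / 2) * x ^ 2) * Real.exp (-(a / 2) * x ^ 2) := by
            rw [← Real.exp_add]; ring_nf
          rw [smul_eq_mul]
          calc Real.exp (β * Real.cos x) * x ^ 4
              ≤ Real.exp β * Real.exp (-a * x ^ 2) * x ^ 4 := by gcongr
            _ = Real.exp β * (x ^ 4 * Real.exp (-(a / 2) * x ^ 2)) *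
                Real.exp (-(a / 2) * x ^ 2) := by rw [h5]; ring
            _ ≤ _ := by gcongr
      _ ≤ ∫ x, Real.exp β * (8 / a ^ 2) * Real.exp (-(a / 2) * x ^ 2) := by
          refine setIntegral_le_integral ((integrable_exp_neg_mul_sq (by positivity)).const_mul _)
            (ae_of_all _ fun x => by positivity)
      _ = _ := by rw [integral_const_mul, integral_gaussian]
  rw [integral_stepLaw, smul_eq_mul, inv_mul_le_iff₀ (stepMass_pos β)]
  refine hnum.trans ?_
  have h1 : Real.exp β * (8 / a ^ 2) * √(Real.pi / (a / 2)) =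
      2 * Real.exp (β - 1 / 2) / √β * (fourthMomentConst / β ^ 2) := by
    have h2 : √(Real.pi / (a / 2)) = √(Real.pi ^ 3) / √β := by
      rw [← Real.sqrt_div (by positivity)]
      congr 1
      rw [ha_def]
      field_simp
    rw [h2, Real.exp_sub, fourthMomentConst, ha_def]
    field_simp
    norm_num
  rw [h1]
  exact mul_le_mul_of_nonneg_right (le_stepMass hβ) (by rw [fourthMomentConst]; positivity)

/-! ### Characteristic function of a step -/

/-- The Fourier coefficients of the law of a step. -/
def stepCoeff (β : ℝ) (k : ℤ) : ℝ := ∫ x, Real.cos (k * x) ∂stepLaw β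

lemma integral_Ioc_neg {E : Type*} [NormedAddCommGroup E] [NormedSpace ℝ E] (g : ℝ → E) :
    ∫ x in Set.Ioc (-Real.pi) Real.pi, g (-x) = ∫ x in Set.Ioc (-Real.pi) Real.pi, g x := by
  have := Real.pi_pos
  rw [← intervalIntegral.integral_of_le (by linarith),
    ← intervalIntegral.integral_of_le (by linarith), intervalIntegral.integral_comp_neg, neg_neg]

/-- The step law is symmetric, so the sine part vanishes and the coefficient is real. -/
lemma charFun_stepLaw (β : ℝ) (k : ℤ) : charFun (stepLaw β) k = stepCoeff β k := by
  have h : ∀ x : ℝ, Complex.exp ((k : ℝ) * x * Complex.I) =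
      (Real.cos (k * x) : ℂ) + (Real.sin (k * x) : ℂ) * Complex.I := by
    intro x
    rw [← Complex.ofReal_mul, Complex.exp_mul_I, Complex.ofReal_cos, Complex.ofReal_sin]
  have hsin : ∫ x, Real.sin (k * x) ∂stepLaw β = 0 := by
    rw [integral_stepLaw]
    have := integral_Ioc_neg fun x => Real.exp (β * Real.cos x) • Real.sin (k * x)
    simp only [Real.cos_neg, mul_neg, Real.sin_neg, smul_neg, integral_neg] at this
    rw [show ∫ x in Set.Ioc (-Real.pi) Real.pi, Real.exp (β * Real.cos x) • Real.sin (k * x) = 0 by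
      linarith, smul_zero]
  rw [charFun_apply_real]
  simp_rw [h]
  have i1 : Integrable (fun x : ℝ => (Real.cos (k * x) : ℂ)) (stepLaw β) :=
    (integrable_stepLaw β (g := fun x => Real.cos (k * x)) (by fun_prop)).ofReal
  have i2 : Integrable (fun x : ℝ => (Real.sin (k * x) : ℂ)) (stepLaw β) :=
    (integrable_stepLaw β (g := fun x => Real.sin (k * x)) (by fun_prop)).ofReal
  have e1 : ∫ x : ℝ, (Real.cos (k * x) : ℂ) ∂stepLaw β = stepCoeff β k := integral_ofReal
  have e2 : ∫ x : ℝ, (Real.sin (k * x) : ℂ) ∂stepLaw β = (0 : ℝ) := by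
    rw [← hsin]; exact integral_ofReal
  rw [integral_add i1 (i2.mul_const _), integral_mul_const, e1, e2]
  simp

lemma stepCoeff_neg (β : ℝ) (k : ℤ) : stepCoeff β (-k) = stepCoeff β k := by simp [stepCoeff]

lemma abs_stepCoeff_le_one (β : ℝ) (k : ℤ) : |stepCoeff β k| ≤ 1 := by
  have := norm_integral_le_of_norm_le_const (μ := stepLaw β) (C := 1)
    (f := fun x => Real.cos (k * x)) (ae_of_all _ fun x => Real.abs_cos_le_one (k * x))
  simpa [stepCoeff] using this

/-- Integration by parts: the derivative of `sin (k x) exp (β cos x)` integrates to zero over the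
period. It yields both the asymptotics of `c_1` and the decay of `c_k` at high frequency. -/
lemma mul_stepCoeff (β : ℝ) (k : ℤ) :
    k * stepCoeff β k = β * ∫ x, Real.sin (k * x) * Real.sin x ∂stepLaw β := by
  have hpi := Real.pi_pos
  have hd : ∀ x ∈ Set.uIcc (-Real.pi) Real.pi,
      HasDerivAt (fun x => Real.sin (k * x) * Real.exp (β * Real.cos x))
      (k * (Real.exp (β * Real.cos x) * Real.cos (k * x)) -
        β * (Real.exp (β * Real.cos x) * (Real.sin (k * x) * Real.sin x))) x := by
    intro x _
    have h1 : HasDerivAt (fun x : ℝ => (k : ℝ) * x) k x := by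
      simpa using (hasDerivAt_id x).const_mul (k : ℝ)
    refine (h1.sin.mul ((Real.hasDerivAt_cos x).const_mul β).exp).congr_deriv ?_
    ring
  have h := intervalIntegral.integral_eq_sub_of_hasDerivAt hd
    (Continuous.intervalIntegrable (by fun_prop) _ _)
  rw [intervalIntegral.integral_sub (Continuous.intervalIntegrable (by fun_prop) _ _)
    (Continuous.intervalIntegrable (by fun_prop) _ _), intervalIntegral.integral_const_mul,
    intervalIntegral.integral_const_mul, intervalIntegral.integral_of_le (by linarith),
    intervalIntegral.integral_of_le (by linarith)] at h
  simp only [mul_neg, Real.sin_neg, Real.sin_int_mul_pi, neg_zero, zero_mul, sub_zero] at h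
  rw [stepCoeff, integral_stepLaw, integral_stepLaw]
  simp only [smul_eq_mul]
  linear_combination (stepMass β)⁻¹ * h

lemma sq_integral_le {μ : Measure ℝ} [IsProbabilityMeasure μ] {f : ℝ → ℝ} (hf : Integrable f μ)
    (hf2 : Integrable (fun x => f x ^ 2) μ) : (∫ x, f x ∂μ) ^ 2 ≤ ∫ x, f x ^ 2 ∂μ := by
  exact (even_two.convexOn_pow (𝕜 := ℝ)).map_integral_le (continuous_pow 2).continuousOn
    isClosed_univ (ae_of_all _ fun _ => Set.mem_univ _) hf hf2

/-- By `mul_stepCoeff`, `k c_k = β E[sin (k x) sin x]`. Jensen bounds the square by `β² E[sin² x]`,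
and the same identity at `k = 1` turns this into `β c_1 ≤ β`. -/
lemma sq_mul_stepCoeff_sq_le {β : ℝ} (hβ : 0 ≤ β) (k : ℤ) : k ^ 2 * stepCoeff β k ^ 2 ≤ β := by
  have h1 := mul_stepCoeff β 1
  simp only [Int.cast_one, one_mul] at h1
  have h2 : (∫ x, Real.sin (k * x) * Real.sin x ∂stepLaw β) ^ 2 ≤
      ∫ x, Real.sin x * Real.sin x ∂stepLaw β := by
    refine (sq_integral_le (integrable_stepLaw β (by fun_prop))
      (integrable_stepLaw β (by fun_prop))).trans ?_
    refine integral_mono (integrable_stepLaw β (by fun_prop)) (integrable_stepLaw β (by fun_prop))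
      fun x => ?_
    change (Real.sin (k * x) * Real.sin x) ^ 2 ≤ Real.sin x * Real.sin x
    nlinarith [Real.sin_sq_le_one (k * x), sq_nonneg (Real.sin x)]
  calc (k : ℝ) ^ 2 * stepCoeff β k ^ 2 = (k * stepCoeff β k) ^ 2 := by ring
    _ = β * (β * (∫ x, Real.sin (k * x) * Real.sin x ∂stepLaw β) ^ 2) := by
      rw [mul_stepCoeff]; ring
    _ ≤ β * (β * ∫ x, Real.sin x * Real.sin x ∂stepLaw β) := by gcongr
    _ = β * stepCoeff β 1 := by rw [← h1]
    _ ≤ β * 1 := by gcongr; exact (abs_le.1 (abs_stepCoeff_le_one β 1)).2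
    _ = β := mul_one β

lemma one_sub_stepCoeff (β : ℝ) (k : ℤ) :
    1 - stepCoeff β k = ∫ x, (1 - Real.cos (k * x)) ∂stepLaw β := by
  rw [integral_sub (integrable_const _) (integrable_stepLaw β (by fun_prop))]
  simp [stepCoeff]

lemma abs_one_sub_cos_sub_le (y : ℝ) : |1 - Real.cos y - y ^ 2 / 2| ≤ 2 * y ^ 4 := by
  rcases le_or_gt |y| 1 with h | h
  · have h1 := Real.cos_bound h
    have h2 : |y| ^ 4 = y ^ 4 := by rw [← abs_pow]; exact abs_of_nonneg (by positivity)
    rw [h2] at h1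
    rw [show 1 - Real.cos y - y ^ 2 / 2 = -(Real.cos y - (1 - y ^ 2 / 2)) by ring, abs_neg]
    nlinarith [show 0 ≤ y ^ 4 by positivity]
  · have h1 : 1 ≤ y ^ 2 := by rw [← sq_abs]; nlinarith
    have h2 := Real.cos_le_one y
    have h3 := Real.neg_one_le_cos y
    rw [abs_le]
    constructor <;> nlinarith

lemma tendsto_fourthMoment : Tendsto (fun β => β * ∫ x, x ^ 4 ∂stepLaw β) atTop (𝓝 0) := by
  have h : Tendsto (fun β : ℝ => fourthMomentConst / β) atTop (𝓝 0) :=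
    tendsto_const_nhds.div_atTop tendsto_id
  refine squeeze_zero' ?_ ?_ h
  · filter_upwards [eventually_ge_atTop 1] with β hβ
    exact mul_nonneg (by linarith) (integral_nonneg fun x => by positivity)
  · filter_upwards [eventually_ge_atTop 1] with β hβ
    have := mul_le_mul_of_nonneg_left (integral_pow_four_stepLaw_le hβ) (by linarith : 0 ≤ β)
    refine this.trans_eq ?_
    field_simp

/-- From `c_1 = β E[sin² x]` and `sin² = 2 (1 - cos) - (1 - cos)²` one gets `β (1 - c_1) (2 + 1 / β)
= 1 + β E[(1 - cos x)²]`, whose last term is a vanishing fourth-moment error. No sharp Laplace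
asymptotics enter. -/
lemma tendsto_mul_one_sub_stepCoeff_one :
    Tendsto (fun β => β * (1 - stepCoeff β 1)) atTop (𝓝 (1 / 2)) := by
  have h1 : Tendsto (fun β => β * ∫ x, (1 - Real.cos x) ^ 2 ∂stepLaw β) atTop (𝓝 0) := by
    refine squeeze_zero' ?_ ?_ tendsto_fourthMoment
    · filter_upwards [eventually_ge_atTop 1] with β hβ
      exact mul_nonneg (by linarith) (integral_nonneg fun x => by positivity)
    · filter_upwards [eventually_ge_atTop 1] with β hβ
      refine mul_le_mul_of_nonneg_left (integral_mono (integrable_stepLaw β (by fun_prop))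
        (integrable_stepLaw β (by fun_prop)) fun x => ?_) (by linarith)
      have h2 : 1 - Real.cos x ≤ x ^ 2 / 2 := by linarith [Real.one_sub_sq_div_two_le_cos (x := x)]
      have h3 : 0 ≤ 1 - Real.cos x := by linarith [Real.cos_le_one x]
      change (1 - Real.cos x) ^ 2 ≤ x ^ 4
      calc (1 - Real.cos x) ^ 2 ≤ (x ^ 2 / 2) ^ 2 := by gcongr
        _ ≤ x ^ 4 := by nlinarith [show 0 ≤ x ^ 4 by positivity]
  have h2 : ∀ β : ℝ, 0 < β → β * (1 - stepCoeff β 1) =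
      (1 + β * ∫ x, (1 - Real.cos x) ^ 2 ∂stepLaw β) / (2 + 1 / β) := by
    intro β hβ
    have e1 := mul_stepCoeff β 1
    simp only [Int.cast_one, one_mul] at e1
    have e2 := one_sub_stepCoeff β 1
    simp only [Int.cast_one, one_mul] at e2
    have e3 : ∫ x, Real.sin x * Real.sin x ∂stepLaw β =
        2 * (1 - stepCoeff β 1) - ∫ x, (1 - Real.cos x) ^ 2 ∂stepLaw β := by
      rw [e2, ← integral_const_mul, ← integral_sub (integrable_stepLaw β (by fun_prop))
        (integrable_stepLaw β (by fun_prop))]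
      congr with x
      nlinarith [Real.sin_sq_add_cos_sq x]
    rw [e3] at e1
    rw [eq_div_iff (by positivity)]
    field_simp
    linarith
  have h3 : Tendsto (fun β => (1 + β * ∫ x, (1 - Real.cos x) ^ 2 ∂stepLaw β) / (2 + 1 / β)) atTop
      (𝓝 ((1 + 0) / (2 + 0))) := by
    refine (tendsto_const_nhds.add h1).div (tendsto_const_nhds.add ?_) (by norm_num)
    exact tendsto_const_nhds.div_atTop tendsto_id
  rw [show (1 : ℝ) / 2 = (1 + 0) / (2 + 0) by norm_num]
  refine h3.congr' ?_
  filter_upwards [eventually_gt_atTop 0] with β hβ using (h2 β hβ).symm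

/-- To second order `1 - cos (k x)` and `k² (1 - cos x)` agree; their difference is at most a
constant times `x⁴`, which is negligible after multiplication by `β`. This reduces the claim to `k =
1`. -/
lemma tendsto_mul_one_sub_stepCoeff (k : ℤ) :
    Tendsto (fun β => β * (1 - stepCoeff β k)) atTop (𝓝 (k ^ 2 / 2)) := by
  have h1 : Tendsto (fun β => β * (1 - stepCoeff β k) - k ^ 2 * (β * (1 - stepCoeff β 1))) atTop
      (𝓝 0) := by
    have h2 : Tendsto (fun β => (2 * (k : ℝ) ^ 4 + 2 * k ^ 2) * (β * ∫ x, x ^ 4 ∂stepLaw β)) atTop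
        (𝓝 0) := by simpa using tendsto_fourthMoment.const_mul _
    refine squeeze_zero_norm' ?_ h2
    filter_upwards [eventually_ge_atTop 1] with β hβ
    have e : β * (1 - stepCoeff β k) - k ^ 2 * (β * (1 - stepCoeff β 1)) =
        β * ∫ x, ((1 - Real.cos (k * x)) - k ^ 2 * (1 - Real.cos x)) ∂stepLaw β := by
      rw [integral_sub (integrable_stepLaw β (by fun_prop)) (integrable_stepLaw β (by fun_prop)),
        integral_const_mul, one_sub_stepCoeff, one_sub_stepCoeff]
      simp only [Int.cast_one, one_mul]
      ring
    rw [e, norm_mul, Real.norm_of_nonneg (by linarith : 0 ≤ β), mul_left_comm]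
    refine mul_le_mul_of_nonneg_left ?_ (by linarith)
    rw [← integral_const_mul]
    refine norm_integral_le_of_norm_le (integrable_stepLaw β (by fun_prop)) (ae_of_all _ fun x => ?_)
    have a1 := abs_le.1 (abs_one_sub_cos_sub_le (k * x))
    have a2 := abs_le.1 (abs_one_sub_cos_sub_le x)
    have hk : (0 : ℝ) ≤ (k : ℝ) ^ 2 := sq_nonneg _
    rw [Real.norm_eq_abs, abs_le]
    have b1 := mul_le_mul_of_nonneg_left a2.1 hk
    have b2 := mul_le_mul_of_nonneg_left a2.2 hk
    constructor <;> nlinarith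
  have := h1.add (tendsto_mul_one_sub_stepCoeff_one.const_mul ((k : ℝ) ^ 2))
  rw [show (0 : ℝ) + k ^ 2 * (1 / 2) = k ^ 2 / 2 by ring] at this
  refine this.congr fun β => ?_
  ring

/-- `(1 - x_n) ^ l_n → exp (-c)` when `x_n → 0` and `l_n x_n → c`. -/
lemma tendsto_one_sub_pow {x : ℕ → ℝ} {l : ℕ → ℕ} {c : ℝ} (hx : Tendsto x atTop (𝓝 0))
    (hl : Tendsto (fun n => l n * x n) atTop (𝓝 c)) :
    Tendsto (fun n => (1 - x n) ^ l n) atTop (𝓝 (Real.exp (-c))) := by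
  -- Squeeze by `1 - 1 / y ≤ log y ≤ y - 1` at `y = 1 - x n`.
  have hlog : Tendsto (fun n => l n * Real.log (1 - x n)) atTop (𝓝 (-c)) := by
    have h1 : Tendsto (fun n => -(l n * x n) / (1 - x n)) atTop (𝓝 (-c / (1 - 0))) :=
      hl.neg.div (tendsto_const_nhds.sub hx) (by norm_num)
    rw [sub_zero, div_one] at h1
    refine tendsto_of_tendsto_of_tendsto_of_le_of_le' h1 hl.neg ?_ ?_
    · filter_upwards [hx.eventually_lt_const (show (0 : ℝ) < 1 by norm_num)] with n hn
      have h2 := Real.one_sub_inv_le_log_of_pos (show 0 < 1 - x n by linarith)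
      have h3 : -(l n * x n) / (1 - x n) = l n * (1 - (1 - x n)⁻¹) := by
        have : 1 - x n ≠ 0 := by linarith
        field_simp
        ring
      rw [h3]
      exact mul_le_mul_of_nonneg_left h2 (Nat.cast_nonneg _)
    · filter_upwards [hx.eventually_lt_const (show (0 : ℝ) < 1 by norm_num)] with n hn
      have h2 := Real.log_le_sub_one_of_pos (show 0 < 1 - x n by linarith)
      rw [← mul_neg]
      exact mul_le_mul_of_nonneg_left (by linarith) (Nat.cast_nonneg _)
  refine ((Real.continuous_exp.tendsto _).comp hlog).congr' ?_
  filter_upwards [hx.eventually_lt_const (show (0 : ℝ) < 1 by norm_num)] with n hn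
  rw [Function.comp, mul_comm, ← Real.rpow_natCast, Real.rpow_def_of_pos (by linarith)]

lemma tendsto_stepCoeff_pow {β : ℕ → ℝ} {l : ℕ → ℕ} {s : ℝ} (hβ : Tendsto β atTop atTop)
    (hl : Tendsto (fun n => l n / β n) atTop (𝓝 s)) (k : ℤ) :
    Tendsto (fun n => stepCoeff (β n) k ^ l n) atTop (𝓝 (Real.exp (-(k ^ 2 * s / 2)))) := by
  have h1 := (tendsto_mul_one_sub_stepCoeff k).comp hβ
  have h2 : Tendsto (fun n => 1 - stepCoeff (β n) k) atTop (𝓝 0) := by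
    refine (h1.div_atTop hβ).congr' ?_
    filter_upwards [hβ.eventually_gt_atTop 0] with n hn
    simp only [Function.comp]
    field_simp
  have h3 : Tendsto (fun n => l n * (1 - stepCoeff (β n) k)) atTop (𝓝 (k ^ 2 * s / 2)) := by
    have := hl.mul h1
    rw [show s * (k ^ 2 / 2) = k ^ 2 * s / 2 by ring] at this
    refine this.congr' ?_
    filter_upwards [hβ.eventually_gt_atTop 0] with n hn
    simp only [Function.comp]
    field_simp
  simpa using tendsto_one_sub_pow h2 h3

/-! ### A spectral gap estimate uniform in the frequency -/

/-- The constant in the lower bound for the spectral gap of a step. -/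
def gapConst : ℝ := min (1 / 2) (Real.exp (-(1 / 2)) / (2 * Real.pi ^ 2 * √(Real.pi ^ 3 / 2)))

lemma gapConst_pos : 0 < gapConst := lt_min (by norm_num) (by positivity)

/-- Only `x` between `1 / (2√β)` and `1 / √β` is kept: there `x²` is of order `1 / β`, and `k² ≤ 2β`
gives `(2 k x)² ≤ 8 < π²`, so `1 - cos (2 k x) ≥ 2 (2 k x)² / π²`. The frequency is doubled because
`stepCoeff_sq_le` bounds `c_k²` through `c_{2k}`. -/
lemma le_one_sub_stepCoeff {β : ℝ} (hβ : 1 ≤ β) {k : ℤ} (hk : (k : ℝ) ^ 2 ≤ 2 * β) :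
    2 * gapConst * k ^ 2 / β ≤ 1 - stepCoeff β (2 * k) := by
  have hβ0 : 0 < β := by linarith
  have hs : 1 ≤ √β := by rw [Real.one_le_sqrt]; exact hβ
  have hs0 : 0 < √β := by linarith
  have hss : √β ^ 2 = β := Real.sq_sqrt hβ0.le
  have h0 : (0 : ℝ) < (√β)⁻¹ := by positivity
  have h1 : (√β)⁻¹ ≤ 1 := inv_le_one_of_one_le₀ hs
  have hpi := Real.pi_gt_three
  have hsub : Set.Ioc ((√β)⁻¹ / 2) (√β)⁻¹ ⊆ Set.Ioc (-Real.pi) Real.pi :=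
    Set.Ioc_subset_Ioc (by linarith) (by linarith)
  have hig : Integrable (fun x => Real.exp (β * Real.cos x) • (1 - Real.cos ((2 * k : ℤ) * x)))
    (volume.restrict (Set.Ioc (-Real.pi) Real.pi)) := integrable_of_continuous_period (by fun_prop)
  have hnum : k ^ 2 * Real.exp (β - 1 / 2) / (Real.pi ^ 2 * β * √β) ≤
      ∫ x in Set.Ioc (-Real.pi) Real.pi,
        Real.exp (β * Real.cos x) • (1 - Real.cos ((2 * k : ℤ) * x)) := by
    calc _ = ∫ x in Set.Ioc ((√β)⁻¹ / 2) (√β)⁻¹,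
          Real.exp (β - 1 / 2) * (2 / Real.pi ^ 2 * (k ^ 2 / β)) := by
          rw [setIntegral_const, Real.volume_real_Ioc_of_le (by linarith), smul_eq_mul]
          field_simp
          norm_num
      _ ≤ ∫ x in Set.Ioc ((√β)⁻¹ / 2) (√β)⁻¹,
          Real.exp (β * Real.cos x) • (1 - Real.cos ((2 * k : ℤ) * x)) := by
          refine setIntegral_mono_on (integrable_const _) (hig.mono_measure
            (Measure.restrict_mono hsub le_rfl)) measurableSet_Ioc fun x hx => ?_
          have hx0 : 0 < x := by linarith [hx.1]
          have hx2 : x ^ 2 ≤ ((√β)⁻¹) ^ 2 := pow_le_pow_left₀ hx0.le hx.2 2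
          have hx3 : ((√β)⁻¹ / 2) ^ 2 ≤ x ^ 2 := pow_le_pow_left₀ (by positivity) hx.1.le 2
          rw [inv_pow, hss] at hx2
          rw [div_pow, inv_pow, hss] at hx3
          have hx4 : β * x ^ 2 ≤ 1 := by
            calc β * x ^ 2 ≤ β * β⁻¹ := by gcongr
              _ = 1 := mul_inv_cancel₀ (by linarith)
          have hy : |((2 * k : ℤ) : ℝ) * x| ≤ Real.pi := by
            refine abs_le_of_sq_le_sq ?_ (by linarith)
            push_cast
            nlinarith [sq_nonneg x]
          have hc := Real.cos_le_one_sub_mul_cos_sq hy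
          rw [smul_eq_mul]
          refine mul_le_mul ?_ ?_ (by positivity) (Real.exp_pos _).le
          · refine Real.exp_le_exp.2 ?_
            nlinarith [Real.one_sub_sq_div_two_le_cos (x := x)]
          · have : 2 / Real.pi ^ 2 * (k ^ 2 / β) ≤
                2 / Real.pi ^ 2 * (((2 * k : ℤ) : ℝ) * x) ^ 2 := by
              refine mul_le_mul_of_nonneg_left ?_ (by positivity)
              push_cast
              calc (k : ℝ) ^ 2 / β = 4 * k ^ 2 * (β⁻¹ / 2 ^ 2) := by ring
                _ ≤ 4 * k ^ 2 * x ^ 2 := by gcongr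
                _ = _ := by ring
            linarith
      _ ≤ _ := by
          refine setIntegral_mono_set hig (ae_of_all _ fun x => ?_) hsub.eventuallyLE
          exact mul_nonneg (Real.exp_pos _).le (by simpa using Real.cos_le_one _)
  rw [one_sub_stepCoeff, integral_stepLaw, smul_eq_mul, le_inv_mul_iff₀ (stepMass_pos β)]
  refine le_trans ?_ hnum
  calc stepMass β * (2 * gapConst * k ^ 2 / β)
      ≤ Real.exp β * (√(Real.pi ^ 3 / 2) / √β) *
        (2 * (Real.exp (-(1 / 2)) / (2 * Real.pi ^ 2 * √(Real.pi ^ 3 / 2))) * k ^ 2 / β) := by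
        have := gapConst_pos
        have := stepMass_le hβ0
        gcongr
        exact min_le_right _ _
    _ = k ^ 2 * Real.exp (β - 1 / 2) / (Real.pi ^ 2 * β * √β) := by
        rw [sub_eq_add_neg, Real.exp_add]
        field_simp

/-- For `k² ≤ 2β`, Jensen and the double angle formula give `c_k² ≤ (1 + c_{2k}) / 2`, and the gap
applies. For `k² > 2β` the decay `k² c_k² ≤ β` suffices, as `gapConst ≤ 1 / 2`. Squaring avoids the
sign of `c_k`; the inverse form stays meaningful when `k²` exceeds `β`. -/
lemma stepCoeff_sq_le {β : ℝ} (hβ : 1 ≤ β) (k : ℤ) :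
    stepCoeff β k ^ 2 ≤ (1 + gapConst * k ^ 2 / β)⁻¹ := by
  have hβ0 : 0 < β := by linarith
  have hg := gapConst_pos
  rw [← one_div, le_div_iff₀ (by positivity)]
  rcases le_or_gt ((k : ℝ) ^ 2) (2 * β) with hk | hk
  · have h1 := le_one_sub_stepCoeff hβ hk
    have h2 : stepCoeff β k ^ 2 ≤ (1 + stepCoeff β (2 * k)) / 2 := by
      refine (sq_integral_le (integrable_stepLaw β (by fun_prop))
        (integrable_stepLaw β (by fun_prop))).trans_eq ?_
      have : (1 + stepCoeff β (2 * k)) / 2 =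
          ∫ x, (1 + Real.cos ((2 * k : ℤ) * x)) / 2 ∂stepLaw β := by
        rw [integral_div, integral_add (integrable_const _) (integrable_stepLaw β (by fun_prop))]
        simp [stepCoeff]
      rw [this]
      congr with x
      have := Real.cos_sq (k * x)
      rw [this]
      push_cast
      ring_nf
    have h3 : stepCoeff β k ^ 2 ≤ 1 - gapConst * k ^ 2 / β := by
      have : 2 * gapConst * k ^ 2 / β = 2 * (gapConst * k ^ 2 / β) := by ring
      linarith
    have h4 : 0 ≤ gapConst * k ^ 2 / β := by positivity
    nlinarith
  · have h1 := sq_mul_stepCoeff_sq_le hβ0.le k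
    have h2 : stepCoeff β k ^ 2 ≤ 1 / 2 := by nlinarith [sq_nonneg (stepCoeff β k)]
    have h3 : stepCoeff β k ^ 2 * (gapConst * k ^ 2 / β) ≤ 1 / 2 := by
      calc stepCoeff β k ^ 2 * (gapConst * k ^ 2 / β)
          = gapConst * (k ^ 2 * stepCoeff β k ^ 2) / β := by ring
        _ ≤ gapConst * β / β := by gcongr
        _ = gapConst := by field_simp
        _ ≤ 1 / 2 := min_le_left _ _
    linarith

/-- Bernoulli's inequality applied to the `l / 2` squared factors. For `l` comparable to `β` the
result is a fixed majorant, summable over `k`. -/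
lemma abs_stepCoeff_pow_le {β : ℝ} (hβ : 1 ≤ β) (k : ℤ) (l : ℕ) :
    |stepCoeff β k ^ l| ≤ (1 + gapConst * (l / 2 : ℕ) / β * k ^ 2)⁻¹ := by
  have hβ0 : 0 < β := by linarith
  have hg := gapConst_pos
  have h0 : 0 ≤ gapConst * k ^ 2 / β := by positivity
  calc |stepCoeff β k ^ l| = |stepCoeff β k| ^ l := abs_pow _ _
    _ ≤ |stepCoeff β k| ^ (2 * (l / 2)) :=
        pow_le_pow_of_le_one (abs_nonneg _) (abs_stepCoeff_le_one β k) (Nat.mul_div_le l 2)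
    _ = (stepCoeff β k ^ 2) ^ (l / 2) := by rw [pow_mul, sq_abs]
    _ ≤ ((1 + gapConst * k ^ 2 / β)⁻¹) ^ (l / 2) := by gcongr; exact stepCoeff_sq_le hβ k
    _ ≤ _ := by
        rw [inv_pow]
        refine inv_anti₀ (by positivity) ?_
        refine le_trans (le_of_eq ?_) (one_add_mul_le_pow (by linarith) (l / 2))
        ring

lemma summable_inv_one_add_sq {c : ℝ} (hc : 0 < c) :
    Summable fun k : ℤ => (1 + c * (k : ℝ) ^ 2)⁻¹ := by
  have h : Summable fun k : ℤ => c⁻¹ * (1 / (k : ℝ) ^ 2) :=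
    (Real.summable_one_div_int_pow.2 one_lt_two).mul_left _
  refine Summable.of_norm_bounded_eventually h ?_
  filter_upwards [(Set.finite_singleton (0 : ℤ)).compl_mem_cofinite] with k hk
  have hk0 : (0 : ℝ) < (k : ℝ) ^ 2 := by
    have : (k : ℝ) ≠ 0 := by exact_mod_cast hk
    positivity
  rw [Real.norm_of_nonneg (by positivity), one_div, ← mul_inv]
  exact inv_anti₀ (by positivity) (by linarith)

/-! ### The local limit theorem -/

/-- The density of a step, as a function on the circle. -/
def stepDensity (β : ℝ) : C(Circle, ℂ) where
  toFun z := ((Real.exp (β * (z : ℂ).re) / stepMass β : ℝ) : ℂ)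
  continuous_toFun := by fun_prop

/-- The density of the position of the walk after `l ≥ 1` steps. -/
def chainKernel (β : ℝ) (l : ℕ) : C(Circle, ℂ) :=
  rotAvg (convPow (stepLaw β) (l - 1)) (stepDensity β)

/-- The condition `1 ≤ l` is needed because `chainKernel` counts `l - 1` averages after one density,
with truncated subtraction. -/
lemma rotAvg_chainKernel (β : ℝ) (d : ℕ) {l : ℕ} (hl : 1 ≤ l) :
    rotAvg (convPow (stepLaw β) d) (chainKernel β l) = chainKernel β (d + l) := by
  obtain ⟨l, rfl⟩ := Nat.exists_eq_add_of_le' hl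
  exact (rotAvg_convPow_add (stepLaw β) d l (stepDensity β)).symm

/-- Averaging contracts the sup norm, so one kernel of length about `n / 2` controls all longer
ones. -/
lemma norm_chainKernel_anti (β : ℝ) {l m : ℕ} (hl : 1 ≤ l) (hm : l ≤ m) :
    ‖chainKernel β m‖ ≤ ‖chainKernel β l‖ := by
  obtain ⟨d, rfl⟩ := Nat.exists_eq_add_of_le' hm
  rw [← rotAvg_chainKernel β d hl]
  exact norm_rotAvg_le _ _

lemma angleCoeff_stepDensity (β : ℝ) (k : ℤ) :
    angleCoeff (fun x => stepDensity β (Circle.exp x)) k = stepCoeff β k := by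
  rw [← stepCoeff_neg, ← charFun_stepLaw, charFun_apply_real, integral_stepLaw, angleCoeff,
    ← integral_smul]
  congr with x
  simp only [stepDensity, ContinuousMap.coe_mk, Circle.coe_exp, Complex.exp_ofReal_mul_I_re,
    Complex.real_smul]
  push_cast
  ring_nf

lemma angleCoeff_chainKernel (β : ℝ) {l : ℕ} (hl : 1 ≤ l) (k : ℤ) :
    angleCoeff (fun x => chainKernel β l (Circle.exp x)) k = (stepCoeff β k : ℂ) ^ l := by
  rw [chainKernel, angleCoeff_rotAvg, charFun_convPow, charFun_stepLaw, angleCoeff_stepDensity,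
    ← pow_succ, Nat.sub_add_cancel hl]

/-- The continuous function on the circle with given Fourier coefficients. -/
def circleSeries (a : ℤ → ℂ) : C(Circle, ℂ) :=
  ∑' k : ℤ, ((2 * Real.pi : ℂ)⁻¹ * a k) • circleMonomial k

lemma summable_circleSeries {a : ℤ → ℂ} (ha : Summable a) :
    Summable fun k : ℤ => ((2 * Real.pi : ℂ)⁻¹ * a k) • circleMonomial k := by
  refine Summable.of_norm ?_
  simp only [norm_smul, norm_circleMonomial, mul_one]
  exact (ha.mul_left _).norm

lemma hasSum_circleSeries {a : ℤ → ℂ} (ha : Summable a) :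
    HasSum (fun k : ℤ => ((2 * Real.pi : ℂ)⁻¹ * a k) • circleMonomial k) (circleSeries a) :=
  (summable_circleSeries ha).hasSum

lemma eq_circleSeries {f : ℝ → ℂ} (hf : Continuous f) (hp : f.Periodic (2 * Real.pi))
    (hs : Summable (angleCoeff f)) (x : ℝ) : f x = circleSeries (angleCoeff f) (Circle.exp x) := by
  have h1 := (hasSum_angleCoeff hf hp hs x).mul_left (2 * Real.pi : ℂ)⁻¹
  have h2 := ContinuousMap.hasSum_apply (hasSum_circleSeries hs) (Circle.exp x)
  have hpi : (2 * Real.pi : ℂ) ≠ 0 := by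
    simp [Real.pi_ne_zero]
  rw [← mul_assoc, inv_mul_cancel₀ hpi, one_mul] at h1
  refine h1.unique (h2.congr_fun fun k => ?_)
  rw [ContinuousMap.smul_apply, circleMonomial_exp, smul_eq_mul, mul_assoc (2 * Real.pi : ℂ)⁻¹]

lemma eq_circleSeries_of_circle (f : C(Circle, ℂ))
    (hs : Summable (angleCoeff fun x => f (Circle.exp x))) :
    f = circleSeries (angleCoeff fun x => f (Circle.exp x)) := by
  ext z
  obtain ⟨x, rfl⟩ := Circle.exp_surjective z
  exact eq_circleSeries (f := fun x => f (Circle.exp x)) (by fun_prop)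
    (fun x => by simp only [Circle.periodic_exp x]) hs x

/-- The heat kernel on the circle, i.e. the density of a Gaussian of variance `s` modulo `2π`. -/
def heatKernel (s : ℝ) : C(Circle, ℂ) :=
  circleSeries fun k => (Real.exp (-(k ^ 2 * s / 2)) : ℂ)

lemma summable_heat {s : ℝ} (hs : 0 < s) :
    Summable fun k : ℤ => (Real.exp (-((k : ℝ) ^ 2 * s / 2)) : ℂ) := by
  refine Complex.summable_ofReal.2 ?_
  refine Summable.of_nonneg_of_le (fun k => (Real.exp_pos _).le) (fun k => ?_)
    (summable_inv_one_add_sq (half_pos hs))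
  rw [Real.exp_neg]
  refine inv_anti₀ (by positivity) ?_
  have := Real.add_one_le_exp ((k : ℝ) ^ 2 * s / 2)
  linarith

/-- The local central limit theorem for the walk. -/
theorem tendsto_chainKernel {β : ℕ → ℝ} {l : ℕ → ℕ} {s : ℝ} (hβ : Tendsto β atTop atTop)
    (hs : 0 < s) (hl : Tendsto (fun n => l n / β n) atTop (𝓝 s)) :
    Tendsto (fun n => chainKernel (β n) (l n)) atTop (𝓝 (heatKernel s)) := by
  have hg := gapConst_pos
  -- Eventually `l / β > s / 2`; halving gives `s / 4`, and rounding down costs at most `1 / (2β) ≤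
  -- s / 16`, so `s / 8` is safe.
  have hl2 : ∀ᶠ n in atTop, 1 ≤ β n ∧ 1 ≤ l n ∧ s / 8 ≤ (l n / 2 : ℕ) / β n := by
    filter_upwards [hβ.eventually_ge_atTop 1, hβ.eventually_ge_atTop (8 / s),
      hl.eventually_const_lt (half_lt_self hs)] with n h1 h2 h3
    have hβ0 : 0 < β n := by linarith
    rw [lt_div_iff₀ hβ0] at h3
    have h4 : 8 ≤ β n * s := by rwa [div_le_iff₀ hs] at h2
    have h5 : (l n : ℝ) ≤ 2 * (l n / 2 : ℕ) + 1 := by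
      have : l n ≤ 2 * (l n / 2) + 1 := by omega
      exact_mod_cast this
    refine ⟨h1, ?_, ?_⟩
    · have : (0 : ℝ) < l n := by nlinarith
      exact_mod_cast this
    · rw [le_div_iff₀ hβ0]
      nlinarith
  have hc : 0 < gapConst * (s / 8) := by positivity
  have hbound : ∀ᶠ n in atTop, ∀ k : ℤ,
      ‖(stepCoeff (β n) k : ℂ) ^ l n‖ ≤ (1 + gapConst * (s / 8) * (k : ℝ) ^ 2)⁻¹ := by
    filter_upwards [hl2] with n hn k
    rw [← Complex.ofReal_pow, Complex.norm_real]
    refine (abs_stepCoeff_pow_le hn.1 k (l n)).trans (inv_anti₀ (by positivity) ?_)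
    have := mul_le_mul_of_nonneg_right (mul_le_mul_of_nonneg_left hn.2.2 hg.le)
      (sq_nonneg (k : ℝ))
    rw [mul_div_assoc]
    linarith
  have hlim : Tendsto (fun n => circleSeries fun k => (stepCoeff (β n) k : ℂ) ^ l n) atTop
      (𝓝 (heatKernel s)) := by
    -- The series is summed in `C(Circle, ℂ)`, where characters have norm one, so termwise
    -- convergence under a summable bound is uniform convergence of the kernels.
    refine tendsto_tsum_of_dominated_convergence
      (bound := fun k : ℤ => ‖(2 * Real.pi : ℂ)⁻¹‖ * (1 + gapConst * (s / 8) * (k : ℝ) ^ 2)⁻¹)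
      ((summable_inv_one_add_sq hc).mul_left _) (fun k => ?_) ?_
    · refine Tendsto.smul_const (Tendsto.const_mul _ ?_) _
      simp only [← Complex.ofReal_pow]
      exact (Complex.continuous_ofReal.tendsto _).comp (tendsto_stepCoeff_pow hβ hl k)
    · filter_upwards [hbound] with n hn k
      rw [norm_smul, norm_circleMonomial, mul_one, norm_mul]
      exact mul_le_mul_of_nonneg_left (hn k) (norm_nonneg _)
  refine hlim.congr' ?_
  filter_upwards [hl2, hbound] with n hn hb
  have e : angleCoeff (fun x => chainKernel (β n) (l n) (Circle.exp x)) =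
      fun k => (stepCoeff (β n) k : ℂ) ^ l n := funext (angleCoeff_chainKernel (β n) hn.2.1)
  rw [← e]
  refine (eq_circleSeries_of_circle _ ?_).symm
  rw [e]
  exact Summable.of_norm_bounded (summable_inv_one_add_sq hc) hb

/-! ### The Markov property of the chain -/

lemma pi_eq_map_cons {n : ℕ} (μ : Fin (n + 1) → Measure ℝ) [∀ i, SigmaFinite (μ i)] :
    Measure.pi μ = ((μ 0).prod (Measure.pi fun j : Fin n => μ j.succ)).map
      fun p => (Fin.cons p.1 p.2 : Fin (n + 1) → ℝ) := by
  have h := (measurePreserving_piFinSuccAbove μ 0).symm.map_eq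
  rw [← h]
  congr 1
  ext p i
  refine Fin.cases ?_ (fun i => ?_) i
  · simp
  · simp

/-- The reference measure without the site at the left end. -/
def tailMeasure (n : ℕ) (y : ℝ) : Measure (Fin (n + 1) → ℝ) :=
  Measure.pi fun j => siteMeasure (n + 1) 0 y j.succ

instance (n : ℕ) (y : ℝ) : IsFiniteMeasure (tailMeasure n y) := by
  unfold tailMeasure
  infer_instance

lemma continuous_finCons {n : ℕ} :
    Continuous fun p : ℝ × (Fin n → ℝ) => (Fin.cons p.1 p.2 : Fin (n + 1) → ℝ) := by
  refine continuous_pi fun i => ?_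
  refine Fin.cases ?_ (fun i => ?_) i
  · simpa using continuous_fst
  · simp only [Fin.cons_succ]; fun_prop

/-- The left site carries a point mass. The boundary value `0` inside `tailMeasure` is a placeholder
that no remaining site sees. -/
lemma referenceMeasure_succ (n : ℕ) (x y : ℝ) :
    referenceMeasure (n + 1) x y = (tailMeasure n y).map fun θ => (Fin.cons x θ : Fin (n + 2) → ℝ) := by
  have h0 : siteMeasure (n + 1) x y 0 = Measure.dirac x := by simp [siteMeasure]
  have h1 : (fun j : Fin (n + 1) => siteMeasure (n + 1) x y j.succ) =
      fun j => siteMeasure (n + 1) 0 y j.succ := by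
    funext j
    simp [siteMeasure, Fin.succ_ne_zero]
  rw [referenceMeasure, pi_eq_map_cons, h0, h1, Measure.dirac_prod, Measure.map_map
    continuous_finCons.measurable (by fun_prop), tailMeasure]
  rfl

lemma tailMeasure_succ (n : ℕ) (y : ℝ) :
    tailMeasure (n + 1) y = ((volume.restrict (Set.Ioc (-Real.pi) Real.pi)).prod
      (tailMeasure n y)).map fun p => (Fin.cons p.1 p.2 : Fin (n + 2) → ℝ) := by
  have h0 : siteMeasure (n + 2) 0 y (0 : Fin (n + 2)).succ =
      volume.restrict (Set.Ioc (-Real.pi) Real.pi) := by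
    have : (0 : Fin (n + 2)).succ ≠ Fin.last (n + 2) := by
      rw [Ne, Fin.ext_iff]; simp
    rw [siteMeasure, if_neg (Fin.succ_ne_zero _), if_neg this]
  have h1 : (fun j : Fin (n + 1) => siteMeasure (n + 2) 0 y j.succ.succ) =
      fun j => siteMeasure (n + 1) 0 y j.succ := by
    funext j
    have : j.succ.succ = Fin.last (n + 2) ↔ j.succ = Fin.last (n + 1) := by
      simp [Fin.ext_iff]
    simp only [siteMeasure, Fin.succ_ne_zero, if_false, this]
  rw [tailMeasure, pi_eq_map_cons, h0, h1, tailMeasure]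

lemma tailMeasure_zero (y : ℝ) : tailMeasure 0 y = Measure.dirac fun _ => y := by
  have h : siteMeasure 1 0 y (0 : Fin 1).succ = Measure.dirac y := by
    have : (0 : Fin 1).succ = Fin.last 1 := rfl
    rw [siteMeasure, if_neg (Fin.succ_ne_zero _), if_pos this]
  rw [tailMeasure, pi_eq_map_cons, h, Measure.pi_of_empty, Measure.dirac_prod_dirac,
    Measure.map_dirac' continuous_finCons.measurable]
  congr 1
  funext i
  fin_cases i
  rfl

/-- The first step decomposition of the reference measure. -/
lemma integral_referenceMeasure_succ (n : ℕ) (x y : ℝ) {F : (Fin (n + 3) → ℝ) → ℂ}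
    (hF : Continuous F) (hF' : Integrable F (referenceMeasure (n + 2) x y)) :
    ∫ θ, F θ ∂referenceMeasure (n + 2) x y =
      ∫ u in Set.Ioc (-Real.pi) Real.pi,
        ∫ θ, F (Fin.cons x θ) ∂referenceMeasure (n + 1) u y := by
  have hc : ∀ m : ℕ, ∀ u : ℝ, Measurable fun θ : Fin m → ℝ => (Fin.cons u θ : Fin (m + 1) → ℝ) :=
    fun m u => (continuous_finCons.comp (by fun_prop : Continuous fun θ => (u, θ))).measurable
  rw [referenceMeasure_succ, tailMeasure_succ] at hF' ⊢
  rw [integral_map (hc _ x).aemeasurable hF.aestronglyMeasurable]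
  rw [integrable_map_measure hF.aestronglyMeasurable (hc _ x).aemeasurable] at hF'
  have hF2 : Continuous fun θ => F (Fin.cons x θ : Fin (n + 3) → ℝ) :=
    hF.comp (continuous_finCons.comp (by fun_prop : Continuous fun θ => (x, θ)))
  rw [integral_map continuous_finCons.measurable.aemeasurable hF2.aestronglyMeasurable]
  change Integrable (fun θ => F (Fin.cons x θ : Fin (n + 3) → ℝ)) _ at hF'
  rw [integrable_map_measure hF2.aestronglyMeasurable
    continuous_finCons.measurable.aemeasurable] at hF'
  refine (integral_prod _ hF').trans ?_
  congr with u
  rw [referenceMeasure_succ, integral_map (hc _ u).aemeasurable hF2.aestronglyMeasurable]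
  rfl

lemma ae_referenceMeasure_zero (n : ℕ) (x y : ℝ) :
    ∀ᵐ θ ∂referenceMeasure (n + 1) x y, θ 0 = x := by
  have hm : Measurable fun θ : Fin (n + 1) → ℝ => (Fin.cons x θ : Fin (n + 2) → ℝ) :=
    (continuous_finCons.comp (by fun_prop : Continuous fun θ => (x, θ))).measurable
  rw [referenceMeasure_succ, ae_map_iff hm.aemeasurable
    (measurableSet_eq_fun (by fun_prop) (by fun_prop))]
  exact ae_of_all _ fun θ => rfl

/-- The spins of a configuration, extended by `1`. -/
def spins (n : ℕ) (θ : Fin (n + 1) → ℝ) (j : ℕ) : Circle :=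
  if h : j < n + 1 then Circle.exp (θ ⟨j, h⟩) else 1

lemma continuous_spins (n : ℕ) : Continuous (spins n) := by
  refine continuous_pi fun j => ?_
  unfold spins
  split_ifs
  · fun_prop
  · fun_prop

/-- Prepend a value to a sequence. -/
def consSeq (z : Circle) (s : ℕ → Circle) : ℕ → Circle
  | 0 => z
  | j + 1 => s j

lemma spins_cons (n : ℕ) (x : ℝ) (θ : Fin (n + 1) → ℝ) :
    spins (n + 1) (Fin.cons x θ) = consSeq (Circle.exp x) (spins n θ) := by
  funext j
  cases j with
  | zero => simp [spins, consSeq]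
  | succ j =>
    simp only [spins, consSeq, Nat.add_lt_add_iff_right]
    split_ifs with h
    · rw [show (⟨j + 1, by omega⟩ : Fin (n + 2)) = (⟨j, h⟩ : Fin (n + 1)).succ from rfl,
        Fin.cons_succ]
    · rfl

lemma hamiltonian_cons (n : ℕ) (x : ℝ) (θ : Fin (n + 1) → ℝ) :
    hamiltonian (n + 1) (Fin.cons x θ) = -Real.cos (x - θ 0) + hamiltonian n θ := by
  rw [hamiltonian, Fin.sum_univ_succ, hamiltonian]
  simp only [Fin.castSucc_zero, Fin.cons_zero, Fin.cons_succ, ← Fin.succ_castSucc]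
  ring

lemma continuous_hamiltonian (n : ℕ) : Continuous (hamiltonian n) := by
  unfold hamiltonian
  fun_prop

/-- The integral of a function of the spins against the unnormalised Gibbs weight, for the chain with
`n + 1` edges. -/
def chainInt (n : ℕ) (β x y : ℝ) (G : (ℕ → Circle) → ℂ) : ℂ :=
  ∫ θ, (Real.exp (-β * hamiltonian (n + 1) θ) : ℂ) * G (spins (n + 1) θ)
    ∂referenceMeasure (n + 1) x y

lemma exists_bound_of_continuous {X : Type*} [TopologicalSpace X] [CompactSpace X] {G : X → ℂ}
    (hG : Continuous G) : ∃ C, ∀ s, ‖G s‖ ≤ C := by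
  obtain ⟨C, hC⟩ := isCompact_univ.exists_bound_of_continuousOn hG.continuousOn
  exact ⟨C, fun s => hC s (Set.mem_univ s)⟩

lemma integrable_chainInt (n : ℕ) (β x y : ℝ) {G : (ℕ → Circle) → ℂ} (hG : Continuous G) :
    Integrable (fun θ => (Real.exp (-β * hamiltonian n θ) : ℂ) * G (spins n θ))
      (referenceMeasure n x y) := by
  obtain ⟨C, hC⟩ := exists_bound_of_continuous hG
  refine Integrable.mul_bdd (integrable_exp_hamiltonian n β x y).ofReal
    (hG.comp (continuous_spins n)).aestronglyMeasurable (ae_of_all _ fun θ => hC _)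

/-- The Markov property in integrated form: the first edge splits off and the first interior angle
`u` becomes the left boundary value of a shorter chain. -/
lemma chainInt_succ (n : ℕ) (β x y : ℝ) {G : (ℕ → Circle) → ℂ} (hG : Continuous G) :
    chainInt (n + 1) β x y G = ∫ u in Set.Ioc (-Real.pi) Real.pi,
      (Real.exp (β * Real.cos (x - u)) : ℂ) *
        chainInt n β u y fun s => G (consSeq (Circle.exp x) s) := by
  rw [chainInt, integral_referenceMeasure_succ _ _ _ ?_ (integrable_chainInt _ _ _ _ hG)]
  · congr with u
    rw [chainInt, ← integral_const_mul]
    have h0 := ae_referenceMeasure_zero n u y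
    refine integral_congr_ae ?_
    filter_upwards [h0] with θ hθ
    rw [spins_cons, hamiltonian_cons, hθ, ← mul_assoc, ← Complex.ofReal_mul, ← Real.exp_add]
    congr 3
    ring_nf
  · have := continuous_hamiltonian (n + 2)
    have := continuous_spins (n + 2)
    fun_prop

lemma chainInt_congr (n : ℕ) (β x y : ℝ) {G G' : (ℕ → Circle) → ℂ}
    (h : ∀ s, s 0 = Circle.exp x → G s = G' s) : chainInt n β x y G = chainInt n β x y G' := by
  refine integral_congr_ae ?_
  filter_upwards [ae_referenceMeasure_zero n x y] with θ hθ
  rw [h]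
  rw [← hθ]
  rfl

lemma chainInt_const_mul (n : ℕ) (β x y : ℝ) (a : ℂ) (G : (ℕ → Circle) → ℂ) :
    chainInt n β x y (fun s => a * G s) = a * chainInt n β x y G := by
  rw [chainInt, chainInt, ← integral_const_mul]
  congr with θ
  ring

/-- Translation by `x` over a period and evenness of the cosine: the unnormalised one-step operator
is `stepMass β` times a rotation average. -/
lemma setIntegral_exp_mul_cos (β x : ℝ) (f : C(Circle, ℂ)) :
    ∫ u in Set.Ioc (-Real.pi) Real.pi,
      (Real.exp (β * Real.cos (x - u)) : ℂ) * f (Circle.exp u) =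
    stepMass β * rotAvg (stepLaw β) f (Circle.exp x) := by
  have h := integral_Ioc_add_of_periodic
    (f := fun u : ℝ => (Real.exp (β * Real.cos (x - u)) : ℂ) * f (Circle.exp u)) (fun u => by
      simp only [Circle.periodic_exp u, ← sub_sub, Real.cos_sub_two_pi]) x
  rw [← h, rotAvg_apply, integral_stepLaw, Complex.real_smul, ← mul_assoc]
  rw [← Complex.ofReal_mul, mul_inv_cancel₀ (stepMass_pos β).ne', Complex.ofReal_one, one_mul]
  congr with u
  rw [Complex.real_smul, sub_add_cancel_right, Real.cos_neg, add_comm, Circle.exp_add]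

/-- If the integral of `G` depends on the left angle `u` through `f (exp (i u))`, then placing `d`
extra steps before `G` applies the one-step operator `d` times to `f`. All chain integrals below
come from this by choosing `G`. -/
lemma chainInt_shift (n : ℕ) (β y : ℝ) {G : (ℕ → Circle) → ℂ} (hG : Continuous G)
    {f : C(Circle, ℂ)} (hf : ∀ u, chainInt n β u y G = stepMass β ^ (n + 1) * f (Circle.exp u))
    (d : ℕ) (x : ℝ) :
    chainInt (n + d) β x y (fun s => G fun j => s (d + j)) =
      stepMass β ^ (n + d + 1) * rotAvg (convPow (stepLaw β) d) f (Circle.exp x) := by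
  induction d generalizing x with
  | zero => simpa [rotAvg_convPow_zero] using hf x
  | succ d ih =>
    rw [← add_assoc, chainInt_succ _ _ _ _ (by fun_prop)]
    have e : ∀ s : ℕ → Circle, (fun j => consSeq (Circle.exp x) s (d + 1 + j)) =
        fun j => s (d + j) := by
      intro s
      funext j
      rw [add_right_comm]
      rfl
    simp only [e, ih]
    rw [rotAvg_convPow_succ, show n + d + 1 + 1 = (n + d + 1) + 1 from rfl, pow_succ _ (n + d + 1),
      mul_assoc, ← setIntegral_exp_mul_cos, ← integral_const_mul]
    congr with u
    ring

/-- Translation of a function on the circle. -/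
def translate (w : Circle) (f : C(Circle, ℂ)) : C(Circle, ℂ) :=
  f.comp ⟨fun z => z * w⁻¹, by fun_prop⟩

@[simp] lemma translate_apply (w : Circle) (f : C(Circle, ℂ)) (z : Circle) :
    translate w f z = f (z * w⁻¹) := rfl

lemma rotAvg_translate (μ : Measure ℝ) [IsProbabilityMeasure μ] (w : Circle) (f : C(Circle, ℂ)) :
    rotAvg μ (translate w f) = translate w (rotAvg μ f) := by
  ext z
  simp only [rotAvg_apply, translate_apply]
  congr with u
  rw [mul_right_comm]

lemma norm_translate (w : Circle) (f : C(Circle, ℂ)) : ‖translate w f‖ ≤ ‖f‖ :=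
  (ContinuousMap.norm_le _ (norm_nonneg _)).2 fun _ => f.norm_coe_le_norm _

lemma tendsto_translate (w : Circle) {f : ℕ → C(Circle, ℂ)} {g : C(Circle, ℂ)}
    (h : Tendsto f atTop (𝓝 g)) :
    Tendsto (fun n => translate w (f n)) atTop (𝓝 (translate w g)) := by
  rw [tendsto_iff_norm_sub_tendsto_zero] at h ⊢
  refine squeeze_zero (fun n => norm_nonneg _) (fun n => ?_) h
  exact norm_translate w (f n - g)

lemma chainInt_zero (β x y : ℝ) :
    chainInt 0 β x y (fun _ => 1) =
      stepMass β * translate (Circle.exp y) (chainKernel β 1) (Circle.exp x) := by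
  have hc : Measurable fun θ : Fin 1 → ℝ => (Fin.cons x θ : Fin 2 → ℝ) :=
    (continuous_finCons.comp (by fun_prop : Continuous fun θ => (x, θ))).measurable
  have hh := continuous_hamiltonian 1
  rw [chainInt, referenceMeasure_succ, integral_map hc.aemeasurable
    (Continuous.aestronglyMeasurable (by fun_prop)), tailMeasure_zero, integral_dirac]
  have e1 : hamiltonian 1 (Fin.cons x fun _ : Fin 1 => y) = -Real.cos (x - y) := by
    simp [hamiltonian]
  have e2 : translate (Circle.exp y) (chainKernel β 1) (Circle.exp x) =
      ((Real.exp (β * Real.cos (x - y)) / stepMass β : ℝ) : ℂ) := by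
    rw [translate_apply, chainKernel, rotAvg_convPow_zero, ← Circle.exp_neg, ← Circle.exp_add,
      ← sub_eq_add_neg, stepDensity]
    simp only [ContinuousMap.coe_mk, Circle.coe_exp, Complex.exp_ofReal_mul_I_re]
  rw [e1, e2, ← Complex.ofReal_mul, mul_div_cancel₀ _ (stepMass_pos β).ne', neg_mul_neg, mul_one]

lemma chainInt_one (n : ℕ) (β x y : ℝ) :
    chainInt n β x y (fun _ => 1) =
      stepMass β ^ (n + 1) * translate (Circle.exp y) (chainKernel β (n + 1)) (Circle.exp x) := by
  have h := chainInt_shift 0 β y (G := fun _ => 1) (by fun_prop)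
    (f := translate (Circle.exp y) (chainKernel β 1))
    (fun u => by rw [chainInt_zero, zero_add, pow_one]) n x
  rw [zero_add] at h
  rw [h, rotAvg_translate, rotAvg_chainKernel β n le_rfl]

lemma continuous_listVal {T : Type*} [Add T] (L : List (T × C(Circle, ℂ))) :
    Continuous (listVal L : (T → Circle) → ℂ) := by
  induction L with
  | nil => exact continuous_const
  | cons p L ih =>
    obtain ⟨d, H⟩ := p
    exact (H.continuous.comp (continuous_apply d)).mul
      (ih.comp (continuous_pi fun t => continuous_apply (d + t)))

/-- Induction on the list: once the walk has reached a marked time its spin is the fixed left end of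
the remaining chain, so `H` comes out as a multiplication operator, and `chainInt_shift` inserts the
steps before it. -/
lemma chainInt_listVal (n : ℕ) (β y : ℝ) (L : List (ℕ × C(Circle, ℂ))) (x : ℝ) :
    chainInt (n + listTime L) β x y (listVal L) =
      stepMass β ^ (n + listTime L + 1) *
        transfer (fun d => rotAvg (convPow (stepLaw β) d)) L
          (translate (Circle.exp y) (chainKernel β (n + 1))) (Circle.exp x) := by
  induction L generalizing x with
  | nil => exact chainInt_one n β x y
  | cons p L ih =>
    obtain ⟨d, H⟩ := p
    have e : listTime ((d, H) :: L) = listTime L + d := by simp [listTime, add_comm]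
    have hG : Continuous fun s : ℕ → Circle => H (s 0) * listVal L s :=
      (H.continuous.comp (continuous_apply 0)).mul (continuous_listVal L)
    rw [e, ← add_assoc]
    refine chainInt_shift (n + listTime L) β y hG
      (f := H * transfer (fun d => rotAvg (convPow (stepLaw β) d)) L
          (translate (Circle.exp y) (chainKernel β (n + 1)))) (fun u => ?_) d x
    rw [chainInt_congr _ _ _ _ (G' := fun s => H (Circle.exp u) * listVal L s)
      (fun s hs => by rw [hs]), chainInt_const_mul, ih, ContinuousMap.mul_apply]
    ring

lemma ofReal_partitionFunction (n : ℕ) (β x y : ℝ) :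
    (partitionFunction (n + 1) β x y : ℂ) =
      stepMass β ^ (n + 1) * translate (Circle.exp y) (chainKernel β (n + 1)) (Circle.exp x) := by
  rw [← chainInt_one, partitionFunction, chainInt]
  simp only [mul_one]
  exact integral_ofReal.symm

lemma integral_gibbsMeasure {E : Type*} [NormedAddCommGroup E] [NormedSpace ℝ E] (n : ℕ)
    (β x y : ℝ) (F : (Fin (n + 1) → ℝ) → E) :
    ∫ θ, F θ ∂gibbsMeasure n β x y = ∫ θ,
      (Real.exp (-β * hamiltonian n θ) / partitionFunction n β x y) • F θ
        ∂referenceMeasure n x y :=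
  integral_tilted (μ := referenceMeasure n x y) (fun θ => -β * hamiltonian n θ) F

lemma integral_gibbsMeasure_spins (n : ℕ) (β x y : ℝ) (G : (ℕ → Circle) → ℂ) :
    ∫ θ, G (spins (n + 1) θ) ∂gibbsMeasure (n + 1) β x y =
      chainInt n β x y G / partitionFunction (n + 1) β x y := by
  rw [integral_gibbsMeasure, chainInt, ← integral_div]
  congr with θ
  rw [Complex.real_smul]
  push_cast
  ring

/-- Finite-dimensional distributions of the Gibbs measure. -/
theorem integral_listVal_gibbsMeasure {N : ℕ} (β x y : ℝ) (L : List (ℕ × C(Circle, ℂ)))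
    (hN : listTime L < N) :
    ∫ θ, listVal L (spins N θ) ∂gibbsMeasure N β x y =
      transfer (fun d => rotAvg (convPow (stepLaw β) d)) L
          (translate (Circle.exp y) (chainKernel β (N - listTime L))) (Circle.exp x) /
        translate (Circle.exp y) (chainKernel β N) (Circle.exp x) := by
  obtain ⟨n, rfl⟩ := Nat.exists_eq_add_of_lt hN
  have e1 : listTime L + n + 1 - listTime L = n + 1 := by omega
  have hm : (stepMass β : ℂ) ≠ 0 := by exact_mod_cast (stepMass_pos β).ne'
  rw [integral_gibbsMeasure_spins, ofReal_partitionFunction, e1, add_comm (listTime L) n,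
    chainInt_listVal, mul_div_mul_left _ _ (pow_ne_zero _ hm)]

/-! ### Comparison of the conditioned increments with those of the free walk -/

lemma integrable_mul_circle (ψ f : C(Circle, ℂ)) (μ : Measure ℝ) [IsFiniteMeasure μ]
    (z : Circle) : Integrable (fun v => ψ (Circle.exp v) * f (z * Circle.exp v)) μ := by
  refine Integrable.of_bound (C := ‖ψ‖ * ‖f‖) ?_ (ae_of_all _ fun u => ?_)
  · exact Continuous.aestronglyMeasurable (by fun_prop)
  · rw [norm_mul]
    exact mul_le_mul (ψ.norm_coe_le_norm _) (f.norm_coe_le_norm _) (norm_nonneg _) (norm_nonneg _)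

/-- Averaging over random rotations weighted by a function of the rotation. -/
def weightedAvg (μ : Measure ℝ) [IsProbabilityMeasure μ] (ψ f : C(Circle, ℂ)) : C(Circle, ℂ) where
  toFun z := ∫ v, ψ (Circle.exp v) * f (z * Circle.exp v) ∂μ
  continuous_toFun := by
    refine continuous_of_dominated (bound := fun _ => ‖ψ‖ * ‖f‖) ?_ ?_ (integrable_const _) ?_
    · exact fun z => (integrable_mul_circle ψ f μ z).1
    · refine fun z => ae_of_all _ fun u => ?_
      rw [norm_mul]
      exact mul_le_mul (ψ.norm_coe_le_norm _) (f.norm_coe_le_norm _) (norm_nonneg _)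
        (norm_nonneg _)
    · exact ae_of_all _ fun u => by fun_prop

/-- Rotations of the circle commute. This moves the steps before an increment to the far side of it.
-/
lemma rotAvg_weightedAvg (μ ν : Measure ℝ) [IsProbabilityMeasure μ] [IsProbabilityMeasure ν]
    (ψ f : C(Circle, ℂ)) :
    rotAvg μ (weightedAvg ν ψ f) = weightedAvg ν ψ (rotAvg μ f) := by
  ext z
  simp only [rotAvg_apply, weightedAvg, ContinuousMap.coe_mk]
  rw [integral_integral_swap]
  · congr with v
    rw [integral_const_mul]
    congr 2 with u
    rw [mul_right_comm]
  · refine Integrable.of_bound (C := ‖ψ‖ * ‖f‖) ?_ (ae_of_all _ fun p => ?_)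
    · exact Continuous.aestronglyMeasurable (by fun_prop)
    · rw [Function.uncurry, norm_mul]
      exact mul_le_mul (ψ.norm_coe_le_norm _) (f.norm_coe_le_norm _) (norm_nonneg _)
        (norm_nonneg _)

lemma norm_weightedAvg_le (μ : Measure ℝ) [IsProbabilityMeasure μ] (ψ f : C(Circle, ℂ)) :
    ‖weightedAvg μ ψ f‖ ≤ (∫ v, ‖ψ (Circle.exp v)‖ ∂μ) * ‖f‖ := by
  refine (ContinuousMap.norm_le _ (mul_nonneg (integral_nonneg fun _ => norm_nonneg _)
    (norm_nonneg _))).2 fun z => ?_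
  rw [← integral_mul_const]
  refine norm_integral_le_of_norm_le ?_ (ae_of_all _ fun v => ?_)
  · refine Integrable.of_bound (C := ‖ψ‖ * ‖f‖) (Continuous.aestronglyMeasurable (by fun_prop))
      (ae_of_all _ fun v => ?_)
    rw [norm_mul, norm_norm, norm_norm]
    gcongr
    exact ψ.norm_coe_le_norm _
  · rw [norm_mul]
    gcongr
    exact f.norm_coe_le_norm _

/-- The law of an increment of the Gibbs measure is dominated by that of the walk. -/
theorem norm_integral_increment_gibbsMeasure_le {N : ℕ} (β x y : ℝ) (ψ : C(Circle, ℂ)) (d e : ℕ)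
    (hN : d + e < N) :
    ‖∫ θ, ψ (spins N θ (d + e) * (spins N θ d)⁻¹) ∂gibbsMeasure N β x y‖ ≤
      (∫ v, ‖ψ (Circle.exp v)‖ ∂convPow (stepLaw β) e) * ‖chainKernel β (N - e)‖ /
        ‖translate (Circle.exp y) (chainKernel β N) (Circle.exp x)‖ := by
  obtain ⟨n, rfl⟩ : ∃ n, N = n + e + d + 1 := ⟨N - (d + e) - 1, by omega⟩
  have hm : (stepMass β : ℂ) ≠ 0 := by exact_mod_cast (stepMass_pos β).ne'
  have h1 : ∀ u, chainInt (n + e) β u y (fun s => ψ (s e * (s 0)⁻¹)) =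
      stepMass β ^ (n + e + 1) * weightedAvg (convPow (stepLaw β) e) ψ
        (translate (Circle.exp y) (chainKernel β (n + 1))) (Circle.exp u) := by
    intro u
    rw [chainInt_congr _ _ _ _ (G' := fun s => ψ (s e * (Circle.exp u)⁻¹))
      (fun s hs => by rw [hs])]
    refine (chainInt_shift n β y (G := fun s => ψ (s 0 * (Circle.exp u)⁻¹)) (by fun_prop)
      (f := translate (Circle.exp u) ψ * translate (Circle.exp y) (chainKernel β (n + 1)))
      (fun w => ?_) e u).trans ?_
    rotate_left
    · congr 1
      rw [rotAvg_apply]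
      simp only [weightedAvg, ContinuousMap.coe_mk, ContinuousMap.mul_apply, translate_apply]
      congr with v
      rw [mul_comm (Circle.exp u) (Circle.exp v), mul_inv_cancel_right]
    · rw [chainInt_congr _ _ _ _ (G' := fun s => ψ (Circle.exp w * (Circle.exp u)⁻¹) * 1)
        (fun s hs => by rw [hs, mul_one]), chainInt_const_mul, chainInt_one,
        ContinuousMap.mul_apply]
      simp only [translate_apply]
      ring
  have h2 := chainInt_shift (n + e) β y (G := fun s => ψ (s e * (s 0)⁻¹)) (by fun_prop) h1 d x
  have h3 := integral_gibbsMeasure_spins (n + e + d) β x y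
    (fun s => ψ (s (d + e) * (s d)⁻¹))
  rw [h3]
  change ‖chainInt (n + e + d) β x y (fun s => ψ (s (d + e) * (s (d + 0))⁻¹)) / _‖ ≤ _
  -- The `d` steps before the increment and the `n + 1` steps after it merge into one kernel of
  -- length `N - e`. The bound therefore does not deteriorate when the increment lies close to the
  -- right end.
  rw [h2, ofReal_partitionFunction, mul_div_mul_left _ _ (pow_ne_zero _ hm), norm_div,
    rotAvg_weightedAvg, rotAvg_translate, rotAvg_chainKernel β d (by omega)]
  have e1 : n + e + d + 1 - e = d + (n + 1) := by omega
  rw [e1]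
  gcongr
  refine (ContinuousMap.norm_coe_le_norm _ _).trans ((norm_weightedAvg_le _ _ _).trans ?_)
  exact mul_le_mul_of_nonneg_left (norm_translate _ _) (integral_nonneg fun _ => norm_nonneg _)

/-! ### The fourth moment of an increment -/

/-- The function `z ↦ |z - 1| ^ 4` on the circle. -/
def chordPow : C(Circle, ℂ) where
  toFun z := ((‖(z : ℂ) - 1‖ ^ 4 : ℝ) : ℂ)
  continuous_toFun := by fun_prop

/-- The fourth power of the chord is `(2 - 2 cos v)²`, a trigonometric polynomial of degree two, so
its mean under the walk involves only `c_1` and `c_2`. -/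
lemma norm_chordPow_exp (v : ℝ) :
    ‖chordPow (Circle.exp v)‖ = 6 - 8 * Real.cos v + 2 * Real.cos (2 * v) := by
  have h1 : ‖(Circle.exp v : ℂ) - 1‖ ^ 2 = 2 - 2 * Real.cos v := by
    rw [← Complex.normSq_eq_norm_sq, Complex.normSq_apply, Circle.coe_exp]
    simp only [Complex.sub_re, Complex.sub_im, Complex.exp_ofReal_mul_I_re,
      Complex.exp_ofReal_mul_I_im, Complex.one_re, Complex.one_im]
    nlinarith [Real.sin_sq_add_cos_sq v]
  change ‖((‖(Circle.exp v : ℂ) - 1‖ ^ 4 : ℝ) : ℂ)‖ = _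
  rw [Complex.norm_real, Real.norm_of_nonneg (by positivity),
    show ‖(Circle.exp v : ℂ) - 1‖ ^ 4 = (‖(Circle.exp v : ℂ) - 1‖ ^ 2) ^ 2 by ring, h1,
    Real.cos_two_mul]
  ring

lemma integral_cos_convPow (β : ℝ) (k : ℤ) (e : ℕ) :
    ∫ v, Real.cos (k * v) ∂convPow (stepLaw β) e = stepCoeff β k ^ e := by
  have h := charFun_convPow (stepLaw β) e k
  rw [charFun_stepLaw, charFun_apply_real] at h
  have h2 := congrArg Complex.re h
  have hi : Integrable (fun v : ℝ => Complex.exp ((k : ℝ) * v * Complex.I)) (convPow (stepLaw β) e) := by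
    refine Integrable.of_bound (C := 1) (Continuous.aestronglyMeasurable (by fun_prop))
      (ae_of_all _ fun v => ?_)
    rw [← Complex.ofReal_mul, Complex.norm_exp_ofReal_mul_I]
  rw [← Complex.ofReal_pow, Complex.ofReal_re] at h2
  rw [← h2]
  have h3 := integral_re hi
  simp only [RCLike.re_eq_complex_re] at h3
  rw [← h3]
  congr with v
  rw [← Complex.ofReal_mul, Complex.exp_ofReal_mul_I_re]

lemma integral_chordPow_convPow (β : ℝ) (e : ℕ) :
    ∫ v, ‖chordPow (Circle.exp v)‖ ∂convPow (stepLaw β) e =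
      6 - 8 * stepCoeff β 1 ^ e + 2 * stepCoeff β 2 ^ e := by
  have hi : ∀ c : ℝ, Integrable (fun v : ℝ => Real.cos (c * v)) (convPow (stepLaw β) e) := by
    intro c
    exact Integrable.of_bound (C := 1) (Continuous.aestronglyMeasurable (by fun_prop))
      (ae_of_all _ fun v => Real.abs_cos_le_one _)
  have h1 := integral_cos_convPow β 1 e
  have h2 := integral_cos_convPow β 2 e
  simp only [norm_chordPow_exp]
  rw [← h1, ← h2]
  simp only [Int.cast_one, one_mul, Int.cast_ofNat]
  have h3 := hi 1
  simp only [one_mul] at h3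
  have h5 : Integrable (fun v : ℝ => 6 - 8 * Real.cos v) (convPow (stepLaw β) e) :=
    (integrable_const _).sub (h3.const_mul _)
  rw [integral_add h5 ((hi 2).const_mul _), integral_sub (integrable_const _) (h3.const_mul _), integral_const_mul, integral_const_mul]
  simp

/-- For `x ≤ 1` this is the second-order Bernoulli inequality. For `x > 1` and `l ≥ 2` the left side
is at most `1`, and the right side is at least `1` because `l x ≥ 2`. -/
lemma one_sub_pow_le {x : ℝ} (h0 : 0 ≤ x) (h2 : x ≤ 2) (l : ℕ) :
    (1 - x) ^ l ≤ 1 - l * x + l ^ 2 * x ^ 2 / 2 := by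
  rcases le_or_gt x 1 with h1 | h1
  · have : ∀ l : ℕ, (1 - x) ^ l ≤ 1 - l * x + l * (l - 1) / 2 * x ^ 2 := by
      intro l
      induction l with
      | zero => simp
      | succ l ih =>
        have hl : (0 : ℝ) ≤ l * (l - 1) := by
          rcases Nat.eq_zero_or_pos l with rfl | hl
          · simp
          · have : (1 : ℝ) ≤ l := by exact_mod_cast hl
            nlinarith
        have := mul_le_mul_of_nonneg_right ih (show 0 ≤ 1 - x by linarith)
        rw [pow_succ]
        refine this.trans ?_
        push_cast
        nlinarith [mul_nonneg hl (show 0 ≤ x ^ 3 by positivity)]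
    refine (this l).trans ?_
    have : 0 ≤ (l : ℝ) * x ^ 2 := by positivity
    nlinarith
  · rcases l with _ | _ | l
    · simp
    · simp only [zero_add, pow_one, Nat.cast_one]; nlinarith
    · have h3 : (1 - x) ^ (l + 1 + 1) ≤ 1 := by
        refine (le_abs_self _).trans ?_
        rw [abs_pow]
        exact pow_le_one₀ (abs_nonneg _) (abs_le.2 ⟨by linarith, by linarith⟩)
      have h4 : (0 : ℝ) ≤ l := Nat.cast_nonneg l
      push_cast
      have h5 : 2 ≤ ((l : ℝ) + 1 + 1) * x := by nlinarith
      nlinarith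

/-- In `6 - 8 c_1^e + 2 c_2^e` the constants cancel. The first-order part is `e` times the one-step
value `8δ - 2x`, which is `O(β⁻²)`; the second-order part is `e² x²` with `x ≤ 4δ` and `δ² =
O(β⁻²)`. The two contribute `1` and `4` to the factor `5`. -/
lemma integral_chordPow_convPow_le {β : ℝ} (hβ : 1 ≤ β) (e : ℕ) :
    ∫ v, ‖chordPow (Circle.exp v)‖ ∂convPow (stepLaw β) e ≤
      5 * fourthMomentConst * (e / β) ^ 2 := by
  have hβ0 : 0 < β := by linarith
  have hC : 0 ≤ fourthMomentConst := by rw [fourthMomentConst]; positivity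
  have h4 := integral_pow_four_stepLaw_le hβ
  set δ := 1 - stepCoeff β 1 with hδ
  set x := 1 - stepCoeff β 2 with hx
  have hδ0 : 0 ≤ δ := by linarith [(abs_le.1 (abs_stepCoeff_le_one β 1)).2]
  have hδ2 : δ ≤ 2 := by linarith [(abs_le.1 (abs_stepCoeff_le_one β 1)).1]
  have hx0 : 0 ≤ x := by linarith [(abs_le.1 (abs_stepCoeff_le_one β 2)).2]
  have hx2 : x ≤ 2 := by linarith [(abs_le.1 (abs_stepCoeff_le_one β 2)).1]
  have hM : 8 * δ - 2 * x = ∫ v, ‖chordPow (Circle.exp v)‖ ∂stepLaw β := by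
    have h1 := integral_chordPow_convPow β 1
    have h2 : convPow (stepLaw β) 1 = stepLaw β := by
      rw [convPow, convPow, Measure.conv_dirac_zero]
    rw [h2] at h1
    rw [h1]
    ring
  have hM0 : 0 ≤ 8 * δ - 2 * x := by rw [hM]; exact integral_nonneg fun _ => norm_nonneg _
  have hs : ∀ v : ℝ, 1 - Real.cos v ≤ v ^ 2 / 2 := fun v => by
    linarith [Real.one_sub_sq_div_two_le_cos (x := v)]
  have hs0 : ∀ v : ℝ, 0 ≤ 1 - Real.cos v := fun v => by linarith [Real.cos_le_one v]
  have hM4 : 8 * δ - 2 * x ≤ fourthMomentConst / β ^ 2 := by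
    rw [hM]
    refine le_trans (integral_mono ?_ (integrable_stepLaw β (by fun_prop)) fun v => ?_) h4
    · exact integrable_stepLaw β (by fun_prop)
    · change ‖chordPow (Circle.exp v)‖ ≤ v ^ 4
      rw [norm_chordPow_exp, Real.cos_two_mul]
      have := mul_le_mul (hs v) (hs v) (hs0 v) (by positivity)
      nlinarith
  have hδ4 : δ ^ 2 ≤ fourthMomentConst / β ^ 2 / 4 := by
    rw [hδ, one_sub_stepCoeff]
    simp only [Int.cast_one, one_mul]
    refine (sq_integral_le (integrable_stepLaw β (by fun_prop))
      (integrable_stepLaw β (by fun_prop))).trans ?_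
    have : ∫ v, (1 - Real.cos v) ^ 2 ∂stepLaw β ≤ ∫ v, v ^ 4 / 4 ∂stepLaw β := by
      refine integral_mono (integrable_stepLaw β (by fun_prop))
        (integrable_stepLaw β (by fun_prop)) fun v => ?_
      have := mul_le_mul (hs v) (hs v) (hs0 v) (by positivity)
      change (1 - Real.cos v) ^ 2 ≤ v ^ 4 / 4
      nlinarith
    rw [integral_div] at this
    linarith
  rw [integral_chordPow_convPow]
  have ha : 1 - e * δ ≤ stepCoeff β 1 ^ e := by
    have := one_add_mul_le_pow (show -2 ≤ -δ by linarith) e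
    rw [show 1 + -δ = stepCoeff β 1 by rw [hδ]; ring] at this
    linarith
  have hb : stepCoeff β 2 ^ e ≤ 1 - e * x + e ^ 2 * x ^ 2 / 2 := by
    have := one_sub_pow_le hx0 hx2 e
    rwa [show 1 - x = stepCoeff β 2 by rw [hx]; ring] at this
  have hxx : x ^ 2 ≤ 16 * δ ^ 2 := by nlinarith
  have he2 : (e : ℝ) ≤ (e : ℝ) ^ 2 := by exact_mod_cast Nat.le_self_pow two_ne_zero e
  calc 6 - 8 * stepCoeff β 1 ^ e + 2 * stepCoeff β 2 ^ e
      ≤ e * (8 * δ - 2 * x) + e ^ 2 * x ^ 2 := by linarith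
    _ ≤ e ^ 2 * (fourthMomentConst / β ^ 2) + e ^ 2 * (16 * (fourthMomentConst / β ^ 2 / 4)) := by
        gcongr
        linarith
    _ = 5 * fourthMomentConst * (e / β) ^ 2 := by
        field_simp
        ring

/-! ### Gaussian densities modulo `2π` -/

/-- The periodisation of the product of a Gaussian density and a function. -/
def wrap (v : NNReal) (G : ℝ → ℂ) (u : ℝ) : ℂ :=
  ∑' m : ℤ, (gaussianPDFReal 0 v (u + 2 * Real.pi * m) : ℂ) * G (u + 2 * Real.pi * m)

lemma gaussianPDFReal_add_le {v : NNReal} (hv : v ≠ 0) {R u : ℝ} (hu : |u| ≤ R) (m : ℤ) :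
    gaussianPDFReal 0 v (u + 2 * Real.pi * m) ≤
      (√(2 * Real.pi * v))⁻¹ * Real.exp (R ^ 2 / (2 * v)) *
        (1 + Real.pi ^ 2 / v * (m : ℝ) ^ 2)⁻¹ := by
  have hv0 : (0 : ℝ) < v := NNReal.coe_pos.2 (bot_lt_iff_ne_bot.2 hv)
  rw [gaussianPDFReal, mul_assoc (√(2 * Real.pi * v))⁻¹]
  refine mul_le_mul_of_nonneg_left ?_ (by positivity)
  have h1 : u ^ 2 ≤ R ^ 2 := sq_le_sq' (abs_le.1 hu).1 (abs_le.1 hu).2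
  have h2 : -(u + 2 * Real.pi * m - 0) ^ 2 / (2 * v) ≤
      R ^ 2 / (2 * v) + -(Real.pi ^ 2 / v * (m : ℝ) ^ 2) := by
    have h3 : R ^ 2 / (2 * v) + -(Real.pi ^ 2 / v * (m : ℝ) ^ 2) =
        (R ^ 2 - 2 * Real.pi ^ 2 * m ^ 2) / (2 * v) := by field_simp; ring
    rw [h3]
    refine div_le_div_of_nonneg_right ?_ (by positivity)
    nlinarith [sq_nonneg (2 * u + 2 * Real.pi * m)]
  calc Real.exp (-(u + 2 * Real.pi * m - 0) ^ 2 / (2 * v))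
      ≤ Real.exp (R ^ 2 / (2 * v) + -(Real.pi ^ 2 / v * (m : ℝ) ^ 2)) := Real.exp_le_exp.2 h2
    _ = Real.exp (R ^ 2 / (2 * v)) * (Real.exp (Real.pi ^ 2 / v * (m : ℝ) ^ 2))⁻¹ := by
        rw [Real.exp_add, Real.exp_neg]
    _ ≤ _ := by
        refine mul_le_mul_of_nonneg_left (inv_anti₀ (by positivity) ?_) (Real.exp_pos _).le
        linarith [Real.add_one_le_exp (Real.pi ^ 2 / v * (m : ℝ) ^ 2)]

section wrap
variable {v : NNReal} {G : ℝ → ℂ} {C : ℝ}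

lemma norm_wrap_term_le (hv : v ≠ 0) (hC : ∀ y, ‖G y‖ ≤ C) {R u : ℝ} (hu : |u| ≤ R) (m : ℤ) :
    ‖(gaussianPDFReal 0 v (u + 2 * Real.pi * m) : ℂ) * G (u + 2 * Real.pi * m)‖ ≤
      (√(2 * Real.pi * v))⁻¹ * Real.exp (R ^ 2 / (2 * v)) *
        (1 + Real.pi ^ 2 / v * (m : ℝ) ^ 2)⁻¹ * C := by
  have hv0 : (0 : ℝ) < v := NNReal.coe_pos.2 (bot_lt_iff_ne_bot.2 hv)
  rw [norm_mul, Complex.norm_real, Real.norm_of_nonneg (gaussianPDFReal_nonneg _ _ _)]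
  exact mul_le_mul (gaussianPDFReal_add_le hv hu m) (hC _) (norm_nonneg _) (by positivity)

lemma summable_wrap_bound (hv : v ≠ 0) (R C : ℝ) :
    Summable fun m : ℤ => (√(2 * Real.pi * v))⁻¹ * Real.exp (R ^ 2 / (2 * v)) *
        (1 + Real.pi ^ 2 / v * (m : ℝ) ^ 2)⁻¹ * C := by
  have hv0 : (0 : ℝ) < v := NNReal.coe_pos.2 (bot_lt_iff_ne_bot.2 hv)
  exact ((summable_inv_one_add_sq (by positivity)).mul_left _).mul_right _

lemma summable_wrap (hv : v ≠ 0) (hC : ∀ y, ‖G y‖ ≤ C) (u : ℝ) :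
    Summable fun m : ℤ =>
      (gaussianPDFReal 0 v (u + 2 * Real.pi * m) : ℂ) * G (u + 2 * Real.pi * m) :=
  Summable.of_norm_bounded (summable_wrap_bound hv |u| C)
    (fun m => norm_wrap_term_le hv hC le_rfl m)

lemma continuous_gaussianPDFReal (μ : ℝ) (v : NNReal) : Continuous (gaussianPDFReal μ v) := by
  unfold gaussianPDFReal
  fun_prop

lemma continuous_wrap (hv : v ≠ 0) (hG : Continuous G) (hC : ∀ y, ‖G y‖ ≤ C) :
    Continuous (wrap v G) := by
  have hg := continuous_gaussianPDFReal 0 v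
  rw [continuous_iff_continuousAt]
  intro u
  have h : ContinuousOn (wrap v G) (Metric.closedBall 0 (|u| + 1)) := by
    refine continuousOn_tsum (fun m => Continuous.continuousOn (by fun_prop))
      (summable_wrap_bound hv (|u| + 1) C) (fun m x hx => norm_wrap_term_le hv hC ?_ m)
    simpa using hx
  refine h.continuousAt (Filter.mem_of_superset (Metric.ball_mem_nhds u one_pos) fun x hx => ?_)
  rw [Metric.mem_ball, Real.dist_eq] at hx
  rw [mem_closedBall_zero_iff, Real.norm_eq_abs]
  have := abs_sub_abs_le_abs_sub x u
  linarith

lemma periodic_wrap : (wrap v G).Periodic (2 * Real.pi) := by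
  intro u
  rw [wrap, wrap, ← (Equiv.addRight (1 : ℤ)).tsum_eq (fun m : ℤ =>
    (gaussianPDFReal 0 v (u + 2 * Real.pi * m) : ℂ) * G (u + 2 * Real.pi * m))]
  congr with m
  simp only [Equiv.coe_addRight, Int.cast_add, Int.cast_one]
  ring_nf

lemma setIntegral_Ioc_zsmul {E : Type*} [NormedAddCommGroup E] [NormedSpace ℝ E] (g : ℝ → E)
    (m : ℤ) :
    ∫ u in Set.Ioc (-Real.pi + m • (2 * Real.pi)) (-Real.pi + (m + 1) • (2 * Real.pi)), g u =
      ∫ u in Set.Ioc (-Real.pi) Real.pi, g (u + 2 * Real.pi * m) := by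
  have hpi := Real.pi_pos
  have e1 : -Real.pi + m • (2 * Real.pi) = -Real.pi + 2 * Real.pi * m := by
    rw [zsmul_eq_mul]; ring
  have e2 : -Real.pi + (m + 1) • (2 * Real.pi) = Real.pi + 2 * Real.pi * m := by
    rw [zsmul_eq_mul]; push_cast; ring
  rw [e1, e2, ← intervalIntegral.integral_of_le (by linarith),
    ← intervalIntegral.integral_of_le (by linarith), intervalIntegral.integral_comp_add_right]

/-- The line is cut into translates of `(-π, π]`; the periodic factor `h` is the same on each and
leaves the sum. Thus `wrap v G` is the density of the Gaussian modulo `2π`, weighted by `G`. -/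
lemma integral_gaussianReal_eq_wrap (hv : v ≠ 0) (hG : Continuous G) (hC : ∀ y, ‖G y‖ ≤ C)
    {h : ℝ → ℂ} (hm : Measurable h) {C' : ℝ} (hC' : ∀ y, ‖h y‖ ≤ C')
    (hp : h.Periodic (2 * Real.pi)) :
    ∫ y, h y * G y ∂gaussianReal 0 v =
      ∫ u in Set.Ioc (-Real.pi) Real.pi, h u * wrap v G u := by
  set g : ℝ → ℂ := fun y => (gaussianPDFReal 0 v y : ℂ) * (h y * G y) with hg
  have hgi : Integrable g := by
    refine (integrable_gaussianPDFReal 0 v).ofReal.mul_bdd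
      (hm.mul hG.measurable).aestronglyMeasurable (c := C' * C) (ae_of_all _ fun y => ?_)
    rw [norm_mul]
    exact mul_le_mul (hC' y) (hC y) (norm_nonneg _) ((norm_nonneg _).trans (hC' y))
  have hgs : HasSum (fun m : ℤ => ∫ u in Set.Ioc (-Real.pi) Real.pi, g (u + 2 * Real.pi * m))
      (∫ y, g y) := by
    have := hasSum_integral_iUnion (fun m : ℤ => measurableSet_Ioc)
      (Set.pairwise_disjoint_Ioc_add_zsmul (-Real.pi) (2 * Real.pi)) hgi.integrableOn
    rw [iUnion_Ioc_add_zsmul Real.two_pi_pos, setIntegral_univ] at this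
    simpa only [setIntegral_Ioc_zsmul] using this
  have hgn : Summable fun m : ℤ => ∫ u in Set.Ioc (-Real.pi) Real.pi, ‖g (u + 2 * Real.pi * m)‖ := by
    have := hasSum_integral_iUnion (fun m : ℤ => measurableSet_Ioc)
      (Set.pairwise_disjoint_Ioc_add_zsmul (-Real.pi) (2 * Real.pi)) hgi.norm.integrableOn
    simp only [setIntegral_Ioc_zsmul] at this
    exact this.summable
  have hper : ∀ (u : ℝ) (m : ℤ), h (u + 2 * Real.pi * m) = h u := by
    intro u m
    have := hp.int_mul m u
    rwa [mul_comm (m : ℝ)] at this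
  rw [integral_gaussianReal_eq_integral_smul hv]
  have e1 : ∫ y, gaussianPDFReal 0 v y • (h y * G y) = ∫ y, g y := by
    congr with y
  rw [e1, ← hgs.tsum_eq, integral_tsum_of_summable_integral_norm
    (fun m => (hgi.comp_add_right _).integrableOn) hgn]
  congr with u
  rw [wrap, ← tsum_mul_left]
  congr with m
  simp only [hg, hper]
  ring

lemma angleCoeff_wrap (hv : v ≠ 0) (hG : Continuous G) (hC : ∀ y, ‖G y‖ ≤ C) (k : ℤ) :
    angleCoeff (wrap v G) k = ∫ y, circleMonomial (-k) (Circle.exp y) * G y ∂gaussianReal 0 v := by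
  rw [integral_gaussianReal_eq_wrap hv hG hC (h := fun y => circleMonomial (-k) (Circle.exp y))
    (Continuous.measurable (by fun_prop)) (C' := 1) (fun y => (Circle.norm_coe _).le)
    (fun y => by simp only [Circle.periodic_exp y]), angleCoeff]
  congr with u
  rw [circleMonomial_exp]
  push_cast
  ring_nf

lemma charFun_gaussianReal_int (v : NNReal) (k : ℤ) :
    charFun (gaussianReal 0 v) k = (Real.exp (-((k : ℝ) ^ 2 * v / 2)) : ℂ) := by
  rw [charFun_gaussianReal]
  push_cast
  congr 1
  ring

/-- Poisson summation: the wrapped Gaussian is continuous and periodic, and its Fourier coefficients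
are the values of the Gaussian characteristic function at the integers, which define the heat
kernel. -/
lemma heatKernel_exp (hv : v ≠ 0) (u : ℝ) : heatKernel v (Circle.exp u) = wrap v (fun _ => 1) u := by
  have hv0 : (0 : ℝ) < v := NNReal.coe_pos.2 (bot_lt_iff_ne_bot.2 hv)
  have hc : Continuous (wrap v fun _ => 1) :=
    continuous_wrap hv continuous_const (C := 1) (fun _ => by simp)
  have h1 : angleCoeff (wrap v fun _ => 1) =
      fun k : ℤ => (Real.exp (-((k : ℝ) ^ 2 * v / 2)) : ℂ) := by
    funext k
    rw [angleCoeff_wrap hv continuous_const (C := 1) (fun _ => by simp)]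
    have h2 := rotAvg_circleMonomial (gaussianReal 0 v) (-k)
    have h3 := congrArg (fun f : C(Circle, ℂ) => f 1) h2
    simp only [rotAvg_apply, one_mul, ContinuousMap.smul_apply, smul_eq_mul,
      charFun_gaussianReal_int] at h3
    simp only [mul_one]
    rw [h3]
    simp
  rw [heatKernel, ← h1]
  refine (eq_circleSeries hc periodic_wrap ?_ u).symm
  rw [h1]
  exact summable_heat hv0

lemma wrap_one_eq (v : NNReal) (u : ℝ) : wrap v (fun _ => 1) u =
    ((∑' m : ℤ, gaussianPDFReal 0 v (u + 2 * Real.pi * m) : ℝ) : ℂ) := by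
  rw [wrap, Complex.ofReal_tsum]
  simp

lemma summable_gaussianPDFReal_wrap (hv : v ≠ 0) (u : ℝ) :
    Summable fun m : ℤ => gaussianPDFReal 0 v (u + 2 * Real.pi * m) := by
  have := summable_wrap hv (G := fun _ => 1) (C := 1) (fun _ => by simp) u
  simp only [mul_one] at this
  exact Complex.summable_ofReal.1 this

lemma tsum_gaussianPDFReal_wrap_pos (hv : v ≠ 0) (u : ℝ) :
    0 < ∑' m : ℤ, gaussianPDFReal 0 v (u + 2 * Real.pi * m) :=
  (summable_gaussianPDFReal_wrap hv u).tsum_pos (fun _ => gaussianPDFReal_nonneg _ _ _) 0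
    (gaussianPDFReal_pos _ _ _ hv)

/-- Invisible on the Fourier series, but clear for the wrapped sum of positive densities. -/
lemma heatKernel_ne_zero (hv : v ≠ 0) (z : Circle) : heatKernel v z ≠ 0 := by
  obtain ⟨u, rfl⟩ := Circle.exp_surjective z
  rw [heatKernel_exp hv, wrap_one_eq]
  exact_mod_cast (tsum_gaussianPDFReal_wrap_pos hv u).ne'

end wrap

/-! ### Ratios of partition functions -/

section scaling
variable {b : ℝ} {β : ℕ → ℝ}

lemma tendsto_atTop_of_ratio (hb : 0 < b) (hβ : Tendsto (fun n : ℕ => β n / n) atTop (𝓝 b)) :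
    Tendsto β atTop atTop := by
  refine (hβ.pos_mul_atTop hb tendsto_natCast_atTop_atTop).congr' ?_
  filter_upwards [eventually_gt_atTop 0] with n hn
  field_simp

lemma tendsto_ratio (hb : 0 < b) (hβ : Tendsto (fun n : ℕ => β n / n) atTop (𝓝 b)) {l : ℕ → ℕ}
    {t : ℝ} (hl : Tendsto (fun n : ℕ => (l n : ℝ) / n) atTop (𝓝 t)) :
    Tendsto (fun n => l n / β n) atTop (𝓝 (t / b)) := by
  refine (hl.div hβ hb.ne').congr' ?_
  filter_upwards [eventually_gt_atTop 0] with n hn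
  have : (n : ℝ) ≠ 0 := by exact_mod_cast hn.ne'
  simp only [Pi.div_apply]
  rw [div_div_div_cancel_right₀ this]

lemma tendsto_chainKernel_of_ratio (hb : 0 < b)
    (hβ : Tendsto (fun n : ℕ => β n / n) atTop (𝓝 b)) {l : ℕ → ℕ} {t : ℝ} (ht : 0 < t)
    (hl : Tendsto (fun n : ℕ => (l n : ℝ) / n) atTop (𝓝 t)) :
    Tendsto (fun n => chainKernel (β n) (l n)) atTop (𝓝 (heatKernel (t / b))) :=
  tendsto_chainKernel (tendsto_atTop_of_ratio hb hβ) (div_pos ht hb) (tendsto_ratio hb hβ hl)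

lemma tendsto_chainKernel_self (hb : 0 < b)
    (hβ : Tendsto (fun n : ℕ => β n / n) atTop (𝓝 b)) :
    Tendsto (fun n => chainKernel (β n) n) atTop (𝓝 (heatKernel (1 / b))) := by
  refine tendsto_chainKernel_of_ratio hb hβ one_pos ?_
  refine tendsto_const_nhds.congr' ?_
  filter_upwards [eventually_gt_atTop 0] with n hn
  have : (n : ℝ) ≠ 0 := by exact_mod_cast hn.ne'
  rw [div_self this]

/-- The limit of the ratios of partition functions. -/
theorem tendsto_partitionFunction_ratio (hb : 0 < b)
    (hβ : Tendsto (fun n : ℕ => β n / n) atTop (𝓝 b)) (θ₀ θ₁ θ₀' θ₁' : ℝ) :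
    Tendsto (fun n : ℕ => partitionFunction n (β n) θ₀ θ₁ / partitionFunction n (β n) θ₀' θ₁')
      atTop (𝓝 ((∑' m : ℤ, Real.exp (-(b / 2) * (θ₁ - θ₀ + 2 * Real.pi * m) ^ 2)) /
        ∑' m : ℤ, Real.exp (-(b / 2) * (θ₁' - θ₀' + 2 * Real.pi * m) ^ 2))) := by
  set v : NNReal := ⟨1 / b, by positivity⟩ with hv_def
  have hvb : (v : ℝ) = 1 / b := rfl
  have hv : v ≠ 0 := by
    rw [← NNReal.coe_ne_zero, hvb]
    positivity
  -- The Gaussian normalisation does not depend on the endpoints and will cancel in the ratio;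
  -- replacing `m` by `-m` exchanges `x - y` and `y - x`.
  have hval : ∀ x y : ℝ, heatKernel (1 / b) (Circle.exp x * (Circle.exp y)⁻¹) =
      (((√(2 * Real.pi * v))⁻¹ *
        ∑' m : ℤ, Real.exp (-(b / 2) * (y - x + 2 * Real.pi * m) ^ 2) : ℝ) : ℂ) := by
    intro x y
    rw [← Circle.exp_neg, ← Circle.exp_add, ← sub_eq_add_neg, ← hvb, heatKernel_exp hv, wrap_one_eq,
      ← tsum_mul_left, ← (Equiv.neg ℤ).tsum_eq]
    congr 2 with m
    rw [gaussianPDFReal, hvb]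
    simp only [Equiv.neg_apply, Int.cast_neg]
    congr 2
    field_simp
    ring
  have hpos : ∀ x y : ℝ, ∑' m : ℤ, Real.exp (-(b / 2) * (y - x + 2 * Real.pi * m) ^ 2) ≠ 0 := by
    intro x y h0
    have := hval x y
    rw [h0, mul_zero, Complex.ofReal_zero] at this
    exact heatKernel_ne_zero hv _ this
  have hlim : ∀ x y : ℝ, Tendsto (fun n => chainKernel (β n) n (Circle.exp x * (Circle.exp y)⁻¹))
      atTop (𝓝 (heatKernel (1 / b) (Circle.exp x * (Circle.exp y)⁻¹))) := fun x y =>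
    ((continuous_eval_const (F := C(Circle, ℂ)) _).tendsto _).comp (tendsto_chainKernel_self hb hβ)
  have h := (hlim θ₀ θ₁).div (hlim θ₀' θ₁') (heatKernel_ne_zero hv _)
  rw [hval, hval, ← Complex.ofReal_div, mul_div_mul_left _ _ (by rw [hvb]; positivity)] at h
  have h2 := (Complex.continuous_re.tendsto _).comp h
  rw [Complex.ofReal_re] at h2
  refine h2.congr' ?_
  filter_upwards [eventually_gt_atTop 0] with n hn
  obtain ⟨n, rfl⟩ := Nat.exists_eq_succ_of_ne_zero hn.ne'
  have hm : (stepMass (β (n + 1)) : ℂ) ≠ 0 := by exact_mod_cast (stepMass_pos _).ne'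
  have e : ((partitionFunction (n + 1) (β (n + 1)) θ₀ θ₁ /
      partitionFunction (n + 1) (β (n + 1)) θ₀' θ₁' : ℝ) : ℂ) =
      chainKernel (β (n + 1)) (n + 1) (Circle.exp θ₀ * (Circle.exp θ₁)⁻¹) /
      chainKernel (β (n + 1)) (n + 1) (Circle.exp θ₀' * (Circle.exp θ₁')⁻¹) := by
    rw [Complex.ofReal_div, ofReal_partitionFunction, ofReal_partitionFunction,
      mul_div_mul_left _ _ (pow_ne_zero _ hm)]
    rfl
  change (chainKernel (β (n + 1)) (n + 1) (Circle.exp θ₀ * (Circle.exp θ₁)⁻¹) /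
      chainKernel (β (n + 1)) (n + 1) (Circle.exp θ₀' * (Circle.exp θ₁')⁻¹)).re = _
  rw [← e, Complex.ofReal_re]

end scaling

/-! ### A maximal inequality -/

/-- If `y ≥ 10x` then `x + y ≤ 1.1 y` and `1.1⁴ < 3 / 2`; otherwise `x + y ≤ 11x`. The factor `3 /
2` on `y⁴`, being below `2`, is what lets the halving recursion close. -/
lemma two_mul_add_pow_four_le (x y : ENNReal) :
    2 * (x + y) ^ 4 ≤ 2 * 11 ^ 4 * x ^ 4 + 3 * y ^ 4 := by
  rcases le_total y (10 * x) with h | h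
  · calc 2 * (x + y) ^ 4 ≤ 2 * (x + 10 * x) ^ 4 := by gcongr
      _ = 2 * 11 ^ 4 * x ^ 4 := by ring
      _ ≤ _ := le_self_add
  · have h2 : 10 * (x + y) ≤ 11 * y := by
      calc 10 * (x + y) = 10 * x + 10 * y := by ring
        _ ≤ y + 10 * y := by gcongr
        _ = 11 * y := by ring
    have h3 : 10 ^ 4 * (2 * (x + y) ^ 4) ≤ 10 ^ 4 * (3 * y ^ 4) := by
      calc 10 ^ 4 * (2 * (x + y) ^ 4) = 2 * (10 * (x + y)) ^ 4 := by ring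
        _ ≤ 2 * (11 * y) ^ 4 := by gcongr
        _ = (2 * 11 ^ 4) * y ^ 4 := by ring
        _ ≤ (10 ^ 4 * 3) * y ^ 4 := by gcongr ?_ * _; norm_num
        _ = _ := by ring
    rw [ENNReal.mul_le_mul_iff_right (by positivity) (by finiteness)] at h3
    exact h3.trans le_add_self

section maximal
variable {Ω E : Type*} [MeasurableSpace Ω] [PseudoEMetricSpace E] {μ : Measure Ω}

/-- The largest fourth power of an increment of a sequence between `a` and `a + L`. -/
def maxIncrement (Y : ℕ → E) (a L : ℕ) : ENNReal :=
  (Finset.range (L + 1)).sup fun k => edist (Y a) (Y (a + k)) ^ 4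

lemma le_maxIncrement (Y : ℕ → E) (a : ℕ) {k L : ℕ} (h : k ≤ L) :
    edist (Y a) (Y (a + k)) ^ 4 ≤ maxIncrement Y a L :=
  Finset.le_sup (f := fun k => edist (Y a) (Y (a + k)) ^ 4)
    (Finset.mem_range.2 (Nat.lt_succ_of_le h))

/-- The maximum is attained either before `a + h`, or after it, in which case the triangle
inequality passes through `a + h`. -/
lemma maxIncrement_add_le (Y : ℕ → E) (a h k : ℕ) :
    2 * maxIncrement Y a (h + k) ≤ 2 * maxIncrement Y a h +
      (2 * 11 ^ 4 * edist (Y a) (Y (a + h)) ^ 4 + 3 * maxIncrement Y (a + h) k) := by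
  have key : ∀ i ≤ h + k, 2 * edist (Y a) (Y (a + i)) ^ 4 ≤ 2 * maxIncrement Y a h +
      (2 * 11 ^ 4 * edist (Y a) (Y (a + h)) ^ 4 + 3 * maxIncrement Y (a + h) k) := by
    intro i hi
    rcases le_total i h with hih | hih
    · exact (mul_le_mul_right (le_maxIncrement Y a hih) 2).trans le_self_add
    · obtain ⟨j, rfl⟩ := Nat.exists_eq_add_of_le hih
      refine le_trans ?_ le_add_self
      calc 2 * edist (Y a) (Y (a + (h + j))) ^ 4
          ≤ 2 * (edist (Y a) (Y (a + h)) + edist (Y (a + h)) (Y (a + h + j))) ^ 4 := by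
            rw [add_assoc]
            gcongr
            exact edist_triangle _ _ _
        _ ≤ _ := two_mul_add_pow_four_le _ _
        _ ≤ _ := by
            gcongr
            exact le_maxIncrement Y (a + h) (by omega)
  obtain ⟨i, hi, h1⟩ := Finset.exists_mem_eq_sup (Finset.range (h + k + 1))
    ⟨0, by simp⟩ fun k => edist (Y a) (Y (a + k)) ^ 4
  rw [maxIncrement, h1]
  exact key i (Nat.lt_succ_iff.1 (Finset.mem_range.1 hi))

lemma measurable_maxIncrement {Y : Ω → ℕ → E}
    (hY : ∀ i j, Measurable fun ω => edist (Y ω i) (Y ω j)) (a L : ℕ) :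
    Measurable fun ω => maxIncrement (Y ω) a L := by
  unfold maxIncrement
  simp only [← Finset.sup'_eq_sup Finset.nonempty_range_add_one]
  exact Finset.measurable_range_sup'' fun k _ => (hY a (a + k)).pow_const 4

/-- A moment bound of order `e²`, superlinear in the length, survives taking the maximum. Under
splitting into halves, the maximum over the first half, the increment to the midpoint and the
maximum over the second half add up to `11⁴ A (4h² + 3k²)` for twice the mean, and the constant
reproduces itself. -/
theorem lintegral_maxIncrement_le {Y : Ω → ℕ → E}
    (hY : ∀ i j, Measurable fun ω => edist (Y ω i) (Y ω j)) {A : ENNReal}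
    (hA : ∀ a e : ℕ, ∫⁻ ω, edist (Y ω a) (Y ω (a + e)) ^ 4 ∂μ ≤ A * e ^ 2) (L a : ℕ) :
    ∫⁻ ω, maxIncrement (Y ω) a L ∂μ ≤ 11 ^ 4 * A * L ^ 2 := by
  induction L using Nat.strong_induction_on generalizing a with
  | _ L ih =>
  rcases Nat.lt_or_ge L 2 with hL | hL
  · have h1 : ∀ ω, maxIncrement (Y ω) a L ≤ edist (Y ω a) (Y ω (a + L)) ^ 4 := by
      intro ω
      refine Finset.sup_le fun k hk => ?_
      rw [Finset.mem_range] at hk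
      rcases Nat.eq_zero_or_pos k with rfl | hk0
      · simp
      · rw [show k = L by omega]
    refine (lintegral_mono h1).trans ((hA a L).trans ?_)
    gcongr
    exact le_mul_of_one_le_left' (by norm_num)
  -- The balanced split works: `7r² ≤ 8r²` for `L = 2r`, and for `L = 2r + 1` the inequality needs
  -- only `r ≥ 1`.
  · obtain ⟨h, k, rfl, hh, hk, hhk⟩ : ∃ h k, L = h + k ∧ h < L ∧ k < L ∧
        4 * h ^ 2 + 3 * k ^ 2 ≤ 2 * (h + k) ^ 2 := by
      refine ⟨L / 2, L - L / 2, by omega, by omega, by omega, ?_⟩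
      obtain ⟨r, hr | hr⟩ : ∃ r, L = 2 * r ∨ L = 2 * r + 1 := ⟨L / 2, by omega⟩
      · rw [show L / 2 = r by omega, show L - r = r by omega]
        nlinarith
      · rw [show L / 2 = r by omega, show L - r = r + 1 by omega]
        have : 1 ≤ r := by omega
        nlinarith
    have h1 : 2 * ∫⁻ ω, maxIncrement (Y ω) a (h + k) ∂μ ≤
        2 * (11 ^ 4 * A * h ^ 2) + (2 * 11 ^ 4 * (A * h ^ 2) + 3 * (11 ^ 4 * A * k ^ 2)) := by
      have m1 := measurable_maxIncrement hY
      rw [← lintegral_const_mul _ (m1 _ _)]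
      refine (lintegral_mono fun ω => maxIncrement_add_le (Y ω) a h k).trans ?_
      rw [lintegral_add_left ((m1 _ _).const_mul _),
        lintegral_add_left (((hY _ _).pow_const 4).const_mul _),
        lintegral_const_mul _ (m1 _ _), lintegral_const_mul _ (m1 _ _),
        lintegral_const_mul _ ((hY _ _).pow_const 4)]
      gcongr
      · exact ih h hh a
      · exact hA a h
      · exact ih k hk (a + h)
    have h2 : 2 * (11 ^ 4 * A * h ^ 2) + (2 * 11 ^ 4 * (A * h ^ 2) + 3 * (11 ^ 4 * A * k ^ 2)) ≤
        2 * (11 ^ 4 * A * ((h + k : ℕ) : ENNReal) ^ 2) := by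
      calc 2 * (11 ^ 4 * A * h ^ 2) + (2 * 11 ^ 4 * (A * h ^ 2) + 3 * (11 ^ 4 * A * k ^ 2))
          = 11 ^ 4 * A * ((4 * h ^ 2 + 3 * k ^ 2 : ℕ) : ENNReal) := by push_cast; ring
        _ ≤ 11 ^ 4 * A * ((2 * (h + k) ^ 2 : ℕ) : ENNReal) := by gcongr
        _ = _ := by push_cast; ring
    have h3 := h1.trans h2
    rwa [ENNReal.mul_le_mul_iff_right (by positivity) (by finiteness)] at h3

/-- Either `x ≤ δ` or `1 ≤ (x / δ)³`. It converts fourth moments into a bound on a first moment. -/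
lemma le_add_inv_pow_mul {δ : ENNReal} (h0 : δ ≠ 0) (ht : δ ≠ ⊤) (x : ENNReal) :
    x ≤ δ + δ⁻¹ ^ 3 * x ^ 4 := by
  rcases le_total x δ with h | h
  · exact h.trans le_self_add
  · refine le_trans ?_ le_add_self
    have h1 : 1 ≤ δ⁻¹ * x := by
      rw [← ENNReal.inv_mul_cancel h0 ht]
      gcongr
    calc x = 1 ^ 3 * x := by simp
      _ ≤ (δ⁻¹ * x) ^ 3 * x := by gcongr
      _ = _ := by ring

end maximal

/-! ### Increments of the chain -/

lemma dist_circle (z w : Circle) : dist z w = ‖(z : ℂ) - w‖ := Complex.dist_eq _ _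

lemma edist_pow_four (z w : Circle) :
    edist z w ^ 4 = ENNReal.ofReal ‖chordPow (w * z⁻¹)‖ := by
  have h : ‖((w * z⁻¹ : Circle) : ℂ) - 1‖ = dist z w := by
    have hz := z.coe_ne_zero
    have h1 : ((w * z⁻¹ : Circle) : ℂ) - 1 = (w - z) * (z : ℂ)⁻¹ := by
      rw [Circle.coe_mul, Circle.coe_inv]
      field_simp
    rw [h1, norm_mul, norm_inv, Circle.norm_coe, inv_one, mul_one, dist_comm, dist_circle]
  have h2 : ‖chordPow (w * z⁻¹)‖ = dist z w ^ 4 := by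
    rw [← h]
    simp [chordPow]
  rw [h2, ENNReal.ofReal_pow dist_nonneg, edist_dist]

lemma lintegral_edist_pow_four (N : ℕ) (β x y : ℝ) (i j : ℕ) :
    ∫⁻ θ, edist (spins N θ i) (spins N θ j) ^ 4 ∂gibbsMeasure N β x y = ENNReal.ofReal
      ‖∫ θ, chordPow (spins N θ j * (spins N θ i)⁻¹) ∂gibbsMeasure N β x y‖ := by
  have hc : ∀ k, Continuous fun θ => spins N θ k := fun k =>
    (continuous_apply k).comp (continuous_spins N)
  have h1 : Continuous fun θ => chordPow (spins N θ j * (spins N θ i)⁻¹) :=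
    chordPow.continuous.comp ((hc j).mul (hc i).inv)
  have h2 : ∫ θ, chordPow (spins N θ j * (spins N θ i)⁻¹) ∂gibbsMeasure N β x y =
      ((∫ θ, ‖chordPow (spins N θ j * (spins N θ i)⁻¹)‖ ∂gibbsMeasure N β x y : ℝ) : ℂ) := by
    refine Eq.trans ?_ integral_ofReal
    congr with θ
    simp [chordPow]
  rw [h2, Complex.norm_real, Real.norm_of_nonneg (integral_nonneg fun _ => norm_nonneg _),
    ofReal_integral_eq_lintegral_ofReal _ (ae_of_all _ fun _ => norm_nonneg _)]
  · simp only [edist_pow_four]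
  · refine Integrable.of_bound (C := ‖chordPow‖) h1.norm.aestronglyMeasurable
      (ae_of_all _ fun θ => ?_)
    rw [norm_norm]
    exact chordPow.norm_coe_le_norm _

lemma heatKernel_ne_zero_of_pos {s : ℝ} (hs : 0 < s) (z : Circle) : heatKernel s z ≠ 0 := by
  lift s to NNReal using hs.le
  exact heatKernel_ne_zero (NNReal.coe_pos.1 hs).ne' z

lemma edist_circle_le (z w : Circle) : edist z w ≤ 2 := by
  rw [edist_dist, dist_circle]
  refine ENNReal.ofReal_le_of_le_toReal ?_
  refine (norm_sub_le _ _).trans ?_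
  rw [Circle.norm_coe, Circle.norm_coe]
  norm_num

lemma measurable_edist_spins (n i j : ℕ) :
    Measurable fun θ => edist (spins n θ i) (spins n θ j) :=
  (((continuous_apply i).comp (continuous_spins n)).edist
    ((continuous_apply j).comp (continuous_spins n))).measurable

section scaling
variable {b : ℝ} {β : ℕ → ℝ}

/-- For an increment of at most `n / 2` steps, at least about `n / 2` steps remain, so the numerator
kernel is bounded while the denominator tends to a positive heat kernel value. Longer increments use
the diameter of the circle. Capping indices at `n - 1` leaves a last step, as the comparison with
the free walk requires. -/
theorem exists_lintegral_increment_le (hb : 0 < b)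
    (hβ : Tendsto (fun n : ℕ => β n / n) atTop (𝓝 b)) (x y : ℝ) :
    ∃ C : ENNReal, C ≠ ⊤ ∧ ∀ᶠ n : ℕ in atTop, ∀ a e : ℕ,
      ∫⁻ θ, edist (spins n θ (min a (n - 1))) (spins n θ (min (a + e) (n - 1))) ^ 4
        ∂gibbsMeasure n (β n) x y ≤ C / (n : ENNReal) ^ 2 * e ^ 2 := by
  have hF : 0 ≤ fourthMomentConst := by rw [fourthMomentConst]; positivity
  have hhalf : Tendsto (fun n : ℕ => ((n - n / 2 : ℕ) : ℝ) / n) atTop (𝓝 (1 / 2)) := by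
    have h0 : Tendsto (fun n : ℕ => (1 : ℝ) / n) atTop (𝓝 0) := tendsto_one_div_atTop_nhds_zero_nat
    have h1 : Tendsto (fun n : ℕ => 1 / 2 + (1 : ℝ) / n) atTop (𝓝 (1 / 2)) := by
      have := h0.const_add (1 / 2)
      rwa [add_zero] at this
    refine tendsto_of_tendsto_of_tendsto_of_le_of_le' tendsto_const_nhds h1 ?_ ?_
    · filter_upwards [eventually_gt_atTop 0] with n hn
      have hn' : (0 : ℝ) < n := Nat.cast_pos.2 hn
      rw [div_le_div_iff₀ two_pos hn']
      exact_mod_cast (by omega : 1 * n ≤ (n - n / 2) * 2)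
    · filter_upwards [eventually_gt_atTop 0] with n hn
      have hn' : (0 : ℝ) < n := Nat.cast_pos.2 hn
      have : (((n - n / 2) * 2 : ℕ) : ℝ) ≤ ((n + 2 : ℕ) : ℝ) := Nat.cast_le.2 (by omega)
      push_cast at this
      rw [div_add_div _ _ two_ne_zero hn'.ne', div_le_div_iff₀ hn' (by positivity)]
      nlinarith
  have h1 := (tendsto_chainKernel_of_ratio hb hβ one_half_pos hhalf).norm
  set C₁ := ‖heatKernel (1 / 2 / b)‖ + 1 with hC₁
  have hC₁0 : 0 < C₁ := by positivity
  have h2 : Tendsto (fun n => ‖translate (Circle.exp y) (chainKernel (β n) n) (Circle.exp x)‖)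
      atTop (𝓝 ‖heatKernel (1 / b) (Circle.exp x * (Circle.exp y)⁻¹)‖) :=
    (((continuous_eval_const (F := C(Circle, ℂ)) _).tendsto _).comp
      (tendsto_chainKernel_self hb hβ)).norm
  set C₂ := ‖heatKernel (1 / b) (Circle.exp x * (Circle.exp y)⁻¹)‖ with hC₂
  have hC₂0 : 0 < C₂ := by
    exact norm_pos_iff.2 (heatKernel_ne_zero_of_pos (one_div_pos.2 hb) _)
  -- The `64` serves increments with `n ≤ 2k`: there `dist⁴ ≤ 16 ≤ 64 (k / n)²`.
  set C : ℝ := 64 + 5 * fourthMomentConst * (2 / b) ^ 2 * C₁ / (C₂ / 2) with hC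
  have hCn : 0 ≤ 5 * fourthMomentConst * (2 / b) ^ 2 * C₁ / (C₂ / 2) := by positivity
  refine ⟨ENNReal.ofReal C, ENNReal.ofReal_ne_top, ?_⟩
  filter_upwards [h1.eventually (gt_mem_nhds (lt_add_one _)),
    h2.eventually (lt_mem_nhds (half_lt_self hC₂0)),
    hβ.eventually (lt_mem_nhds (half_lt_self hb)),
    (tendsto_atTop_of_ratio hb hβ).eventually_ge_atTop 1, eventually_gt_atTop 1]
    with n hn1 hn2 hn3 hn4 hn5 a e
  have hn0 : (0 : ℝ) < n := by positivity
  have hβn : b / 2 * n ≤ β n := ((lt_div_iff₀ hn0).1 hn3).le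
  have hβ0 : 0 < β n := by linarith
  obtain ⟨d, hd⟩ : ∃ d, d = min a (n - 1) := ⟨_, rfl⟩
  obtain ⟨k, hk⟩ : ∃ k, k = min (a + e) (n - 1) - d := ⟨_, rfl⟩
  have hke : k ≤ e := by omega
  have hdk : min (a + e) (n - 1) = d + k := by omega
  have hdn : d + k < n := by omega
  rw [hdk, ← hd]
  have key : ∀ r : ℝ, r ≤ C / n ^ 2 * k ^ 2 →
      ENNReal.ofReal r ≤ ENNReal.ofReal C / (n : ENNReal) ^ 2 * e ^ 2 := by
    intro r hr
    have h4 : r ≤ C / n ^ 2 * (e : ℝ) ^ 2 := hr.trans (by gcongr)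
    refine (ENNReal.ofReal_le_ofReal h4).trans_eq ?_
    rw [ENNReal.ofReal_mul (by positivity), ENNReal.ofReal_div_of_pos (by positivity),
      ENNReal.ofReal_pow (by positivity), ENNReal.ofReal_pow (by positivity),
      ENNReal.ofReal_natCast, ENNReal.ofReal_natCast]
  rcases Nat.lt_or_ge (n / 2) k with hk2 | hk2
  · have h4 : ∫⁻ θ, edist (spins n θ d) (spins n θ (d + k)) ^ 4 ∂gibbsMeasure n (β n) x y ≤
        ENNReal.ofReal 16 := by
      calc _ ≤ ∫⁻ _, 2 ^ 4 ∂gibbsMeasure n (β n) x y :=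
            lintegral_mono fun θ => by gcongr; exact edist_circle_le _ _
        _ = 16 := by rw [lintegral_const, measure_univ, mul_one]; norm_num
        _ = ENNReal.ofReal 16 := by simp
    refine h4.trans (key _ ?_)
    have h5 : (n : ℝ) ≤ 2 * k := by exact_mod_cast (by omega : n ≤ 2 * k)
    rw [div_mul_eq_mul_div, le_div_iff₀ (by positivity)]
    nlinarith [mul_nonneg hCn (sq_nonneg (k : ℝ))]
  · rw [lintegral_edist_pow_four]
    refine key _ ((norm_integral_increment_gibbsMeasure_le (β n) x y chordPow d k hdn).trans ?_)
    have h5 : ‖chainKernel (β n) (n - k)‖ ≤ C₁ :=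
      (norm_chainKernel_anti (β n) (by omega : 1 ≤ n - n / 2) (by omega)).trans hn1.le
    have h6 := integral_chordPow_convPow_le hn4 k
    have h7 : (k / β n : ℝ) ^ 2 ≤ (2 / b) ^ 2 * k ^ 2 / n ^ 2 := by
      have : (k / β n : ℝ) ≤ 2 / b * k / n := by
        rw [div_le_div_iff₀ hβ0 hn0, div_mul_eq_mul_div, div_mul_eq_mul_div, le_div_iff₀ hb]
        have := mul_le_mul_of_nonneg_left hβn (Nat.cast_nonneg (α := ℝ) k)
        linarith
      calc (k / β n : ℝ) ^ 2 ≤ (2 / b * k / n) ^ 2 := by gcongr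
        _ = _ := by ring
    calc _ ≤ (5 * fourthMomentConst * ((2 / b) ^ 2 * k ^ 2 / n ^ 2)) * C₁ / (C₂ / 2) := by
          gcongr
          exact h6.trans (by gcongr)
      _ = (5 * fourthMomentConst * (2 / b) ^ 2 * C₁ / (C₂ / 2)) / n ^ 2 * k ^ 2 := by ring
      _ ≤ _ := by
          gcongr
          linarith

end scaling

/-! ### Discretisation of the paths -/

/-- The path which takes the value `g j` on `[j / m, (j + 1) / m)`. -/
def stepPath {E : Type*} [TopologicalSpace E] (m : ℕ) (g : Fin (m + 1) → E) : SkorokhodSpace E :=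
  ⟨fun t => g ⟨⌊(m : ℝ) * t⌋₊, floor_lt m t⟩, isCadlag_step m g⟩

lemma edist_le_iSup {E : Type*} [PseudoEMetricSpace E] (x y : SkorokhodSpace E) :
    edist x y ≤ ⨆ t, edist (x t) (y t) := by
  refine iInf_le_of_le (OrderIso.refl _) ?_
  simp

/-- With the identity time change, for `t` in the `j`-th block `⌊n t⌋` lies between `n j / m` and `n
(j + 1) / m`, so the distance is an increment from the left end of that block. The maximum over
blocks is bounded by the sum. -/
lemma edist_stepPath_le (n m : ℕ) (hn : 0 < n) (hm : 0 < m) (θ : Fin (n + 1) → ℝ) {δ : ENNReal}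
    (h0 : δ ≠ 0) (ht : δ ≠ ⊤) :
    edist (spinPath n θ) (stepPath m fun j => spins n θ (n * j / m)) ≤ δ + δ⁻¹ ^ 3 *
      ∑ j ∈ Finset.range m, maxIncrement (fun k => spins n θ (min k (n - 1))) (n * j / m)
        (n * (j + 1) / m - n * j / m) := by
  refine (edist_le_iSup _ _).trans (iSup_le fun t => ?_)
  have hn' : (0 : ℝ) < n := Nat.cast_pos.2 hn
  have hm' : (0 : ℝ) < m := Nat.cast_pos.2 hm
  have hv : spinPath n θ t = spins n θ ⌊(n : ℝ) * t⌋₊ := by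
    rw [spins, dif_pos (floor_lt n t)]
    rfl
  have hw : stepPath m (fun j => spins n θ (n * j / m)) t = spins n θ (n * ⌊(m : ℝ) * t⌋₊ / m) := rfl
  rw [hv, hw]
  -- At `t = 1` both paths show the last spin; for `t < 1` the index is at most `n - 1` and the cap
  -- is invisible.
  rcases eq_or_lt_of_le t.2.2 with h1 | h1
  · rw [h1, mul_one, mul_one, Nat.floor_natCast, Nat.floor_natCast, Nat.mul_div_cancel _ hm,
      edist_self]
    exact zero_le
  · obtain ⟨j, hj⟩ : ∃ j, j = ⌊(m : ℝ) * t⌋₊ := ⟨_, rfl⟩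
    obtain ⟨k, hk⟩ : ∃ k, k = ⌊(n : ℝ) * t⌋₊ := ⟨_, rfl⟩
    have hj1 : (j : ℝ) ≤ m * t := hj ▸ Nat.floor_le (mul_nonneg hm'.le t.2.1)
    have hj2 : (m * t : ℝ) < j + 1 := hj ▸ Nat.lt_floor_add_one _
    have hk1 : (k : ℝ) ≤ n * t := hk ▸ Nat.floor_le (mul_nonneg hn'.le t.2.1)
    have hk2 : (n * t : ℝ) < k + 1 := hk ▸ Nat.lt_floor_add_one _
    rw [← hj, ← hk]
    have hjm : j < m := by
      have : (j : ℝ) < m := hj1.trans_lt (mul_lt_of_lt_one_right hm' h1)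
      exact_mod_cast this
    have hkn : k < n := by
      have : (k : ℝ) < n := hk1.trans_lt (mul_lt_of_lt_one_right hn' h1)
      exact_mod_cast this
    have hkl : n * j / m ≤ k := by
      rw [← Nat.lt_succ_iff, Nat.div_lt_iff_lt_mul hm]
      have : (n * j : ℝ) < (k + 1) * m := by nlinarith
      exact_mod_cast this
    have hku : k ≤ n * (j + 1) / m := by
      rw [Nat.le_div_iff_mul_le hm]
      have : (k * m : ℝ) ≤ n * (j + 1) := by nlinarith
      exact_mod_cast this
    obtain ⟨r, hr⟩ := Nat.exists_eq_add_of_le hkl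
    refine (le_add_inv_pow_mul h0 ht _).trans ?_
    gcongr
    have h2 := le_maxIncrement (fun k => spins n θ (min k (n - 1))) (n * j / m)
      (k := r) (L := n * (j + 1) / m - n * j / m) (by omega)
    simp only [← hr] at h2
    rw [min_eq_left (by omega : n * j / m ≤ n - 1), min_eq_left (by omega : k ≤ n - 1),
      edist_comm] at h2
    exact h2.trans (Finset.single_le_sum (f := fun j => maxIncrement
      (fun k => spins n θ (min k (n - 1))) (n * j / m) (n * (j + 1) / m - n * j / m))
      (fun _ _ => zero_le) (Finset.mem_range.2 hjm))

lemma gap_mul_le {n m : ℕ} (hm : 0 < m) (hmn : m ≤ n) (j : ℕ) :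
    (n * (j + 1) / m - n * j / m) * m ≤ 2 * n := by
  obtain ⟨g, hg⟩ : ∃ g, g = n * (j + 1) / m - n * j / m := ⟨_, rfl⟩
  rw [← hg]
  have h1 := Nat.div_mul_le_self (n * (j + 1)) m
  have h2 := Nat.lt_div_mul_add hm (a := n * j)
  have h3 : n * j / m ≤ n * (j + 1) / m := Nat.div_le_div_right (by gcongr; omega)
  have h4 : g + n * j / m = n * (j + 1) / m := by omega
  rw [← h4] at h1
  nlinarith

lemma div_sq_mul_sq_le {n m g : ℕ} (hn : 0 < n) (hm : 0 < m) (h : g * m ≤ 2 * n) (K C : ENNReal) :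
    K * (C / (n : ENNReal) ^ 2) * (g : ENNReal) ^ 2 ≤ K * C * 4 / (m : ENNReal) ^ 2 := by
  have hm0 : (m : ENNReal) ≠ 0 := by exact_mod_cast hm.ne'
  have hnn : (n : ENNReal) ≠ 0 := by exact_mod_cast hn.ne'
  have h5 : (g : ENNReal) / n ≤ 2 / m := by
    rw [ENNReal.div_le_iff hnn (ENNReal.natCast_ne_top n), ← ENNReal.mul_div_right_comm,
      ENNReal.le_div_iff_mul_le (Or.inl hm0) (Or.inl (ENNReal.natCast_ne_top m))]
    exact_mod_cast h
  calc K * (C / (n : ENNReal) ^ 2) * (g : ENNReal) ^ 2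
      = K * C * ((g : ENNReal) / n) ^ 2 := by
        rw [div_eq_mul_inv, div_eq_mul_inv, mul_pow, ENNReal.inv_pow]; ring
    _ ≤ K * C * ((2 : ENNReal) / m) ^ 2 := by gcongr
    _ = _ := by rw [div_eq_mul_inv, div_eq_mul_inv, mul_pow, ENNReal.inv_pow]; ring

/-- Each of the `m` blocks has at most `2n / m` steps and contributes `O(m⁻²)`, so the sum is `O(1 /
m)`. The constant depends on neither `m`, `δ` nor `n`, so `δ` can be fixed before `m` is taken
large. -/
theorem exists_lintegral_edist_stepPath_le {b : ℝ} {β : ℕ → ℝ} (hb : 0 < b)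
    (hβ : Tendsto (fun n : ℕ => β n / n) atTop (𝓝 b)) (x y : ℝ) :
    ∃ C : ENNReal, C ≠ ⊤ ∧ ∀ m : ℕ, 0 < m → ∀ δ : ENNReal, δ ≠ 0 → δ ≠ ⊤ → ∀ᶠ n : ℕ in atTop,
      ∫⁻ θ, edist (spinPath n θ) (stepPath m fun j => spins n θ (n * j / m))
        ∂gibbsMeasure n (β n) x y ≤ δ + δ⁻¹ ^ 3 * (C / m) := by
  obtain ⟨C, hC, h⟩ := exists_lintegral_increment_le hb hβ x y
  obtain ⟨K, hK⟩ : ∃ K : ENNReal, K = 11 ^ 4 := ⟨_, rfl⟩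
  have hKt : K ≠ ⊤ := by rw [hK]; finiteness
  refine ⟨K * C * 4, by finiteness, fun m hm δ h0 ht => ?_⟩
  filter_upwards [h, eventually_ge_atTop m] with n hn hmn
  have hn0 : 0 < n := hm.trans_le hmn
  have hY : ∀ i j, Measurable fun θ : Fin (n + 1) → ℝ =>
      edist (spins n θ (min i (n - 1))) (spins n θ (min j (n - 1))) :=
    fun i j => measurable_edist_spins n _ _
  have hmI := measurable_maxIncrement hY
  have hm0 : (m : ENNReal) ≠ 0 := by exact_mod_cast hm.ne'
  have hsum : ∑ j ∈ Finset.range m, ∫⁻ θ, maxIncrement (fun k => spins n θ (min k (n - 1)))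
        (n * j / m) (n * (j + 1) / m - n * j / m) ∂gibbsMeasure n (β n) x y ≤ K * C * 4 / m := by
    refine (Finset.sum_le_sum (g := fun _ => K * C * 4 / (m : ENNReal) ^ 2) fun j _ => ?_).trans_eq ?_
    · refine (lintegral_maxIncrement_le hY hn _ _).trans ?_
      rw [← hK]
      exact div_sq_mul_sq_le hn0 hm (gap_mul_le hm hmn j) K C
    · rw [Finset.sum_const, Finset.card_range, nsmul_eq_mul, sq, ← mul_div_assoc,
        ENNReal.mul_div_mul_left _ _ hm0 (ENNReal.natCast_ne_top m)]
  refine (lintegral_mono fun θ => edist_stepPath_le n m hn0 hm θ h0 ht).trans ?_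
  rw [lintegral_add_left measurable_const, lintegral_const, measure_univ, mul_one,
    lintegral_const_mul _ (Finset.measurable_fun_sum _ fun j _ => hmI _ _),
    lintegral_finsetSum _ fun j _ => hmI _ _]
  gcongr

/-! ### Finite-dimensional distributions of Brownian motion on the circle -/

lemma measurable_listVal (L : List (NNReal × C(Circle, ℂ))) {S : Type*} [MeasurableSpace S]
    {s : S → NNReal → ℝ} (hs : Measurable s) (c : ℝ) {z : S → ℝ} (hz : Measurable z) :
    Measurable fun x => listVal L fun t => Circle.exp (z x + c * s x t) := by
  induction L generalizing s with
  | nil => exact measurable_const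
  | cons p L ih =>
    obtain ⟨d, H⟩ := p
    refine Measurable.mul ?_ (ih (s := fun x t => s x (d + t)) ?_)
    · have h1 : Measurable fun x => z x + c * s x d :=
        hz.add (((measurable_pi_apply d).comp hs).const_mul c)
      exact (H.continuous.comp Circle.exp.continuous).measurable.comp h1
    · exact measurable_pi_lambda _ fun t => (measurable_pi_apply (d + t)).comp hs

lemma exists_norm_listVal_le {T : Type*} [Add T] (L : List (T × C(Circle, ℂ))) :
    ∃ C, ∀ s : T → Circle, ‖listVal L s‖ ≤ C :=
  exists_bound_of_continuous (continuous_listVal L)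

/-- The Markov property at time `d`: the shifted path is again Brownian and independent of `W d`, so
Fubini and the induction hypothesis from the new starting angle apply. -/
lemma integral_listVal_of_measurable (L : List (NNReal × C(Circle, ℂ))) {Ω : Type*}
    [MeasurableSpace Ω] {P : Measure Ω} [IsProbabilityMeasure P] {v : NNReal}
    {W : NNReal → Ω → ℝ} (hW : IsPreBrownianReal W P) (hm : ∀ t, Measurable (W t)) (z : ℝ) :
    ∫ ω, listVal L (fun t => Circle.exp (z + √v * W t ω)) ∂P =
      transfer (fun d => rotAvg (gaussianReal 0 (d * v))) L 1 (Circle.exp z) := by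
  induction L generalizing W z with
  | nil => simp [listVal, transfer]
  | cons p L ih =>
    obtain ⟨d, H⟩ := p
    obtain ⟨W', hW'⟩ : ∃ W' : NNReal → Ω → ℝ, W' = fun t ω => W (d + t) ω - W d ω := ⟨_, rfl⟩
    have hsh : IsPreBrownianReal W' P := hW' ▸ hW.shift d
    have hmt : ∀ t, Measurable (W' t) := fun t => hW' ▸ (hm (d + t)).sub (hm d)
    have hmW' : Measurable (fun ω t => W' t ω) := measurable_pi_lambda _ hmt
    have hev : Measurable fun x : Set.Iic d → ℝ => x ⟨d, le_refl d⟩ := measurable_pi_apply _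
    have hind : IndepFun (W d) (fun ω t => W' t ω) P := by
      rw [hW']
      exact ((hW.indepFun_shift d).comp measurable_id hev).symm
    have hprod := (indepFun_iff_map_prod_eq_prod_map_map (hm d).aemeasurable
      hmW'.aemeasurable).1 hind
    let K : ℝ × (NNReal → ℝ) → ℂ := fun p => H (Circle.exp (z + √v * p.1)) *
      listVal L fun t => Circle.exp (z + √v * p.1 + √v * p.2 t)
    have hK : Measurable K := by
      have h1 : Measurable fun p : ℝ × (NNReal → ℝ) => z + √v * p.1 :=
        (measurable_fst.const_mul _).const_add z
      exact ((H.continuous.comp Circle.exp.continuous).measurable.comp h1).mul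
        (measurable_listVal L measurable_snd _ h1)
    obtain ⟨C, hC⟩ := exists_norm_listVal_le L
    have hKb : ∀ p, ‖K p‖ ≤ ‖H‖ * C := fun p => by
      rw [norm_mul]
      exact mul_le_mul (H.norm_coe_le_norm _) (hC _) (norm_nonneg _) (norm_nonneg _)
    have e1 : ∫ ω, listVal ((d, H) :: L) (fun t => Circle.exp (z + √v * W t ω)) ∂P =
        ∫ ω, K (W d ω, fun t => W' t ω) ∂P := by
      congr with ω
      simp only [listVal, K, hW']
      congr 2 with t
      congr 2
      ring
    have := Measure.isProbabilityMeasure_map (μ := P) (hm d).aemeasurable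
    have := Measure.isProbabilityMeasure_map (μ := P) hmW'.aemeasurable
    rw [e1, ← integral_map ((hm d).prodMk hmW').aemeasurable hK.aestronglyMeasurable, hprod,
      integral_prod _ (Integrable.of_bound hK.aestronglyMeasurable _ (ae_of_all _ hKb)),
      (hW.hasLaw_eval d).map_eq, transfer, rotAvg_apply]
    have hgm : gaussianReal 0 (d * v) = (gaussianReal 0 d).map fun a => √v * a := by
      rw [gaussianReal_map_const_mul, mul_zero]
      congr 1
      ext
      simp [mul_comm]
    rw [hgm, integral_map (by fun_prop) (Continuous.aestronglyMeasurable (by fun_prop))]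
    congr with a
    have h2 : ∫ y, K (a, y) ∂P.map (fun ω t => W' t ω) = H (Circle.exp (z + √v * a)) *
        ∫ ω, listVal L (fun t => Circle.exp (z + √v * a + √v * W' t ω)) ∂P := by
      have hKa : Measurable fun y => K (a, y) := hK.comp measurable_prodMk_left
      rw [integral_map hmW'.aemeasurable hKa.aestronglyMeasurable, ← integral_const_mul]
    rw [h2, ih hsh hmt, Circle.exp_add]
    rfl

lemma listVal_ae_congr {Ω : Type*} [MeasurableSpace Ω] {P : Measure Ω}
    (L : List (NNReal × C(Circle, ℂ))) {s s' : Ω → NNReal → Circle}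
    (h : ∀ t, ∀ᵐ ω ∂P, s ω t = s' ω t) : ∀ᵐ ω ∂P, listVal L (s ω) = listVal L (s' ω) := by
  induction L generalizing s s' with
  | nil => exact ae_of_all _ fun _ => rfl
  | cons p L ih =>
    obtain ⟨d, H⟩ := p
    filter_upwards [h d, ih fun t => h (d + t)] with ω h1 h2
    rw [listVal, listVal, h1, h2]

theorem integral_listVal_brownian (L : List (NNReal × C(Circle, ℂ))) {Ω : Type*}
    [MeasurableSpace Ω] {P : Measure Ω} [IsProbabilityMeasure P] {v : NNReal}
    {W : NNReal → Ω → ℝ} (hW : IsPreBrownianReal W P) (z : ℝ) :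
    ∫ ω, listVal L (fun t => Circle.exp (z + √v * W t ω)) ∂P =
      transfer (fun d => rotAvg (gaussianReal 0 (d * v))) L 1 (Circle.exp z) := by
  have h : ∀ t, W t =ᵐ[P] (hW.aemeasurable t).mk := fun t => (hW.aemeasurable t).ae_eq_mk
  rw [← integral_listVal_of_measurable L (hW.congr h) fun t => (hW.aemeasurable t).measurable_mk]
  refine integral_congr_ae (listVal_ae_congr L fun t => ?_)
  filter_upwards [h t] with ω hω
  rw [hω]

/-! ### Continuous paths -/

instance : MeasurableSpace C(unitInterval, ℝ) := borel _
instance : BorelSpace C(unitInterval, ℝ) := ⟨rfl⟩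

/-- A measurable way to recover the continuous paths of a process from their values at rational
times. -/
lemma exists_measurable_path {Ω : Type*} [MeasurableSpace Ω] {P : Measure Ω}
    {Z : unitInterval → Ω → ℝ} (hZ : ∀ t, AEMeasurable (Z t) P)
    (hc : ∀ᵐ ω ∂P, Continuous fun t => Z t ω) :
    ∃ Φ : ((Σ n : ℕ, Fin (n + 1)) → ℝ) → C(unitInterval, ℝ), Measurable Φ ∧
      ∀ᵐ ω ∂P, ∀ t, Φ (fun q => Z (bernstein.z q.2) ω) t = Z t ω := by
  -- Bernstein polynomials depend measurably on countably many values of the path and converge to it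
  -- uniformly when it is continuous.
  let B : ℕ → ((Σ n : ℕ, Fin (n + 1)) → ℝ) → C(unitInterval, ℝ) := fun n x =>
    ∑ k : Fin (n + 1), x ⟨n, k⟩ • bernstein n k
  have hB : ∀ n, Measurable (B n) := fun n =>
    Finset.measurable_fun_sum _ fun k _ => (measurable_pi_apply _).smul_const _
  have hBc : ∀ x : C(unitInterval, ℝ),
      Tendsto (fun n => B n fun q => x (bernstein.z q.2)) atTop (𝓝 x) := by
    intro x
    refine (bernsteinApproximation_uniform x).congr fun n => ?_
    ext t
    simp [B, bernsteinApproximation, mul_comm]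
  have hZm : AEMeasurable (fun ω (q : Σ n : ℕ, Fin (n + 1)) => Z (bernstein.z q.2) ω) P :=
    aemeasurable_pi_lambda _ fun q => hZ _
  have hlim0 : ∀ᵐ ω ∂P, ∃ l, Tendsto (fun n => B n fun q => Z (bernstein.z q.2) ω) atTop (𝓝 l) := by
    filter_upwards [hc] with ω hω
    exact ⟨_, hBc ⟨_, hω⟩⟩
  have hmeas : MeasurableSet {x | ∃ l, Tendsto (fun n => B n x) atTop (𝓝 l)} :=
    measurableSet_exists_tendsto hB
  obtain ⟨Φ, hΦ, hlim⟩ := measurable_limit_of_tendsto_metrizable_ae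
    (μ := P.map fun ω (q : Σ n : ℕ, Fin (n + 1)) => Z (bernstein.z q.2) ω) (f := B) (L := atTop)
    (fun n => (hB n).aemeasurable) ((ae_map_iff hZm hmeas).2 hlim0)
  refine ⟨Φ, hΦ, ?_⟩
  filter_upwards [ae_of_ae_map hZm hlim, hc] with ω h1 h2 t
  have := tendsto_nhds_unique h1 (hBc ⟨_, h2⟩)
  rw [this]
  rfl

/-- The Brownian bridge, up to the factor `c`. -/
lemma indepFun_bridge {Ω : Type*} [MeasurableSpace Ω] {P : Measure Ω} [IsProbabilityMeasure P]
    {W : NNReal → Ω → ℝ} (hW : IsPreBrownianReal W P) {S : Type*} (τ : S → unitInterval) :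
    IndepFun (fun ω s => W (unitInterval.toNNReal (τ s)) ω - τ s * W 1 ω)
      (fun ω (_ : Unit) => W 1 ω) P := by
  have mX t := hW.aemeasurable t
  -- The two families are jointly Gaussian, and the covariance of `W τ - τ W 1` with `W 1` is `τ - τ
  -- = 0`.
  apply IsGaussianProcess.indepFun_of_covariance_eq_zero
  · apply hW.isGaussianProcess.of_isGaussianProcess
    rintro (s | _)
    · exact ⟨{unitInterval.toNNReal (τ s), 1},
        { toFun x := x ⟨unitInterval.toNNReal (τ s), by simp⟩ - τ s * x ⟨1, by simp⟩
          map_add' x y := by simp; ring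
          map_smul' c x := by simp; ring }, by simp⟩
    · exact ⟨{1},
        { toFun x := x ⟨1, by simp⟩
          map_add' x y := by simp
          map_smul' c x := by simp }, by simp⟩
  any_goals fun_prop
  · rintro s _
    rw [covariance_fun_sub_left, hW.covariance_fun_eval, covariance_const_mul_left,
      hW.covariance_fun_eval, min_self, min_eq_left]
    · simp
    · exact (τ s).2.2
    · exact (hW.isGaussianProcess.hasGaussianLaw_eval _).memLp_two
    · exact (hW.isGaussianProcess.hasGaussianLaw_eval _).memLp_two.const_mul _
    · exact (hW.isGaussianProcess.hasGaussianLaw_eval _).memLp_two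

/-! ### Averages over small arcs -/

/-- The angles in `(-π, π]` of the points of the circle at distance less than `ε` from `1`. -/
def arcSet (ε : ℝ) : Set ℝ := {u | dist (Circle.exp u) 1 < ε} ∩ Set.Ioc (-Real.pi) Real.pi

lemma isOpen_dist_exp_lt (z : Circle) (ε : ℝ) : IsOpen {u : ℝ | dist (Circle.exp u) z < ε} :=
  isOpen_lt (Circle.exp.continuous.dist continuous_const) continuous_const

lemma measurableSet_arcSet (ε : ℝ) : MeasurableSet (arcSet ε) :=
  (isOpen_dist_exp_lt 1 ε).measurableSet.inter measurableSet_Ioc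

lemma volume_arcSet_ne_top (ε : ℝ) : volume (arcSet ε) ≠ ⊤ :=
  measure_ne_top_of_subset Set.inter_subset_right (by simp)

lemma volume_arcSet_ne_zero {ε : ℝ} (hε : 0 < ε) : volume (arcSet ε) ≠ 0 := by
  have h : IsOpen ({u : ℝ | dist (Circle.exp u) 1 < ε} ∩ Set.Ioo (-Real.pi) Real.pi) :=
    (isOpen_dist_exp_lt 1 ε).inter isOpen_Ioo
  have h2 := h.measure_pos volume ⟨0, by simpa using hε, by simp [Real.pi_pos]⟩
  exact (h2.trans_le (measure_mono (Set.inter_subset_inter_right _ Set.Ioo_subset_Ioc_self))).ne'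

/-- On `(-π, π]` the angle is recovered by `arg`, which is continuous at `1`; hence points close to
`1` have small angles. -/
lemma eventually_arcSet_subset {δ : ℝ} (hδ : 0 < δ) :
    ∀ᶠ ε in 𝓝[>] (0 : ℝ), arcSet ε ⊆ Metric.ball 0 δ := by
  have h1 : ContinuousAt (fun z : Circle => (z : ℂ).arg) 1 := by
    refine ContinuousAt.comp (g := Complex.arg) ?_ continuous_subtype_val.continuousAt
    exact Complex.continuousAt_arg (by simp)
  obtain ⟨ε, hε, h2⟩ := Metric.continuousAt_iff.1 h1 δ hδ
  have h3 : ∀ᶠ ε' in 𝓝[>] (0 : ℝ), ε' < ε := mem_nhdsWithin_of_mem_nhds (gt_mem_nhds hε)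
  filter_upwards [h3] with ε' hε' u hu
  have h4 : dist (Circle.exp u : ℂ).arg ((1 : Circle) : ℂ).arg < δ := h2 (hu.1.trans hε')
  rw [Circle.arg_exp hu.2.1 hu.2.2] at h4
  simpa using h4

lemma tendsto_arcSet_average {g : ℝ → ℂ} (hg : Continuous g) :
    Tendsto (fun ε => ⨍ u in arcSet ε, g u) (𝓝[>] 0) (𝓝 (g 0)) := by
  rw [Metric.tendsto_nhds]
  intro η hη
  obtain ⟨δ, hδ, h1⟩ := Metric.continuousAt_iff.1 (hg.continuousAt (x := 0)) (η / 2) (half_pos hη)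
  filter_upwards [eventually_arcSet_subset hδ, self_mem_nhdsWithin] with ε h2 hε
  have h3 := (convex_closedBall (g 0) (η / 2)).set_average_mem Metric.isClosed_closedBall
    (volume_arcSet_ne_zero hε) (volume_arcSet_ne_top ε) (f := g) ?_ ?_
  · exact (Metric.mem_closedBall.1 h3).trans_lt (half_lt_self hη)
  · filter_upwards [ae_restrict_mem (measurableSet_arcSet ε)] with u hu
    exact (h1 (h2 hu)).le
  · exact (integrable_of_continuous_period hg).mono_measure
      (Measure.restrict_mono Set.inter_subset_right le_rfl)

/-- Periodicity allows a shift by `u₁`, which centres the arc at `1` whatever the target point. -/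
lemma setIntegral_indicator_arc {g : ℝ → ℂ} (hp : g.Periodic (2 * Real.pi)) (u₁ ε : ℝ) :
    ∫ u in Set.Ioc (-Real.pi) Real.pi,
      {u | dist (Circle.exp u) (Circle.exp u₁) < ε}.indicator (fun _ => (1 : ℂ)) u * g u =
    ∫ u in arcSet ε, g (u + u₁) := by
  have hd : ∀ u, dist (Circle.exp (u + u₁)) (Circle.exp u₁) = dist (Circle.exp u) 1 := by
    intro u
    rw [dist_circle, dist_circle, Circle.exp_add, Circle.coe_mul, Circle.coe_one]
    rw [← sub_one_mul, norm_mul, Circle.norm_coe, mul_one]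
  rw [← integral_Ioc_add_of_periodic (u := u₁)]
  · rw [arcSet, Set.inter_comm, ← setIntegral_indicator (isOpen_dist_exp_lt 1 ε).measurableSet]
    congr with u
    simp only [Set.indicator, Set.mem_ofPred_eq, hd]
    split_ifs <;> simp
  · intro u
    simp only [Set.indicator, Set.mem_ofPred_eq, Circle.periodic_exp u, hp u]

/-! ### The pinned path -/

/-- The path `t ↦ θ + w t + r t`. -/
def tiltPath (θ w : ℝ) (r : C(unitInterval, ℝ)) : C(unitInterval, ℝ) :=
  ⟨fun t => θ + w * t + r t, by fun_prop⟩

lemma continuous_tiltPath (θ : ℝ) :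
    Continuous fun p : ℝ × C(unitInterval, ℝ) => tiltPath θ p.1 p.2 := by
  have h : ∀ p : ℝ × C(unitInterval, ℝ), tiltPath θ p.1 p.2 =
      ContinuousMap.const _ θ + p.1 • (⟨fun t => (t : ℝ), by fun_prop⟩ : C(unitInterval, ℝ)) +
        p.2 := by
    intro p
    ext t
    simp [tiltPath]
  simp only [h]
  fun_prop

section pinned
variable {lam : Measure C(unitInterval, ℝ)} [IsProbabilityMeasure lam] {θ : ℝ} {v : NNReal}
  {F : C(unitInterval, ℝ) → ℂ} {C : ℝ}

/-- The average of a function of the path `t ↦ θ + w t + r t` over the random path `r`. -/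
def pathAvg (lam : Measure C(unitInterval, ℝ)) (θ : ℝ) (F : C(unitInterval, ℝ) → ℂ) (w : ℝ) : ℂ :=
  ∫ r, F (tiltPath θ w r) ∂lam

lemma norm_pathAvg_le (hC : ∀ c, ‖F c‖ ≤ C) (w : ℝ) : ‖pathAvg lam θ F w‖ ≤ C := by
  exact (norm_integral_le_of_norm_le_const (ae_of_all _ fun r => hC (tiltPath θ w r))).trans_eq
    (by simp)

lemma integrable_tiltPath (hF : Continuous F) (hC : ∀ c, ‖F c‖ ≤ C) (w : ℝ) :
    Integrable (fun r => F (tiltPath θ w r)) lam :=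
  Integrable.of_bound (hF.comp ((continuous_tiltPath θ).comp
    (by fun_prop : Continuous fun r => (w, r)))).aestronglyMeasurable C (ae_of_all _ fun _ => hC _)

lemma continuous_pathAvg (hF : Continuous F) (hC : ∀ c, ‖F c‖ ≤ C) :
    Continuous (pathAvg lam θ F) := by
  refine continuous_of_dominated (bound := fun _ => C) (fun w => (integrable_tiltPath hF hC w).1)
    (fun w => ae_of_all _ fun r => hC _) (integrable_const _) (ae_of_all _ fun r => ?_)
  exact hF.comp ((continuous_tiltPath θ).comp (by fun_prop : Continuous fun w => (w, r)))

lemma pathAvg_one : pathAvg lam θ (fun _ => 1) = fun _ => 1 := by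
  funext w
  simp [pathAvg]

/-- The law of the path `t ↦ θ + w t + r t`, where `w` is Gaussian conditioned on its value `u₁`
modulo `2π`. -/
def pinnedLaw (lam : Measure C(unitInterval, ℝ)) (θ : ℝ) (v : NNReal) (u₁ : ℝ) :
    Measure C(unitInterval, ℝ) :=
  Measure.sum fun m : ℤ => ENNReal.ofReal (gaussianPDFReal 0 v (u₁ + 2 * Real.pi * m) /
    ∑' m : ℤ, gaussianPDFReal 0 v (u₁ + 2 * Real.pi * m)) •
      lam.map (tiltPath θ (u₁ + 2 * Real.pi * m))

lemma measurable_tiltPath (w : ℝ) : Measurable (tiltPath θ w) :=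
  ((continuous_tiltPath θ).comp (by fun_prop : Continuous fun r => (w, r))).measurable

lemma isProbabilityMeasure_pinnedLaw (hv : v ≠ 0) (u₁ : ℝ) :
    IsProbabilityMeasure (pinnedLaw lam θ v u₁) := by
  refine ⟨?_⟩
  have hs := tsum_gaussianPDFReal_wrap_pos hv u₁
  rw [pinnedLaw, Measure.sum_apply _ MeasurableSet.univ]
  have : ∀ m : ℤ, (lam.map (tiltPath θ (u₁ + 2 * Real.pi * m))) Set.univ = 1 := fun m => by
    rw [Measure.map_apply (measurable_tiltPath _) MeasurableSet.univ, Set.preimage_univ, measure_univ]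
  simp only [Measure.smul_apply, this, smul_eq_mul, mul_one]
  rw [← ENNReal.ofReal_tsum_of_nonneg, tsum_div_const, div_self hs.ne', ENNReal.ofReal_one]
  · exact fun m => div_nonneg (gaussianPDFReal_nonneg _ _ _) hs.le
  · exact (summable_gaussianPDFReal_wrap hv u₁).div_const _

/-- The winding weights share the denominator `wrap v 1`, so a pinned expectation is a ratio of two
wrapped densities at `u₁`, the form in which limits of arc averages arise. -/
lemma integral_pinnedLaw (hv : v ≠ 0) (hF : Continuous F) (hC : ∀ c, ‖F c‖ ≤ C) (u₁ : ℝ) :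
    ∫ c, F c ∂pinnedLaw lam θ v u₁ =
      wrap v (pathAvg lam θ F) u₁ / wrap v (fun _ => 1) u₁ := by
  have hs := tsum_gaussianPDFReal_wrap_pos hv u₁
  have := isProbabilityMeasure_pinnedLaw (lam := lam) (θ := θ) hv u₁
  have hi : Integrable F (pinnedLaw lam θ v u₁) :=
    Integrable.of_bound hF.aestronglyMeasurable C (ae_of_all _ hC)
  rw [pinnedLaw, integral_sum_measure hi, wrap_one_eq, wrap, ← tsum_div_const]
  congr with m
  rw [integral_smul_measure, integral_map (measurable_tiltPath _).aemeasurable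
    hF.aestronglyMeasurable, ENNReal.toReal_ofReal (div_nonneg (gaussianPDFReal_nonneg _ _ _) hs.le),
    Complex.real_smul, pathAvg]
  push_cast
  ring

end pinned

lemma ae_pinnedLaw_exp_one {lam : Measure C(unitInterval, ℝ)} {θ : ℝ} {v : NNReal}
    (h1 : ∀ᵐ r ∂lam, r 1 = 0) (θ₁ : ℝ) :
    ∀ᵐ c ∂pinnedLaw lam θ v (θ₁ - θ), Circle.exp (c 1) = Circle.exp θ₁ := by
  rw [pinnedLaw, Measure.ae_sum_iff]
  intro m
  refine Measure.ae_smul_measure ?_ _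
  have hm : MeasurableSet {c : C(unitInterval, ℝ) | Circle.exp (c 1) = Circle.exp θ₁} :=
    (isClosed_eq (Circle.exp.continuous.comp
      (continuous_eval_const (F := C(unitInterval, ℝ)) 1)) continuous_const).measurableSet
  rw [ae_map_iff (measurable_tiltPath _).aemeasurable hm]
  filter_upwards [h1] with r hr
  have h2 : tiltPath θ (θ₁ - θ + 2 * Real.pi * m) r 1 = θ₁ + m * (2 * Real.pi) := by
    simp only [tiltPath, ContinuousMap.coe_mk, hr, Set.Icc.coe_one]
    ring
  rw [h2]
  exact Circle.periodic_exp.int_mul m θ₁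

/-! ### The Brownian path -/

/-- Here `lam` is the law of `√v` times the bridge, as a random element of `C([0,1])`, and `V` is a
measurable version of the path. The final formula disintegrates over the endpoint `√v W 1`: it is
Fubini under the independence of bridge and endpoint. -/
lemma exists_bridge {Ω : Type*} [MeasurableSpace Ω] {P : Measure Ω} [IsProbabilityMeasure P]
    {W : NNReal → Ω → ℝ} (hW : IsBrownianReal W P) (θ : ℝ) (v : NNReal) :
    ∃ (lam : Measure C(unitInterval, ℝ)) (V : Ω → C(unitInterval, ℝ)),
      IsProbabilityMeasure lam ∧ (∀ᵐ r ∂lam, r 1 = 0) ∧ AEMeasurable V P ∧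
      (∀ᵐ ω ∂P, ∀ t, V ω t = θ + √v * W (unitInterval.toNNReal t) ω) ∧
      ∀ {F : C(unitInterval, ℝ) → ℂ} {h : ℝ → ℂ} {C C' : ℝ}, Continuous F → (∀ c, ‖F c‖ ≤ C) →
        Measurable h → (∀ w, ‖h w‖ ≤ C') →
        ∫ ω, h (√v * W 1 ω) * F (V ω) ∂P = ∫ w, h w * pathAvg lam θ F w ∂gaussianReal 0 v := by
  have hp := hW.toIsPreBrownianReal
  have hm : ∀ t, AEMeasurable (W t) P := hp.aemeasurable
  let Z : unitInterval → Ω → ℝ := fun t ω => W (unitInterval.toNNReal t) ω - t * W 1 ω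
  have hZ : ∀ t, AEMeasurable (Z t) P := fun t => (hm _).sub ((hm _).const_mul _)
  have hZc : ∀ᵐ ω ∂P, Continuous fun t => Z t ω := by
    filter_upwards [hW.cont] with ω hω
    have : Continuous fun t : unitInterval => W (unitInterval.toNNReal t) ω :=
      hω.comp (by fun_prop)
    fun_prop
  obtain ⟨Φ, hΦ, hΦZ⟩ := exists_measurable_path hZ hZc
  let q : Ω → (Σ n : ℕ, Fin (n + 1)) → ℝ := fun ω q => Z (bernstein.z q.2) ω
  have hq : AEMeasurable q P := aemeasurable_pi_lambda _ fun q => hZ _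
  let br : Ω → C(unitInterval, ℝ) := fun ω => √v • Φ (q ω)
  have hbr : AEMeasurable br P := (hΦ.const_smul √v).comp_aemeasurable hq
  have hU : AEMeasurable (fun ω => √v * W 1 ω) P := (hm 1).const_mul _
  have hind : IndepFun br (fun ω => √v * W 1 ω) P := by
    have hev : Measurable fun x : Unit → ℝ => √v * x () := (measurable_pi_apply ()).const_mul _
    exact (indepFun_bridge hp (fun q : Σ n : ℕ, Fin (n + 1) => bernstein.z q.2)).comp
      (hΦ.const_smul √v) hev
  have hprod := (indepFun_iff_map_prod_eq_prod_map_map hbr hU).1 hind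
  have hlaw : P.map (fun ω => √v * W 1 ω) = gaussianReal 0 v := by
    have h1 := (hp.hasLaw_eval 1).map_eq
    have h2 : P.map (fun ω => √v * W 1 ω) = (P.map (W 1)).map fun a => √v * a :=
      (AEMeasurable.map_map_of_aemeasurable (by fun_prop) (hm 1)).symm
    rw [h2, h1, gaussianReal_map_const_mul, mul_zero]
    congr 1
    ext
    simp
  have hlam := Measure.isProbabilityMeasure_map hbr
  have hT : Continuous fun p : C(unitInterval, ℝ) × ℝ => tiltPath θ p.2 p.1 :=
    (continuous_tiltPath θ).comp continuous_swap
  refine ⟨P.map br, fun ω => tiltPath θ (√v * W 1 ω) (br ω), hlam,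
    (ae_map_iff hbr (isClosed_eq (continuous_eval_const (F := C(unitInterval, ℝ)) 1)
      continuous_const).measurableSet).2 ?_, hT.measurable.comp_aemeasurable (hbr.prodMk hU), ?_, ?_⟩
  · filter_upwards [hΦZ] with ω hω
    have h1 : unitInterval.toNNReal 1 = 1 := rfl
    simp [br, q, hω, Z, h1]
  · filter_upwards [hΦZ] with ω hω t
    simp only [tiltPath, ContinuousMap.coe_mk, br, q, ContinuousMap.smul_apply, hω, Z, smul_eq_mul]
    ring
  · intro F h C C' hF hC hh hC'
    let K : C(unitInterval, ℝ) × ℝ → ℂ := fun p => h p.2 * F (tiltPath θ p.2 p.1)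
    have hK : Measurable K := (hh.comp measurable_snd).mul (hF.comp hT).measurable
    have hKb : ∀ p, ‖K p‖ ≤ C' * C := fun p => by
      rw [norm_mul]
      exact mul_le_mul (hC' _) (hC _) (norm_nonneg _) ((norm_nonneg _).trans (hC' p.2))
    have e1 : ∫ ω, h (√v * W 1 ω) * F (tiltPath θ (√v * W 1 ω) (br ω)) ∂P =
        ∫ p, K p ∂P.map fun ω => (br ω, √v * W 1 ω) :=
      (integral_map (hbr.prodMk hU) hK.aestronglyMeasurable).symm
    rw [e1, hprod, hlaw, integral_prod_symm _
      (Integrable.of_bound hK.aestronglyMeasurable _ (ae_of_all _ hKb))]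
    congr with w
    rw [pathAvg, ← integral_const_mul]

/-! ### From paths of angles to paths on the circle -/

/-- The image on the circle of a continuous path of angles. -/
def expPath (c : C(unitInterval, ℝ)) : SkorokhodSpace Circle :=
  ⟨fun t => Circle.exp (c t), fun t => by
    have h : Continuous fun t => Circle.exp (c t) := by fun_prop
    exact ⟨h.continuousWithinAt, _, h.continuousAt.tendsto.mono_left nhdsWithin_le_nhds⟩⟩

lemma dist_exp_le (x y : ℝ) : dist (Circle.exp x) (Circle.exp y) ≤ dist x y := by
  have h : (Circle.exp x : ℂ) - Circle.exp y =
      Circle.exp y * (Complex.exp (Complex.I * (x - y : ℝ)) - 1) := by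
    rw [mul_sub_one, mul_comm Complex.I, ← Circle.coe_exp, ← Circle.coe_mul, ← Circle.exp_add,
      add_sub_cancel]
  rw [dist_circle, h, norm_mul, Circle.norm_coe, one_mul, Real.dist_eq]
  exact Real.norm_exp_I_mul_ofReal_sub_one_le

/-- The identity time change and `|exp (i x) - exp (i y)| ≤ |x - y|` make the map 1-Lipschitz. -/
lemma continuous_expPath : Continuous expPath := by
  refine LipschitzWith.continuous (K := 1) fun c c' => ?_
  rw [ENNReal.coe_one, one_mul]
  refine (edist_le_iSup _ _).trans (iSup_le fun t => ?_)
  calc edist (Circle.exp (c t)) (Circle.exp (c' t)) ≤ edist (c t) (c' t) := by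
        rw [edist_dist, edist_dist]
        exact ENNReal.ofReal_le_ofReal (dist_exp_le _ _)
    _ ≤ edist c c' := by
        rw [edist_dist, edist_dist]
        exact ENNReal.ofReal_le_ofReal (ContinuousMap.dist_apply_le_dist t)

/-! ### Finite-dimensional distributions of the pinned path -/

lemma listVal_append {T : Type*} [AddMonoid T] (L : List (T × C(Circle, ℂ))) (e : T)
    (H : C(Circle, ℂ)) (s : T → Circle) :
    listVal (L ++ [(e, H)]) s = listVal L s * H (s (listTime L + e)) := by
  induction L generalizing s with
  | nil => simp [listVal, listTime]
  | cons p L ih =>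
    obtain ⟨d, H'⟩ := p
    rw [List.cons_append, listVal, listVal, ih, mul_assoc]
    simp [listTime, add_assoc]

lemma transfer_append {T : Type*} (A : T → C(Circle, ℂ) → C(Circle, ℂ))
    (L : List (T × C(Circle, ℂ))) (e : T) (H : C(Circle, ℂ)) :
    transfer A (L ++ [(e, H)]) 1 = transfer A L (A e H) := by
  induction L with
  | nil => simp [transfer]
  | cons p L ih => rw [List.cons_append, transfer, transfer, ih]

/-- Being linear and bounded in its last argument, `transfer` can be applied term by term to the
Fourier series of the heat kernel. -/
lemma exists_transfer_eq {T : Type*} (A : T → C(Circle, ℂ) →L[ℂ] C(Circle, ℂ))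
    (L : List (T × C(Circle, ℂ))) :
    ∃ B : C(Circle, ℂ) →L[ℂ] C(Circle, ℂ), ∀ g, B g = transfer (fun d => A d) L g := by
  induction L with
  | nil => exact ⟨ContinuousLinearMap.id _ _, fun g => rfl⟩
  | cons p L ih =>
    obtain ⟨d, H⟩ := p
    obtain ⟨B, hB⟩ := ih
    refine ⟨(A d).comp ((ContinuousLinearMap.mul ℂ C(Circle, ℂ) H).comp B), fun g => ?_⟩
    rw [transfer, ← hB]
    rfl

lemma listVal_congr_of_le (L : List (NNReal × C(Circle, ℂ))) {s s' : NNReal → Circle}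
    (h : ∀ t ≤ listTime L, s t = s' t) : listVal L s = listVal L s' := by
  induction L generalizing s s' with
  | nil => rfl
  | cons p L ih =>
    obtain ⟨d, H⟩ := p
    have e : listTime ((d, H) :: L) = d + listTime L := by simp [listTime]
    rw [e] at h
    rw [listVal, listVal, h d le_self_add, ih fun t ht => h _ (by gcongr)]

/-- The extension to nonnegative times of a path on the unit interval. -/
def extendPath {E : Type*} (x : unitInterval → E) (t : NNReal) : E :=
  x (Set.projIcc 0 1 zero_le_one (t : ℝ))

lemma continuous_listVal_expPath (L : List (NNReal × C(Circle, ℂ))) :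
    Continuous fun c : C(unitInterval, ℝ) => listVal L (extendPath (expPath c)) := by
  refine (continuous_listVal L).comp (continuous_pi fun t => ?_)
  exact Circle.exp.continuous.comp (continuous_eval_const (F := C(unitInterval, ℝ)) _)

/-- The Gaussian weights are even in `k`, so the series may be written in the characters `z ^ (-k)`,
matching the test characters of `angleCoeff_wrap`. -/
lemma translate_heatKernel_hasSum {s : ℝ} (hs : 0 < s) (z₁ : Circle) :
    HasSum (fun k : ℤ => ((2 * Real.pi : ℂ)⁻¹ * ((Real.exp (-((k : ℝ) ^ 2 * s / 2)) : ℂ) *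
      circleMonomial k z₁)) • circleMonomial (-k)) (translate z₁ (heatKernel s)) := by
  have hsum : Summable fun k : ℤ => (Real.exp (-((k : ℝ) ^ 2 * s / 2)) : ℂ) *
      circleMonomial (-k) z₁ := by
    refine Summable.of_norm ?_
    simp only [norm_mul, circleMonomial_apply, Circle.norm_coe, mul_one]
    exact (summable_heat hs).norm
  have h1 := hasSum_circleSeries hsum
  have h2 : circleSeries (fun k : ℤ => (Real.exp (-((k : ℝ) ^ 2 * s / 2)) : ℂ) *
      circleMonomial (-k) z₁) = translate z₁ (heatKernel s) := by
    ext z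
    have h3 := ContinuousMap.hasSum_apply h1 z
    have h4 := ContinuousMap.hasSum_apply (hasSum_circleSeries (summable_heat hs)) (z * z₁⁻¹)
    refine h3.unique ?_
    refine h4.congr_fun ?_
    intro k
    simp only [ContinuousMap.smul_apply, circleMonomial_apply, smul_eq_mul, mul_zpow, inv_zpow',
      Circle.coe_mul]
    ring
  rw [h2, ← (Equiv.neg ℤ).hasSum_iff] at h1
  refine h1.congr_fun fun k => ?_
  simp

section pinned
variable {Ω : Type*} [MeasurableSpace Ω] {P : Measure Ω}
  {W : NNReal → Ω → ℝ} {lam : Measure C(unitInterval, ℝ)} [IsProbabilityMeasure lam] {θ : ℝ}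
  {v : NNReal} {V : Ω → C(unitInterval, ℝ)}

/-- Both sides are compared through their Fourier series in the endpoint, so no joint density of the
bridge is needed. The `k`-th coefficient on the left is an expectation of the path functional times
a character of the endpoint, computed by the Markov property; the last stretch, from `listTime L` to
`1`, contributes the Gaussian factor that makes the series summable. -/
lemma wrap_pathAvg_listVal [IsProbabilityMeasure P] (hW : IsPreBrownianReal W P) (hv : v ≠ 0)
    (hV : ∀ᵐ ω ∂P, ∀ t, V ω t = θ + √v * W (unitInterval.toNNReal t) ω)
    (hVU : ∀ {F : C(unitInterval, ℝ) → ℂ} {h : ℝ → ℂ} {C C' : ℝ}, Continuous F → (∀ c, ‖F c‖ ≤ C) →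
        Measurable h → (∀ w, ‖h w‖ ≤ C') →
        ∫ ω, h (√v * W 1 ω) * F (V ω) ∂P = ∫ w, h w * pathAvg lam θ F w ∂gaussianReal 0 v)
    (L : List (NNReal × C(Circle, ℂ))) (hL : listTime L < 1) (θ₁ : ℝ) :
    wrap v (pathAvg lam θ fun c => listVal L (extendPath (expPath c))) (θ₁ - θ) =
      transfer (fun d => rotAvg (gaussianReal 0 (d * v))) L
        (translate (Circle.exp θ₁) (heatKernel ((1 - listTime L : NNReal) * v))) (Circle.exp θ) := by
  obtain ⟨C, hC⟩ := exists_norm_listVal_le L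
  set F : C(unitInterval, ℝ) → ℂ := fun c => listVal L (extendPath (expPath c)) with hF
  have hFc : Continuous F := continuous_listVal_expPath L
  have hFb : ∀ c, ‖F c‖ ≤ C := fun c => hC _
  obtain ⟨e, he⟩ : ∃ e : NNReal, e = 1 - listTime L := ⟨_, rfl⟩
  have hTe : listTime L + e = 1 := by rw [he, add_tsub_cancel_of_le hL.le]
  have hev : (0 : ℝ) < e * v := by
    have h1 : 0 < e := by rw [he]; exact tsub_pos_of_lt hL
    have h2 : 0 < v := bot_lt_iff_ne_bot.2 hv
    exact_mod_cast mul_pos h1 h2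
  obtain ⟨B, hB⟩ := exists_transfer_eq (fun d : NNReal => rotAvg (gaussianReal 0 (d * v))) L
  have hcoef : ∀ k : ℤ, angleCoeff (wrap v (pathAvg lam θ F)) k =
      circleMonomial k (Circle.exp θ) * ((Real.exp (-((k : ℝ) ^ 2 * (e * v : ℝ) / 2)) : ℂ) *
        B (circleMonomial (-k)) (Circle.exp θ)) := by
    intro k
    rw [angleCoeff_wrap hv (continuous_pathAvg hFc hFb) (norm_pathAvg_le hFb),
      ← hVU hFc hFb (h := fun w => circleMonomial (-k) (Circle.exp w))
        (Continuous.measurable (by fun_prop)) (C' := 1) (fun y => (Circle.norm_coe _).le)]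
    -- The character of the endpoint is one more marked time. Since the path ends at `θ + √v W 1`,
    -- the starting angle splits off as the factor `circleMonomial k (Circle.exp θ)`.
    have h1 := integral_listVal_brownian (L ++ [(e, circleMonomial (-k))]) hW (v := v) θ
    rw [transfer_append, rotAvg_circleMonomial, ← hB, map_smul, ContinuousMap.smul_apply,
      smul_eq_mul] at h1
    have h2 := charFun_gaussianReal_int (e * v) (-k)
    push_cast at h2 h1
    rw [h2, neg_sq] at h1
    push_cast
    rw [← h1, ← integral_const_mul]
    refine integral_congr_ae ?_
    filter_upwards [hV] with ω hω
    rw [listVal_append, hTe]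
    have h3 : F (V ω) = listVal L fun t => Circle.exp (θ + √v * W t ω) := by
      refine listVal_congr_of_le L fun t ht => ?_
      have ht1 : (t : ℝ) ∈ Set.Icc (0 : ℝ) 1 := ⟨t.2, by exact_mod_cast (ht.trans hL.le)⟩
      simp only [extendPath, expPath, Set.projIcc_of_mem zero_le_one ht1, hω]
      rfl
    rw [h3, Circle.exp_add]
    simp only [circleMonomial_apply, mul_zpow, zpow_neg, Circle.coe_mul, Circle.coe_inv]
    have h4 := (Circle.exp θ ^ k).coe_ne_zero
    field_simp
  have hsum : Summable (angleCoeff (wrap v (pathAvg lam θ F))) := by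
    refine Summable.of_norm_bounded (g := fun k : ℤ =>
      ‖(Real.exp (-((k : ℝ) ^ 2 * (e * v : ℝ) / 2)) : ℂ)‖ * ‖B‖)
      ((summable_heat hev).norm.mul_right _) fun k => ?_
    rw [hcoef, norm_mul, norm_mul, circleMonomial_apply, Circle.norm_coe, one_mul]
    gcongr
    refine ((B (circleMonomial (-k))).norm_coe_le_norm _).trans ?_
    simpa [norm_circleMonomial] using B.le_opNorm (circleMonomial (-k))
  have hD := eq_circleSeries (continuous_wrap hv (continuous_pathAvg hFc hFb)
    (norm_pathAvg_le hFb)) periodic_wrap hsum (θ₁ - θ)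
  have h5 := ContinuousMap.hasSum_apply (hasSum_circleSeries hsum) (Circle.exp (θ₁ - θ))
  have h6 := ContinuousMap.hasSum_apply
    (B.hasSum (translate_heatKernel_hasSum hev (Circle.exp θ₁))) (Circle.exp θ)
  rw [hD, ← he, ← hB]
  refine h5.unique (h6.congr_fun fun k => ?_)
  rw [map_smul, ContinuousMap.smul_apply, ContinuousMap.smul_apply, hcoef]
  have h7 : circleMonomial k (Circle.exp θ₁) =
      circleMonomial k (Circle.exp θ) * circleMonomial k (Circle.exp (θ₁ - θ)) := by
    simp only [circleMonomial_apply]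
    rw [← Circle.coe_mul, ← mul_zpow, ← Circle.exp_add, add_sub_cancel]
  rw [h7]
  simp only [smul_eq_mul]
  ring

/-! ### The conditional law -/

/-- The conditioning event depends on the endpoint angle alone, so by disintegration and wrapping
the integral over the event is that of the weighted endpoint density over an arc. -/
lemma setIntegral_eq_arc (hv : v ≠ 0) (hm : AEMeasurable (W 1) P)
    (hV : ∀ᵐ ω ∂P, ∀ t, V ω t = θ + √v * W (unitInterval.toNNReal t) ω)
    (hVU : ∀ {F : C(unitInterval, ℝ) → ℂ} {h : ℝ → ℂ} {C C' : ℝ}, Continuous F → (∀ c, ‖F c‖ ≤ C) →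
        Measurable h → (∀ w, ‖h w‖ ≤ C') →
        ∫ ω, h (√v * W 1 ω) * F (V ω) ∂P = ∫ w, h w * pathAvg lam θ F w ∂gaussianReal 0 v)
    {X : Ω → SkorokhodSpace Circle} (hX : ∀ᵐ ω ∂P, X ω = expPath (V ω)) (θ₁ ε : ℝ)
    {f : SkorokhodSpace Circle → ℂ} (hf : Continuous f) {C : ℝ} (hC : ∀ x, ‖f x‖ ≤ C) :
    ∫ ω in {ω | dist (X ω 1) (Circle.exp θ₁) < ε}, f (X ω) ∂P =
      ∫ u in arcSet ε, wrap v (pathAvg lam θ fun c => f (expPath c)) (u + (θ₁ - θ)) := by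
  have hFc : Continuous fun c => f (expPath c) := hf.comp continuous_expPath
  have hU : AEMeasurable (fun ω => √v * W 1 ω) P := hm.const_mul _
  set S : Set ℝ := {u | dist (Circle.exp u) (Circle.exp (θ₁ - θ)) < ε} with hS
  have hSm : MeasurableSet S := (isOpen_dist_exp_lt _ ε).measurableSet
  have hA : {ω | dist (X ω 1) (Circle.exp θ₁) < ε} =ᵐ[P] (fun ω => √v * W 1 ω) ⁻¹' S := by
    filter_upwards [hV, hX] with ω h1 h2
    have h3 : X ω 1 = Circle.exp (θ + √v * W 1 ω) := by
      rw [h2]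
      have h4 := h1 1
      have h5 : unitInterval.toNNReal 1 = 1 := rfl
      rw [h5] at h4
      exact congrArg Circle.exp h4
    have h6 : dist (X ω 1) (Circle.exp θ₁) =
        dist (Circle.exp (√v * W 1 ω)) (Circle.exp (θ₁ - θ)) := by
      have h7 : Circle.exp θ₁ = Circle.exp θ * Circle.exp (θ₁ - θ) := by
        rw [← Circle.exp_add, add_sub_cancel]
      rw [h3, h7, Circle.exp_add, dist_circle, dist_circle, Circle.coe_mul, Circle.coe_mul,
        ← mul_sub, norm_mul, Circle.norm_coe, one_mul]
    exact propext (by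
      change dist (X ω 1) (Circle.exp θ₁) < ε ↔ _
      rw [h6]
      rfl)
  have hh := hVU hFc (fun c => hC _) (h := S.indicator fun _ => 1) (measurable_const.indicator hSm)
    (C' := 1) (fun w => by
      rw [Set.indicator]
      split_ifs <;> simp)
  rw [← setIntegral_indicator_arc periodic_wrap,
    ← integral_gaussianReal_eq_wrap hv (continuous_pathAvg hFc fun c => hC _)
      (norm_pathAvg_le fun c => hC _) (measurable_const.indicator hSm) (C' := 1), ← hh,
    Measure.restrict_congr_set hA, ← integral_indicator₀ (hU.nullMeasurable hSm)]
  · refine integral_congr_ae ?_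
    filter_upwards [hX] with ω h2
    by_cases h : √v * W 1 ω ∈ S
    · rw [Set.indicator_of_mem (by exact h), Set.indicator_of_mem h, h2, one_mul]
    · rw [Set.indicator_of_notMem (by exact h), Set.indicator_of_notMem h, zero_mul]
  · intro y
    rw [Set.indicator]
    split_ifs <;> simp
  · intro u
    simp only [hS, Set.indicator, Set.mem_ofPred_eq, Circle.periodic_exp u]

end pinned

/-- The length of the arc cancels in the ratio of averages, and both densities are continuous with
nonzero denominator. -/
lemma tendsto_arc_ratio {D D₁ : ℝ → ℂ} (hD : Continuous D) (hD₁ : Continuous D₁) {u : ℝ}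
    (h0 : D₁ u ≠ 0) :
    Tendsto (fun ε => (∫ x in arcSet ε, D (x + u)) / ∫ x in arcSet ε, D₁ (x + u)) (𝓝[>] 0)
      (𝓝 (D u / D₁ u)) := by
  have h := (tendsto_arcSet_average (hD.comp (continuous_add_const u))).div
    (tendsto_arcSet_average (hD₁.comp (continuous_add_const u))) (by simpa using h0)
  simp only [Function.comp_apply, zero_add] at h
  refine h.congr' ?_
  filter_upwards [self_mem_nhdsWithin] with ε hε
  have h1 : volume.real (arcSet ε) ≠ 0 :=
    ENNReal.toReal_ne_zero.2 ⟨volume_arcSet_ne_zero hε, volume_arcSet_ne_top ε⟩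
  rw [Pi.div_apply, setAverage_eq, setAverage_eq, Complex.real_smul, Complex.real_smul,
    mul_div_mul_left]
  exact_mod_cast inv_ne_zero h1

/-- The limit law is exhibited as the image of a law `ρ` on continuous angle paths, so that its
endpoint and its finite-dimensional distributions can be evaluated directly. -/
theorem exists_conditionalLaw {Ω : Type*} [MeasurableSpace Ω] {P : Measure Ω}
    [IsProbabilityMeasure P] {W : NNReal → Ω → ℝ} (hW : IsBrownianReal W P) {v : NNReal}
    (hv : v ≠ 0) (θ θ₁ : ℝ) {X : Ω → SkorokhodSpace Circle}
    (hX : ∀ᵐ ω ∂P, ∀ t, X ω t = Circle.exp (θ + √v * W (unitInterval.toNNReal t) ω)) :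
    ∃ (ρ : Measure C(unitInterval, ℝ)) (hρ : IsProbabilityMeasure (ρ.map expPath)),
      IsProbabilityMeasure ρ ∧
      IsConditionalLaw P X (fun ω => X ω 1) (Circle.exp θ₁) ⟨ρ.map expPath, hρ⟩ ∧
      (∀ᵐ c ∂ρ, expPath c 1 = Circle.exp θ₁) ∧
      ∀ L : List (NNReal × C(Circle, ℂ)), listTime L < 1 →
        ∫ c, listVal L (extendPath (expPath c)) ∂ρ =
          transfer (fun d => rotAvg (gaussianReal 0 (d * v))) L
            (translate (Circle.exp θ₁) (heatKernel ((1 - listTime L : NNReal) * v)))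
              (Circle.exp θ) /
            translate (Circle.exp θ₁) (heatKernel v) (Circle.exp θ) := by
  obtain ⟨lam, V, hlam, hlam1, hVm, hV, hVU⟩ := exists_bridge hW θ v
  have hp := hW.toIsPreBrownianReal
  have hXV : ∀ᵐ ω ∂P, X ω = expPath (V ω) := by
    filter_upwards [hX, hV] with ω h1 h2
    refine Subtype.ext (funext fun t => ?_)
    rw [h1]
    exact congrArg Circle.exp (h2 t).symm
  have hprob := isProbabilityMeasure_pinnedLaw (lam := lam) (θ := θ) hv (θ₁ - θ)
  have hem : Measurable expPath := continuous_expPath.measurable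
  have hden : wrap v (fun _ => 1) (θ₁ - θ) =
      translate (Circle.exp θ₁) (heatKernel v) (Circle.exp θ) := by
    have h := wrap_pathAvg_listVal hp hv hV hVU [] (by simp [listTime]) θ₁
    simpa [listVal, transfer, listTime, pathAvg_one] using h
  have hwc : ∀ {F : C(unitInterval, ℝ) → ℂ} {C : ℝ}, Continuous F → (∀ c, ‖F c‖ ≤ C) →
      Continuous (wrap v (pathAvg lam θ F)) := fun hF hC =>
    continuous_wrap hv (continuous_pathAvg hF hC) (norm_pathAvg_le hC)
  have hw1 : Continuous (wrap v fun _ => 1) :=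
    continuous_wrap hv continuous_const (C := 1) (fun _ => by simp)
  have hw0 : wrap v (fun _ => 1) (θ₁ - θ) ≠ 0 := by
    rw [← heatKernel_exp hv]
    exact heatKernel_ne_zero hv _
  set A : ℝ → Set Ω := fun ε => {ω | dist (X ω 1) (Circle.exp θ₁) < ε} with hA
  have hPA : ∀ ε, ((P.real (A ε) : ℝ) : ℂ) =
      ∫ u in arcSet ε, wrap v (fun _ => 1) (u + (θ₁ - θ)) := by
    intro ε
    have h := setIntegral_eq_arc hv (hp.aemeasurable 1) hV hVU hXV θ₁ ε (f := fun _ => 1)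
      continuous_const (C := 1) (fun _ => by simp)
    rw [pathAvg_one] at h
    rw [← h]
    simp [hA]
  refine ⟨pinnedLaw lam θ v (θ₁ - θ), Measure.isProbabilityMeasure_map hem.aemeasurable, hprob,
    ⟨?_, ?_, ?_⟩, ae_pinnedLaw_exp_one hlam1 θ₁, ?_⟩
  · exact (hem.comp_aemeasurable hVm).congr (hXV.mono fun ω h => h.symm)
  -- If the event had probability zero, so would those for all smaller arcs; but the averages of the
  -- wrapped density over shrinking arcs have a nonzero limit.
  · have h1 := tendsto_arcSet_average (hw1.comp (continuous_add_const (θ₁ - θ)))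
    simp only [Function.comp_apply, zero_add] at h1
    intro ε hε h0
    obtain ⟨ε', h2, h3⟩ := ((h1.eventually_ne hw0).and (Ioo_mem_nhdsGT hε)).exists
    refine h2 ?_
    have h4 : P (A ε') = 0 := measure_mono_null (fun ω hω => lt_trans hω h3.2) h0
    have h5 : P.real (A ε') = 0 := by simp [measureReal_def, h4]
    rw [setAverage_eq, ← hPA, h5]
    simp
  · intro f
    have hfc : Continuous fun x => (f x : ℂ) := Complex.continuous_ofReal.comp f.continuous
    have hfb : ∀ x, ‖(f x : ℂ)‖ ≤ ‖f‖ := fun x => by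
      rw [Complex.norm_real]
      exact f.norm_coe_le_norm x
    have h1 := tendsto_arc_ratio (hwc (hfc.comp continuous_expPath) fun c => hfb _) hw1 hw0
    have h2 := integral_pinnedLaw (lam := lam) (θ := θ) hv (hfc.comp continuous_expPath)
      (fun c => hfb _) (θ₁ - θ)
    rw [← h2] at h1
    have h3 : ∫ c, ((fun x => (f x : ℂ)) ∘ expPath) c ∂pinnedLaw lam θ v (θ₁ - θ) =
        ((∫ x, f x ∂(pinnedLaw lam θ v (θ₁ - θ)).map expPath : ℝ) : ℂ) := by
      rw [integral_map hem.aemeasurable f.continuous.aestronglyMeasurable]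
      exact integral_ofReal
    rw [h3] at h1
    have h4 := (Complex.continuous_re.tendsto _).comp h1
    rw [Complex.ofReal_re] at h4
    refine h4.congr fun ε => ?_
    have h5 := setIntegral_eq_arc hv (hp.aemeasurable 1) hV hVU hXV θ₁ ε hfc hfb
    have h6 : ∫ ω in A ε, (f (X ω) : ℂ) ∂P = ((∫ ω in A ε, f (X ω) ∂P : ℝ) : ℂ) := integral_ofReal
    have h7 : ((∫ ω, f (X ω) ∂(P[|A ε]) : ℝ) : ℂ) =
        (∫ x in arcSet ε, wrap v (pathAvg lam θ ((fun x => (f x : ℂ)) ∘ expPath)) (x + (θ₁ - θ))) /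
        ∫ x in arcSet ε, wrap v (fun _ => 1) (x + (θ₁ - θ)) := by
      rw [ProbabilityTheory.cond, integral_smul_measure, ← hPA]
      refine Eq.trans ?_ (congrArg (· / ((P.real (A ε) : ℝ) : ℂ)) (h6.symm.trans h5))
      rw [ENNReal.toReal_inv, smul_eq_mul, Complex.ofReal_mul, Complex.ofReal_inv,
        div_eq_inv_mul]
      rfl
    rw [Function.comp_apply, ← h7, Complex.ofReal_re]
  · intro L hL
    obtain ⟨C, hC⟩ := exists_norm_listVal_le L
    rw [integral_pinnedLaw hv (continuous_listVal_expPath L) (fun c => hC _),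
      wrap_pathAvg_listVal hp hv hV hVU L hL, hden]

/-! ### Convergence of the finite-dimensional distributions -/

/-- The list of evaluations at the times with given increments. -/
def evalList {T : Type*} (g : ℕ → T) (H : ℕ → C(Circle, ℂ)) (m : ℕ) : List (T × C(Circle, ℂ)) :=
  (List.range m).map fun i => (g i, H i)

lemma listTime_evalList {T : Type*} [AddCommMonoid T] (g : ℕ → T) (H : ℕ → C(Circle, ℂ)) (m : ℕ) :
    listTime (evalList g H m) = ∑ i ∈ Finset.range m, g i := by
  induction m with
  | zero => simp [evalList, listTime]
  | succ m ih =>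
    rw [Finset.sum_range_succ, ← ih]
    simp [evalList, listTime, List.range_succ]

lemma listVal_evalList {T : Type*} [AddCommMonoid T] (g : ℕ → T) (H : ℕ → C(Circle, ℂ)) (m : ℕ)
    (s : T → Circle) :
    listVal (evalList g H m) s =
      ∏ i ∈ Finset.range m, H i (s (∑ j ∈ Finset.range (i + 1), g j)) := by
  induction m with
  | zero => simp [evalList, listVal]
  | succ m ih =>
    have h : evalList g H (m + 1) = evalList g H m ++ [(g m, H m)] := by
      simp [evalList, List.range_succ]
    rw [h, listVal_append, ih, listTime_evalList, Finset.prod_range_succ, Finset.sum_range_succ]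

/-- The increments of a sequence of times. -/
def gaps {T : Type*} [Sub T] (k : ℕ → T) (i : ℕ) : T := k i - k (i - 1)

/-- Truncated subtraction makes the gap at `0` vanish, so `i + 1` gaps telescope to `k i` exactly
when `k 0 = 0`. -/
lemma sum_gaps {T : Type*} [AddCommMonoid T] [PartialOrder T] [Sub T] [OrderedSub T]
    [CanonicallyOrderedAdd T] {k : ℕ → T} (hk : Monotone k) (h0 : k 0 = 0) (i : ℕ) :
    ∑ j ∈ Finset.range (i + 1), gaps k j = k i := by
  induction i with
  | zero => simp [gaps, h0]
  | succ i ih =>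
    rw [Finset.sum_range_succ, ih, gaps, Nat.add_sub_cancel, add_tsub_cancel_of_le (hk i.le_succ)]

lemma monotone_nat_times (n m : ℕ) : Monotone fun i => n * i / m := fun _ _ h =>
  Nat.div_le_div_right (Nat.mul_le_mul_left n h)

lemma monotone_real_times (m : ℕ) : Monotone fun i : ℕ => (i : NNReal) / m := fun _ _ h =>
  div_le_div_of_nonneg_right (Nat.cast_le.2 h) zero_le

lemma tendsto_nat_times {m : ℕ} (hm : 0 < m) (i : ℕ) :
    Tendsto (fun n : ℕ => ((n * i / m : ℕ) : ℝ) / n) atTop (𝓝 (i / m)) := by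
  have hm' : (0 : ℝ) < m := Nat.cast_pos.2 hm
  have h1 : Tendsto (fun n : ℕ => (i : ℝ) / m - 1 / n) atTop (𝓝 (i / m)) := by
    have := (tendsto_one_div_atTop_nhds_zero_nat (𝕜 := ℝ)).const_sub ((i : ℝ) / m)
    rwa [sub_zero] at this
  refine tendsto_of_tendsto_of_tendsto_of_le_of_le' h1 tendsto_const_nhds ?_ ?_
  · filter_upwards [eventually_gt_atTop 0] with n hn
    have hn' : (0 : ℝ) < n := Nat.cast_pos.2 hn
    have h2 := Nat.lt_div_mul_add hm (a := n * i)
    have h3 : (n * i : ℝ) < (n * i / m : ℕ) * m + m := by exact_mod_cast h2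
    rw [sub_le_iff_le_add, ← add_div, div_le_div_iff₀ hm' hn']
    linarith
  · filter_upwards [eventually_gt_atTop 0] with n hn
    have hn' : (0 : ℝ) < n := Nat.cast_pos.2 hn
    have h2 : ((n * i / m : ℕ) : ℝ) * m ≤ n * i := by exact_mod_cast Nat.div_mul_le_self (n * i) m
    rw [div_le_div_iff₀ hn' hm']
    linarith

lemma tendsto_gaps {m : ℕ} (hm : 0 < m) (i : ℕ) :
    Tendsto (fun n : ℕ => ((gaps (fun i => n * i / m) i : ℕ) : ℝ) / n) atTop
      (𝓝 ((gaps (fun i : ℕ => (i : NNReal) / m) i : NNReal) : ℝ)) := by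
  have h := (tendsto_nat_times hm i).sub (tendsto_nat_times hm (i - 1))
  rw [gaps, NNReal.coe_sub (monotone_real_times m (Nat.sub_le i 1))]
  simp only [NNReal.coe_div, NNReal.coe_natCast]
  refine h.congr fun n => ?_
  rw [gaps, Nat.cast_sub (monotone_nat_times n m (Nat.sub_le i 1)), sub_div]

section scaling
variable {b : ℝ} {β : ℕ → ℝ}

/-- Induction from the innermost factor: `tendsto_rotAvg` accepts an argument that itself varies
with `n`, and the limiting symbols `exp (-k² t / (2b))` are those of a Gaussian of variance `t / b`.
-/
lemma tendsto_transfer (hb : 0 < b) (hβ : Tendsto (fun n : ℕ => β n / n) atTop (𝓝 b))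
    {v : NNReal} (hv : (v : ℝ) = 1 / b) {g : ℕ → ℕ → ℕ} {g₀ : ℕ → NNReal}
    (hg : ∀ i, Tendsto (fun n : ℕ => (g n i : ℝ) / n) atTop (𝓝 (g₀ i))) (H : ℕ → C(Circle, ℂ))
    (l : List ℕ) {f : ℕ → C(Circle, ℂ)} {f₀ : C(Circle, ℂ)} (hf : Tendsto f atTop (𝓝 f₀)) :
    Tendsto (fun n => transfer (fun d => rotAvg (convPow (stepLaw (β n)) d))
      (l.map fun i => (g n i, H i)) (f n)) atTop
      (𝓝 (transfer (fun d => rotAvg (gaussianReal 0 (d * v))) (l.map fun i => (g₀ i, H i)) f₀)) := by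
  induction l with
  | nil => exact hf
  | cons i l ih =>
    refine tendsto_rotAvg (fun k => ?_) (ih.const_mul (H i))
    simp only [charFun_convPow, charFun_stepLaw]
    rw [charFun_gaussianReal_int]
    have h := tendsto_stepCoeff_pow (tendsto_atTop_of_ratio hb hβ) (tendsto_ratio hb hβ (hg i)) k
    have h2 := (Complex.continuous_ofReal.tendsto _).comp h
    rw [NNReal.coe_mul, hv, mul_one_div]
    refine h2.congr fun n => ?_
    simp

/-- The terminal time is left out: the transfer formulas need a positive stretch after the last
marked time, carried by the kernel. -/
lemma tendsto_integral_prod (hb : 0 < b) (hβ : Tendsto (fun n : ℕ => β n / n) atTop (𝓝 b))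
    {v : NNReal} (hv : (v : ℝ) = 1 / b) (θ₀ θ₁ : ℝ) {ρ : Measure C(unitInterval, ℝ)}
    (hρ : ∀ L : List (NNReal × C(Circle, ℂ)), listTime L < 1 →
        ∫ c, listVal L (extendPath (expPath c)) ∂ρ =
          transfer (fun d => rotAvg (gaussianReal 0 (d * v))) L
            (translate (Circle.exp θ₁) (heatKernel ((1 - listTime L : NNReal) * v)))
              (Circle.exp θ₀) /
            translate (Circle.exp θ₁) (heatKernel v) (Circle.exp θ₀))
    (m : ℕ) (H : ℕ → C(Circle, ℂ)) :
    Tendsto (fun n => ∫ θ, ∏ i ∈ Finset.range (m + 1), H i (spins n θ (n * i / (m + 1)))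
        ∂gibbsMeasure n (β n) θ₀ θ₁) atTop
      (𝓝 (∫ c, ∏ i ∈ Finset.range (m + 1),
        H i (extendPath (expPath c) ((i : NNReal) / (m + 1 : ℕ))) ∂ρ)) := by
  have hm : 0 < m + 1 := m.succ_pos
  have hm' : ((m + 1 : ℕ) : NNReal) ≠ 0 := Nat.cast_ne_zero.2 hm.ne'
  set gR : ℕ → NNReal := gaps fun i : ℕ => (i : NNReal) / (m + 1 : ℕ) with hgR
  have sR : ∀ i, ∑ j ∈ Finset.range (i + 1), gR j = (i : NNReal) / (m + 1 : ℕ) :=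
    sum_gaps (monotone_real_times (m + 1)) (by simp)
  have sN : ∀ n i, ∑ j ∈ Finset.range (i + 1), gaps (fun i => n * i / (m + 1)) j =
      n * i / (m + 1) := fun n => sum_gaps (monotone_nat_times n (m + 1)) (by simp)
  have hT : listTime (evalList gR H (m + 1)) = (m : NNReal) / (m + 1 : ℕ) := by
    rw [listTime_evalList, sR]
  have hT1 : listTime (evalList gR H (m + 1)) < 1 := by
    rw [hT, div_lt_one (by positivity)]
    exact_mod_cast m.lt_succ_self
  have h1 := hρ (evalList gR H (m + 1)) hT1
  simp only [listVal_evalList, sR] at h1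
  rw [h1]
  have hl : Tendsto (fun n : ℕ => ((n - n * m / (m + 1) : ℕ) : ℝ) / n) atTop
      (𝓝 (1 - (m : ℝ) / (m + 1 : ℕ))) := by
    refine ((tendsto_nat_times hm m).const_sub 1).congr' ?_
    filter_upwards [eventually_gt_atTop 0] with n hn
    have hn' : (n : ℝ) ≠ 0 := by exact_mod_cast hn.ne'
    rw [Nat.cast_sub (Nat.div_le_of_le_mul (by nlinarith)), sub_div, div_self hn']
  have hl0 : 0 < 1 - (m : ℝ) / (m + 1 : ℕ) := by
    rw [sub_pos, div_lt_one (by positivity)]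
    exact_mod_cast m.lt_succ_self
  have h2 := tendsto_transfer hb hβ hv (g := fun n => gaps fun i => n * i / (m + 1)) (g₀ := gR)
    (fun i => tendsto_gaps hm i) H (List.range (m + 1))
    (tendsto_translate (Circle.exp θ₁) (tendsto_chainKernel_of_ratio hb hβ hl0 hl))
  have h3 := ((continuous_eval_const (F := C(Circle, ℂ)) (Circle.exp θ₀)).tendsto _).comp h2
  have h4 := ((continuous_eval_const (F := C(Circle, ℂ)) (Circle.exp θ₀)).tendsto _).comp
    (tendsto_translate (Circle.exp θ₁) (tendsto_chainKernel_self hb hβ))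
  have h5 := h3.div h4 (heatKernel_ne_zero_of_pos (one_div_pos.2 hb) _)
  have e1 : ((1 - listTime (evalList gR H (m + 1)) : NNReal) * v : ℝ) =
      (1 - (m : ℝ) / (m + 1 : ℕ)) / b := by
    rw [NNReal.coe_sub hT1.le, hT, hv]
    push_cast
    ring
  rw [e1, hv]
  refine h5.congr' ?_
  filter_upwards [eventually_gt_atTop 0] with n hn
  have hLn : listTime (evalList (gaps fun i => n * i / (m + 1)) H (m + 1)) = n * m / (m + 1) := by
    rw [listTime_evalList, sN]
  have h6 := integral_listVal_gibbsMeasure (N := n) (β n) θ₀ θ₁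
    (evalList (gaps fun i => n * i / (m + 1)) H (m + 1)) (by
      rw [hLn, Nat.div_lt_iff_lt_mul hm]
      nlinarith)
  simp only [listVal_evalList, sN] at h6
  rw [h6, hLn]
  rfl

end scaling

lemma ae_spins_last (n : ℕ) (β θ₀ θ₁ : ℝ) (hn : 0 < n) :
    ∀ᵐ θ ∂gibbsMeasure n β θ₀ θ₁, spins n θ n = Circle.exp θ₁ := by
  refine (withDensity_absolutelyContinuous _ _).ae_le ?_
  have h1 : siteMeasure n θ₀ θ₁ (Fin.last n) = Measure.dirac θ₁ := by
    rw [siteMeasure, if_neg (fun h => hn.ne' (congrArg Fin.val h)), if_pos rfl]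
  have h2 : ∀ᵐ x ∂siteMeasure n θ₀ θ₁ (Fin.last n), x = θ₁ := by
    rw [h1, ae_dirac_eq]
    rfl
  filter_upwards [Measure.tendsto_eval_ae_ae.eventually h2] with θ hθ
  rw [spins, dif_pos n.lt_succ_self, ← hθ]
  rfl

/-! ### Reduction of continuous functions of several spins to products -/

/-- Integration against the law of a continuous random variable, as a functional. -/
def lawFunctional {S X : Type*} [TopologicalSpace S] [MeasurableSpace S] [OpensMeasurableSpace S]
    [TopologicalSpace X] [CompactSpace X] (μ : Measure S) [IsProbabilityMeasure μ] (Y : C(S, X)) :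
    C(X, ℂ) →L[ℂ] ℂ :=
  have hi : ∀ f : C(X, ℂ), Integrable (fun ω => f (Y ω)) μ := fun f =>
    Integrable.of_bound (f.continuous.comp Y.continuous).aestronglyMeasurable ‖f‖
      (ae_of_all _ fun _ => f.norm_coe_le_norm _)
  LinearMap.mkContinuous
    { toFun := fun f => ∫ ω, f (Y ω) ∂μ
      map_add' := fun f g => integral_add (hi f) (hi g)
      map_smul' := fun a f => integral_const_mul a _ } 1 (fun f => by
      rw [one_mul]
      exact (norm_integral_le_of_norm_le_const (C := ‖f‖)
        (ae_of_all _ fun u => f.norm_coe_le_norm _)).trans (by simp))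

lemma lawFunctional_apply {S X : Type*} [TopologicalSpace S] [MeasurableSpace S]
    [OpensMeasurableSpace S] [TopologicalSpace X] [CompactSpace X] (μ : Measure S)
    [IsProbabilityMeasure μ] (Y : C(S, X)) (f : C(X, ℂ)) :
    lawFunctional μ Y f = ∫ ω, f (Y ω) ∂μ := rfl

lemma norm_lawFunctional_le {S X : Type*} [TopologicalSpace S] [MeasurableSpace S]
    [OpensMeasurableSpace S] [TopologicalSpace X] [CompactSpace X] (μ : Measure S)
    [IsProbabilityMeasure μ] (Y : C(S, X)) (f : C(X, ℂ)) : ‖lawFunctional μ Y f‖ ≤ ‖f‖ := by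
  exact (norm_integral_le_of_norm_le_const (ae_of_all _ fun _ => f.norm_coe_le_norm _)).trans
    (by simp)

/-- The coordinate functions on a finite power of the circle. -/
def coordFun {m : ℕ} (j : Fin m) : C(Fin m → Circle, ℂ) := ⟨fun z => (z j : ℂ), by fun_prop⟩

lemma coordFun_separates {m : ℕ} (x y : Fin m → Circle) (h : x ≠ y) :
    ∃ f ∈ Set.range (coordFun (m := m)), f x ≠ f y := by
  obtain ⟨j, hj⟩ := Function.ne_iff.1 h
  exact ⟨_, ⟨j, rfl⟩, fun h' => hj (Circle.ext h')⟩

/-- Products of functions of single coordinates are stable under multiplication, so the monoid in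
Stone–Weierstrass contains nothing beyond the functions already covered by `tendsto_integral_prod`.
-/
lemma exists_prod_of_mem_closure {m : ℕ} {f : C(Fin m → Circle, ℂ)}
    (hf : f ∈ Submonoid.closure (Set.range coordFun ∪ star (Set.range (coordFun (m := m))))) :
    ∃ H : ℕ → C(Circle, ℂ), ∀ z, f z = ∏ j : Fin m, H j (z j) := by
  induction hf using Submonoid.closure_induction with
  | one => exact ⟨fun _ => 1, fun z => by simp⟩
  | mul f g _ _ ihf ihg =>
    obtain ⟨H, hH⟩ := ihf
    obtain ⟨K, hK⟩ := ihg
    exact ⟨fun j => H j * K j, fun z => by simp [hH, hK, Finset.prod_mul_distrib]⟩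
  | mem f hf =>
    have key : ∀ (j : Fin m) (h : C(Circle, ℂ)), (∀ z, f z = h (z j)) →
        ∃ H : ℕ → C(Circle, ℂ), ∀ z, f z = ∏ j : Fin m, H j (z j) := by
      intro j h hfh
      refine ⟨fun i => if i = j then h else 1, fun z => ?_⟩
      rw [Finset.prod_eq_single j]
      · simp [hfh]
      · intro i _ hij
        simp [if_neg (fun h' => hij (Fin.ext h'))]
      · simp
    rcases hf with ⟨j, rfl⟩ | ⟨j, hj⟩
    · exact key j (circleMonomial 1) fun z => by simp [coordFun]
    · refine key j (circleMonomial (-1)) fun z => ?_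
      have h1 : f z = star (coordFun j z) := by
        rw [hj]
        simp
      rw [h1]
      simp [coordFun, ← Circle.coe_inv_eq_conj]

/-! ### Convergence of the chain to the pinned path -/

lemma lipschitzWith_stepPath {E : Type*} [PseudoEMetricSpace E] (m : ℕ) :
    LipschitzWith 1 (stepPath m : (Fin (m + 1) → E) → SkorokhodSpace E) := fun g g' => by
  rw [ENNReal.coe_one, one_mul]
  exact (edist_le_iSup _ _).trans (iSup_le fun t => edist_le_pi_edist g g' _)

lemma continuous_spinPath (n : ℕ) : Continuous (spinPath n) :=
  (lipschitzWith_stepPath n).continuous.comp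
    (by fun_prop : Continuous fun (θ : Fin (n + 1) → ℝ) j => Circle.exp (θ j))

lemma continuous_spins_times (n m : ℕ) :
    Continuous fun θ (j : Fin (m + 1)) => spins n θ (n * j / m) :=
  continuous_pi fun j => (continuous_pi_iff.1 (continuous_spins n)) (n * j / m)

lemma continuous_extendPath (m : ℕ) : Continuous fun (c : C(unitInterval, ℝ)) (j : Fin (m + 1)) =>
    extendPath (expPath c) (((j : ℕ) : NNReal) / m) :=
  continuous_pi fun _ => Circle.exp.continuous.comp
    (continuous_eval_const (F := C(unitInterval, ℝ)) _)

lemma tendsto_integral_stepPath {b : ℝ} {β : ℕ → ℝ} (hb : 0 < b)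
    (hβ : Tendsto (fun n : ℕ => β n / n) atTop (𝓝 b)) {v : NNReal} (hv : (v : ℝ) = 1 / b)
    (θ₀ θ₁ : ℝ) {ρ : Measure C(unitInterval, ℝ)} [IsProbabilityMeasure ρ]
    (hρ1 : ∀ᵐ c ∂ρ, expPath c 1 = Circle.exp θ₁)
    (hρ : ∀ L : List (NNReal × C(Circle, ℂ)), listTime L < 1 →
        ∫ c, listVal L (extendPath (expPath c)) ∂ρ =
          transfer (fun d => rotAvg (gaussianReal 0 (d * v))) L
            (translate (Circle.exp θ₁) (heatKernel ((1 - listTime L : NNReal) * v)))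
              (Circle.exp θ₀) /
            translate (Circle.exp θ₁) (heatKernel v) (Circle.exp θ₀))
    {m : ℕ} (hm : 0 < m) (f : C(Fin (m + 1) → Circle, ℂ)) :
    Tendsto (fun n => ∫ θ, f (fun j => spins n θ (n * j / m)) ∂gibbsMeasure n (β n) θ₀ θ₁) atTop
      (𝓝 (∫ c, f (fun j => extendPath (expPath c) (((j : ℕ) : NNReal) / m)) ∂ρ)) := by
  let Y : ∀ n, C(Fin (n + 1) → ℝ, Fin (m + 1) → Circle) := fun n =>
    ⟨fun θ j => spins n θ (n * j / m), continuous_spins_times n m⟩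
  let Y₀ : C(C(unitInterval, ℝ), Fin (m + 1) → Circle) :=
    ⟨fun c j => extendPath (expPath c) (((j : ℕ) : NNReal) / m), continuous_extendPath m⟩
  have hM : convergenceSubmodule (fun n => lawFunctional (gibbsMeasure n (β n) θ₀ θ₁) (Y n))
      (lawFunctional ρ Y₀) = ⊤ := by
    refine submodule_eq_top_of_separates _ coordFun_separates _
      (isClosed_convergenceSubmodule (fun n => norm_lawFunctional_le _ _)
        (norm_lawFunctional_le _ _)) fun f hf => ?_
    obtain ⟨H, hH⟩ := exists_prod_of_mem_closure hf
    change Tendsto _ _ _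
    simp only [lawFunctional_apply, hH, Fin.prod_univ_castSucc]
    obtain ⟨m, rfl⟩ := Nat.exists_eq_succ_of_ne_zero hm.ne'
    -- The spin at time `1` equals `exp (i θ₁)` almost surely on both sides, so its factor is a
    -- constant.
    have h := (tendsto_integral_prod hb hβ hv θ₀ θ₁ hρ m H).mul_const (H (m + 1) (Circle.exp θ₁))
    have e : (∫ c, ∏ i ∈ Finset.range (m + 1),
        H i (extendPath (expPath c) ((i : NNReal) / (m + 1 : ℕ))) ∂ρ) *
          H (m + 1) (Circle.exp θ₁) =
        ∫ c, (∏ i : Fin (m + 1), H i.castSucc (Y₀ c i.castSucc)) *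
          H (Fin.last (m + 1)) (Y₀ c (Fin.last (m + 1))) ∂ρ := by
      rw [← integral_mul_const]
      refine integral_congr_ae ?_
      filter_upwards [hρ1] with c hc
      rw [Finset.prod_range]
      have h1 : Y₀ c (Fin.last (m + 1)) = Circle.exp θ₁ := by
        rw [← hc]
        simp only [Y₀, ContinuousMap.coe_mk, extendPath, Fin.val_last, Nat.succ_eq_add_one]
        rw [div_self (Nat.cast_ne_zero.2 m.succ_ne_zero), NNReal.coe_one, Set.projIcc_right]
        rfl
      rw [h1]
      rfl
    rw [e] at h
    refine h.congr' ?_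
    filter_upwards [eventually_gt_atTop 0] with n hn
    rw [← integral_mul_const]
    refine integral_congr_ae ?_
    filter_upwards [ae_spins_last n (β n) θ₀ θ₁ hn] with θ hθ
    rw [Finset.prod_range]
    have h1 : Y n θ (Fin.last (m + 1)) = Circle.exp θ₁ := by
      simp only [Y, ContinuousMap.coe_mk, Fin.val_last, Nat.succ_eq_add_one]
      rw [Nat.mul_div_cancel _ m.succ_pos, hθ]
    rw [h1]
    rfl
  have hf : f ∈ convergenceSubmodule (fun n => lawFunctional (gibbsMeasure n (β n) θ₀ θ₁) (Y n))
      (lawFunctional ρ Y₀) := by rw [hM]; trivial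
  exact hf

/-- Each limit path is uniformly continuous, so its discretisations converge to it; the diameter
bound `2` gives domination. -/
lemma tendsto_lintegral_edist_expPath (ρ : Measure C(unitInterval, ℝ)) [IsProbabilityMeasure ρ] :
    Tendsto (fun m : ℕ => ∫⁻ c, edist (expPath c)
      (stepPath m fun j => extendPath (expPath c) (((j : ℕ) : NNReal) / m)) ∂ρ) atTop (𝓝 0) := by
  rw [← lintegral_zero (μ := ρ)]
  refine tendsto_lintegral_of_dominated_convergence (fun _ => 2) (fun m => ?_) (fun m => ?_) ?_ ?_
  · exact (continuous_expPath.edist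
      ((lipschitzWith_stepPath m).continuous.comp (continuous_extendPath m))).measurable
  · exact ae_of_all _ fun c => (edist_le_iSup _ _).trans (iSup_le fun t => edist_circle_le _ _)
  · simp
  · refine ae_of_all _ fun c => ?_
    have huc : UniformContinuous fun t => Circle.exp (c t) :=
      CompactSpace.uniformContinuous_of_continuous (by fun_prop)
    rw [ENNReal.tendsto_nhds_zero]
    intro ε hε
    obtain ⟨δ, hδ, h⟩ := EMetric.uniformContinuous_iff.1 huc ε hε
    have h1 : ∀ᶠ m : ℕ in atTop, ENNReal.ofReal (1 / m) < δ := by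
      have h2 := (ENNReal.continuous_ofReal.tendsto 0).comp
        (tendsto_one_div_atTop_nhds_zero_nat (𝕜 := ℝ))
      rw [ENNReal.ofReal_zero] at h2
      exact h2.eventually (gt_mem_nhds hδ)
    filter_upwards [h1, eventually_gt_atTop 0] with m hm1 hm
    have hm' : (0 : ℝ) < m := Nat.cast_pos.2 hm
    refine (edist_le_iSup _ _).trans (iSup_le fun t => (h ?_).le)
    refine lt_of_le_of_lt ?_ hm1
    have h3 : (⌊(m : ℝ) * t⌋₊ : ℝ) ≤ m * t := Nat.floor_le (mul_nonneg hm'.le t.2.1)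
    have h4 : (m * t : ℝ) < ⌊(m : ℝ) * t⌋₊ + 1 := Nat.lt_floor_add_one _
    have h5 : (⌊(m : ℝ) * t⌋₊ : ℝ) / m ≤ t := by
      rw [div_le_iff₀ hm']
      linarith
    have h6 : (t : ℝ) ≤ ⌊(m : ℝ) * t⌋₊ / m + 1 / m := by
      rw [← add_div, le_div_iff₀ hm']
      linarith
    have h7 : ((((⌊(m : ℝ) * t⌋₊ : NNReal) / m : NNReal) : ℝ)) ∈ Set.Icc (0 : ℝ) 1 :=
      ⟨NNReal.coe_nonneg _, by push_cast; exact h5.trans t.2.2⟩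
    rw [Set.projIcc_of_mem zero_le_one h7, edist_dist, Subtype.dist_eq, Real.dist_eq]
    refine ENNReal.ofReal_le_ofReal ?_
    push_cast
    rw [abs_of_nonneg (sub_nonneg.2 h5)]
    linarith

lemma edist_integral_le {S E : Type*} [MeasurableSpace S] {μ : Measure S} [IsProbabilityMeasure μ]
    [PseudoEMetricSpace E] [MeasurableSpace E] [OpensMeasurableSpace E] {f : E → ℝ} {K : NNReal}
    (hK : LipschitzWith K f) {C : ℝ} (hC : ∀ x, ‖f x‖ ≤ C) {A B : S → E} (hA : Measurable A)
    (hB : Measurable B) :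
    edist (∫ ω, f (A ω) ∂μ) (∫ ω, f (B ω) ∂μ) ≤ K * ∫⁻ ω, edist (A ω) (B ω) ∂μ := by
  have hi : ∀ {A : S → E}, Measurable A → Integrable (fun ω => f (A ω)) μ := fun hA =>
    Integrable.of_bound (hK.continuous.measurable.comp hA).aestronglyMeasurable C
      (ae_of_all _ fun _ => hC _)
  rw [edist_eq_enorm_sub, ← integral_sub (hi hA) (hi hB), ← lintegral_const_mul' _ _ (by simp)]
  refine (enorm_integral_le_lintegral_enorm _).trans (lintegral_mono fun ω => ?_)
  rw [← edist_eq_enorm_sub]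
  exact hK _ _

/-- For a bounded Lipschitz function, chain and limit are each replaced by their discretisations at
`m` times, at a cost controlled by the expected distance; between the discretisations only
finite-dimensional distributions matter. -/
theorem tendstoInDistribution_spinPath {b : ℝ} {β : ℕ → ℝ} (hb : 0 < b)
    (hβ : Tendsto (fun n : ℕ => β n / n) atTop (𝓝 b)) {v : NNReal} (hv : (v : ℝ) = 1 / b)
    (θ₀ θ₁ : ℝ) {ρ : Measure C(unitInterval, ℝ)} [IsProbabilityMeasure ρ]
    [IsProbabilityMeasure (ρ.map expPath)]
    (hρ1 : ∀ᵐ c ∂ρ, expPath c 1 = Circle.exp θ₁)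
    (hρ : ∀ L : List (NNReal × C(Circle, ℂ)), listTime L < 1 →
        ∫ c, listVal L (extendPath (expPath c)) ∂ρ =
          transfer (fun d => rotAvg (gaussianReal 0 (d * v))) L
            (translate (Circle.exp θ₁) (heatKernel ((1 - listTime L : NNReal) * v)))
              (Circle.exp θ₀) /
            translate (Circle.exp θ₁) (heatKernel v) (Circle.exp θ₀)) :
    TendstoInDistribution (fun n => spinPath n) atTop id
      (fun n => gibbsMeasure n (β n) θ₀ θ₁) (ρ.map expPath) where
  forall_aemeasurable n := (continuous_spinPath n).measurable.aemeasurable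
  aemeasurable_limit := aemeasurable_id
  tendsto := by
    refine tendsto_iff_forall_lipschitz_integral_tendsto.2 ?_
    rintro f ⟨C, hC⟩ ⟨K, hK⟩
    have hfb : ∀ x, ‖f x‖ ≤ C + ‖f (expPath 0)‖ := fun x => by
      have h1 := hC x (expPath 0)
      rw [dist_eq_norm] at h1
      linarith [norm_sub_norm_le (f x) (f (expPath 0))]
    have e1 : ∫ x, f x ∂(ρ.map expPath).map id = ∫ c, f (expPath c) ∂ρ := by
      rw [Measure.map_id, integral_map continuous_expPath.measurable.aemeasurable
        hK.continuous.aestronglyMeasurable]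
    have e2 : ∀ n, ∫ x, f x ∂(gibbsMeasure n (β n) θ₀ θ₁).map (spinPath n) =
        ∫ θ, f (spinPath n θ) ∂gibbsMeasure n (β n) θ₀ θ₁ := fun n =>
      integral_map (continuous_spinPath n).measurable.aemeasurable
        hK.continuous.aestronglyMeasurable
    simp only [ProbabilityMeasure.coe_mk, e1, e2]
    obtain ⟨D, hD, hosc⟩ := exists_lintegral_edist_stepPath_le hb hβ θ₀ θ₁
    rw [EMetric.tendsto_nhds]
    intro η hη
    -- Four errors: the `δ` part and the `δ⁻³ D / m` part of the discretisation of the chain, the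
    -- finite-dimensional error, and the discretisation of the limit. The choice is `δ`, then `m`,
    -- then `n`.
    obtain ⟨q, hq0, hqt, hq⟩ : ∃ q : ENNReal, q ≠ 0 ∧ q ≠ ⊤ ∧ q + q + q + q < η := by
      obtain ⟨r, hr0, hr⟩ := ENNReal.lt_iff_exists_nnreal_btwn.1 hη
      have hr0' : r ≠ 0 := (ENNReal.coe_pos.1 hr0).ne'
      refine ⟨(r / 4 : NNReal), by simpa using hr0', ENNReal.coe_ne_top, ?_⟩
      refine lt_of_eq_of_lt ?_ hr
      norm_cast
      rw [← NNReal.coe_inj]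
      push_cast
      ring
    obtain ⟨δ, hδ0, hδt, hδ⟩ : ∃ δ : ENNReal, δ ≠ 0 ∧ δ ≠ ⊤ ∧ K * δ ≤ q := by
      refine ⟨q / (K + 1), by simp [hq0], ENNReal.div_ne_top hqt (by simp), ?_⟩
      calc K * (q / (K + 1)) ≤ (K + 1) * (q / (K + 1)) := by gcongr; exact le_self_add
        _ = q := ENNReal.mul_div_cancel (by simp) (by simp)
    have h1 : Tendsto (fun m : ℕ => K * (δ⁻¹ ^ 3 * (D / m))) atTop (𝓝 0) := by
      have h2 := ENNReal.Tendsto.const_mul (a := K * (δ⁻¹ ^ 3 * D))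
        ENNReal.tendsto_inv_nat_nhds_zero (Or.inr (ENNReal.mul_ne_top ENNReal.coe_ne_top
          (ENNReal.mul_ne_top (ENNReal.pow_ne_top (ENNReal.inv_ne_top.2 hδ0)) hD)))
      rw [mul_zero] at h2
      simpa only [div_eq_mul_inv, mul_assoc] using h2
    have h3 : Tendsto (fun m : ℕ => K * ∫⁻ c, edist (expPath c)
      (stepPath m fun j => extendPath (expPath c) (((j : ℕ) : NNReal) / m)) ∂ρ) atTop (𝓝 0) := by
      have := ENNReal.Tendsto.const_mul (a := (K : ENNReal)) (tendsto_lintegral_edist_expPath ρ)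
        (Or.inr ENNReal.coe_ne_top)
      rwa [mul_zero] at this
    have hq0' : 0 < q := pos_iff_ne_zero.2 hq0
    obtain ⟨m, ⟨hm1, hm3⟩, hm⟩ := (((h1.eventually (gt_mem_nhds hq0')).and
      (h3.eventually (gt_mem_nhds hq0'))).and (eventually_gt_atTop 0)).exists
    let f' : C(Fin (m + 1) → Circle, ℂ) := ⟨fun g => (f (stepPath m g) : ℂ),
      Complex.continuous_ofReal.comp (hK.continuous.comp (lipschitzWith_stepPath m).continuous)⟩
    have h4 := tendsto_integral_stepPath hb hβ hv θ₀ θ₁ hρ1 hρ hm f'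
    have h5 : Tendsto (fun n => ∫ θ, f (stepPath m fun j => spins n θ (n * j / m))
        ∂gibbsMeasure n (β n) θ₀ θ₁) atTop
        (𝓝 (∫ c, f (stepPath m fun j => extendPath (expPath c) (((j : ℕ) : NNReal) / m)) ∂ρ)) := by
      have h6 := (Complex.continuous_re.tendsto _).comp h4
      have e3 : ∫ c, f' (fun j => extendPath (expPath c) (((j : ℕ) : NNReal) / m)) ∂ρ =
        ((∫ c, f (stepPath m fun j => extendPath (expPath c) (((j : ℕ) : NNReal) / m)) ∂ρ : ℝ) : ℂ) :=
        integral_ofReal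
      rw [e3, Complex.ofReal_re] at h6
      refine h6.congr fun n => ?_
      have e4 : ∫ θ, f' (fun j => spins n θ (n * j / m)) ∂gibbsMeasure n (β n) θ₀ θ₁ =
        ((∫ θ, f (stepPath m fun j => spins n θ (n * j / m)) ∂gibbsMeasure n (β n) θ₀ θ₁ : ℝ) : ℂ) :=
        integral_ofReal
      rw [Function.comp_apply, e4, Complex.ofReal_re]
    filter_upwards [hosc m hm δ hδ0 hδt, (EMetric.tendsto_nhds.1 h5) q hq0'] with n hn1 hn2
    have hs : Measurable fun θ => stepPath m fun j : Fin (m + 1) => spins n θ (n * j / m) :=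
      ((lipschitzWith_stepPath m).continuous.comp (continuous_spins_times n m)).measurable
    have hs₀ : Measurable fun c => stepPath m fun j : Fin (m + 1) =>
        extendPath (expPath c) (((j : ℕ) : NNReal) / m) :=
      ((lipschitzWith_stepPath m).continuous.comp (continuous_extendPath m)).measurable
    have b1 := edist_integral_le (μ := gibbsMeasure n (β n) θ₀ θ₁) hK hfb
      (continuous_spinPath n).measurable hs
    have b2 := edist_integral_le (μ := ρ) hK hfb continuous_expPath.measurable hs₀
    have b3 : K * ∫⁻ θ, edist (spinPath n θ) (stepPath m fun j => spins n θ (n * j / m))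
        ∂gibbsMeasure n (β n) θ₀ θ₁ ≤ q + q := by
      calc _ ≤ K * (δ + δ⁻¹ ^ 3 * (D / m)) := by gcongr
        _ = K * δ + K * (δ⁻¹ ^ 3 * (D / m)) := mul_add _ _ _
        _ ≤ q + q := add_le_add hδ hm1.le
    refine lt_of_le_of_lt ?_ hq
    refine (edist_triangle4 _ _ _ _).trans
      (add_le_add (add_le_add (b1.trans b3) hn2.le) ?_)
    rw [edist_comm]
    exact b2.trans hm3.le

end XYChain
end

/-! ### The main theorem -/

theorem mainTheorem9 (b : ℝ) (hb : 0 < b) (β : ℕ → ℝ)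
    (hβ : Tendsto (fun n : ℕ => β n / n) atTop (𝓝 b)) :
    -- `S^n_{[nt]}` converges in distribution, for the Skorokhod topology, to `exp (i B(t) / √b)`,
    -- where `B` is a Brownian motion conditioned on its values modulo `2π√b` at times 0 and 1
    (∀ θ₀ ∈ Set.Ioc (-Real.pi) Real.pi, ∀ θ₁ ∈ Set.Ioc (-Real.pi) Real.pi,
      ∀ (Ω : Type*) [MeasurableSpace Ω] (P : Measure Ω) [IsProbabilityMeasure P]
        (W : NNReal → Ω → ℝ) (_ : IsBrownianReal W P)
        (x₀ : ℝ) (_ : Circle.exp (x₀ / √b) = Circle.exp θ₀)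
        (X : Ω → XYChain.SkorokhodSpace Circle)
        (_ : ∀ᵐ ω ∂P, ∀ t : unitInterval,
          X ω t = Circle.exp ((x₀ + W (unitInterval.toNNReal t) ω) / √b)),
        ∃ ν : ProbabilityMeasure (XYChain.SkorokhodSpace Circle),
          XYChain.IsConditionalLaw P X (fun ω => X ω 1) (Circle.exp θ₁) ν ∧
          TendstoInDistribution (fun n => XYChain.spinPath n) atTop id
            (fun n => XYChain.gibbsMeasure n (β n) θ₀ θ₁) (ν : Measure _)) ∧
    -- convergence of the ratios of partition functions
    (∀ θ₀ ∈ Set.Ioc (-Real.pi) Real.pi, ∀ θ₁ ∈ Set.Ioc (-Real.pi) Real.pi,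
      ∀ θ₀' ∈ Set.Ioc (-Real.pi) Real.pi, ∀ θ₁' ∈ Set.Ioc (-Real.pi) Real.pi,
        Tendsto
          (fun n : ℕ => XYChain.partitionFunction n (β n) θ₀ θ₁ /
            XYChain.partitionFunction n (β n) θ₀' θ₁')
          atTop
          (𝓝 ((∑' m : ℤ, Real.exp (-(b / 2) * (θ₁ - θ₀ + 2 * Real.pi * m) ^ 2)) /
            ∑' m : ℤ, Real.exp (-(b / 2) * (θ₁' - θ₀' + 2 * Real.pi * m) ^ 2)))) := by
  refine ⟨fun θ₀ _ θ₁ _ Ω _ P _ W hW x₀ hx₀ X hX => ?_, fun θ₀ _ θ₁ _ θ₀' _ θ₁' _ =>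
    XYChain.tendsto_partitionFunction_ratio hb hβ θ₀ θ₁ θ₀' θ₁'⟩
  set v : NNReal := ⟨1 / b, by positivity⟩ with hv_def
  have hvb : (v : ℝ) = 1 / b := rfl
  have hv : v ≠ 0 := by
    rw [← NNReal.coe_ne_zero, hvb]
    positivity
  have hX' : ∀ᵐ ω ∂P, ∀ t : unitInterval,
      X ω t = Circle.exp (x₀ / √b + √v * W (unitInterval.toNNReal t) ω) := by
    filter_upwards [hX] with ω h t
    rw [h, hvb, Real.sqrt_div zero_le_one, Real.sqrt_one]
    congr 1
    ring
  obtain ⟨ρ, hρ, hρp, hcond, hρ1, hfdd⟩ := XYChain.exists_conditionalLaw hW hv (x₀ / √b) θ₁ hX'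
  -- The starting angle `x₀ / √b` need not equal `θ₀`; the finite-dimensional distributions depend
  -- on it only through its point on the circle.
  rw [hx₀] at hfdd
  exact ⟨_, hcond, XYChain.tendstoInDistribution_spinPath hb hβ hvb θ₀ θ₁ hρ1 hfdd⟩
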